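/- Let $R=(X^*,X_*,R,\check R,\Pi)$ be a reduced and irreducible based root system in the sense of a root datum: $X^*,X_*$ are finitely generated free abelian groups in perfect duality $\langle\,,\,\rangle$, $R\subset X^*$ and $\check R\subset X_*$ are the finite sets of roots and coroots (with $R\neq\emptyset$), and $\Pi$ is a base of $R$. Let $V=X_*\otimes\mathbb R$, let $s_\alpha(x)=x-\langle\alpha,x\rangle\check\alpha$ and $s_{\alpha,k}(x)=x-(\langle\alpha,x\rangle-k)\check\alpha$ for $\alpha\in R$, $k\in\mathbb Z$, let $W_0\subset GL(V)$ be the group generated by all $s_\alpha$, let $W_{\rm aff}\subset{\rm Aff}(V)$ be the group generated by all $s_{\alpha,k}$ (the affine Weyl group), and let $\check Q\subset V$ be the lattice generated by $\check R$. Let $(\,,\,)$ be a $W_0$-invariant inner product on $V$; a root $\beta$ is also regarded as the vector $2\check\beta/(\check\beta,\check\beta)$ of $V$. Let $\Theta$ be an automorphism of $R$, i.e. a linear isometry of $(V,(\,,\,))$ leaving stable $X^*$, $R$ and $\Pi$, regarded as sets of functionals on $V$. Let $W_{\rm aff}^\Theta$, $W_0^\Theta$ be the subgroups of elements of $W_{\rm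 aff}$, $W_0$ commuting with $\Theta$, and let $\check Q^\Theta$ be the group of elements of $\check Q$ fixed by $\Theta$. Put $\mathcal Z=\{x\in X_*\mid\langle\alpha,x\rangle=0\ \forall\alpha\in R\}$, $X_*^{[\Theta]}=\{x\in X_*\mid x-\Theta(x)\in\mathcal Z\}$, $X^{*[\Theta]}={\rm Hom}(X_*^{[\Theta]},\mathbb Z)$ and $V^{[\Theta]}=X_*^{[\Theta]}\otimes\mathbb R\subset V$. For $\beta\in R$ let $\bar\Theta(\beta)\in V$ be the average of the $\Theta$-orbit of $\beta$. Let $R^{[\Theta]}$ be the set of all $\bar\Theta(\beta)$, $\beta\in R$, except those which are smaller multiples of others (those $v$ such that $cv=\bar\Theta(\gamma)$ for some real $c>1$ and some $\gamma\in R$). Let $\check R^{[\Theta]}=\{2\beta/(\beta,\beta)\mid\beta\in R^{[\Theta]}\}$. Let $\Pi^{[\Theta]}$ be the set of the elements $\bar\Theta(\tilde\alpha_\pi)$, where $\pi$ ranges over the $\Theta$-orbits in $\Pi$ and $\tilde\alpha_\pi$ is any highest root (i.e. a highest root of an irreducible component) of the root system $R\cap V_\pi$ with base $\pi$, $V_\pi$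 being the real span of $\pi$. Then $R^{[\Theta]}\subset V^{[\Theta]}$, every $\beta\in R^{[\Theta]}$ defines an element $x\mapsto(\beta,x)$ of $X^{*[\Theta]}$, $\check R^{[\Theta]}\subset X_*^{[\Theta]}$, and with these roots, the coroots $2\beta/(\beta,\beta)$ and the evaluation pairing, $(X^{*[\Theta]},X_*^{[\Theta]},R^{[\Theta]},\check R^{[\Theta]},\Pi^{[\Theta]})$ is a reduced and irreducible based root system in $V^{[\Theta]}$. Moreover $W_{\rm aff}^\Theta=\check Q^\Theta\rtimes W_0^\Theta$ (with $\check Q^\Theta$ acting by translations), every element of $W_{\rm aff}^\Theta$ preserves $V^{[\Theta]}$, and restriction to $V^{[\Theta]}$ is an isomorphism of $W_{\rm aff}^\Theta$ onto the affine Weyl group of this root system. -/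

import Mathlib

open scoped TensorProduct

noncomputable section

/-- The real vector space `V = X_* ⊗ ℝ` attached to a group `Y` of coweights. -/
abbrev CoweightSpace (Y : Type*) [AddCommGroup Y] : Type _ := ℝ ⊗[ℤ] Y

/-- The canonical map `X_* → V = X_* ⊗ ℝ`, `y ↦ 1 ⊗ y`. -/
def coweightIncl (Y : Type*) [AddCommGroup Y] : Y →+ CoweightSpace Y where
  toFun y := (1 : ℝ) ⊗ₜ[ℤ] y
  map_zero' := TensorProduct.tmul_zero _ _
  map_add' := TensorProduct.tmul_add _

lemma coweightIncl_apply {Y : Type*} [AddCommGroup Y] (y : Y) :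
    coweightIncl Y y = (1 : ℝ) ⊗ₜ[ℤ] y := rfl

/-- `GL(V)` acting on `V` by affine transformations. -/
def linearToAffine (V : Type*) [AddCommGroup V] [Module ℝ V] :
    (V ≃ₗ[ℝ] V) →* (V ≃ᵃ[ℝ] V) where
  toFun g := g.toAffineEquiv
  map_one' := rfl
  map_mul' _ _ := rfl

/-- The group of translations of `V` by the elements of an additive subgroup `L` of `V`. -/
def translationGroup {V : Type*} [AddCommGroup V] [Module ℝ V] (L : AddSubgroup V) :
    Subgroup (V ≃ᵃ[ℝ] V) :=
  (AddSubgroup.toSubgroup L).map (AffineEquiv.constVAddHom ℝ V)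

/-- `G` is the internal semidirect product `N ⋊ H` of its subgroups `N` (normal in `G`) and `H`. -/
def IsInternalSemidirect {Γ : Type*} [Group Γ] (N H G : Subgroup Γ) : Prop :=
  N ≤ G ∧ H ≤ G ∧ (N.subgroupOf G).Normal ∧
    Subgroup.IsComplement' (N.subgroupOf G) (H.subgroupOf G)

/-- The elements of a subgroup `G` that are fixed under conjugation by `t`. -/
def fixedUnderConj {Γ : Type*} [Group Γ] (t : Γ) (G : Subgroup Γ) : Subgroup Γ :=
  G ⊓ Subgroup.centralizer {t}

section Orbits

variable {V : Type*} [AddCommGroup V] [Module ℝ V]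

/-- The orbit of `v` under the cyclic group generated by `Θ`. -/
def cyclicOrbit (Θ : V ≃ₗ[ℝ] V) (v : V) : Set V :=
  {w | ∃ n : ℤ, (Θ ^ n) v = w}

/-- The average of the `Θ`-orbit of a vector `v` whose orbit is finite: the orbit consists of the
`p` distinct vectors `v, Θ v, …, Θ ^ (p - 1) v`, where `p` is the minimal period of `v`. -/
def orbitAverage (Θ : V ≃ₗ[ℝ] V) (v : V) : V :=
  (Function.minimalPeriod Θ v : ℝ)⁻¹ •
    ∑ k ∈ Finset.range (Function.minimalPeriod Θ v), (Θ ^ k) v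

/-- `γ` is a highest root of the (possibly reducible) root system `S` with base `π`: a maximal
element of `S` for the order `γ ≤ δ ↔ δ - γ ∈ ℕ π`. (The maximal elements are the highest roots of
the irreducible components.) -/
def IsHighestRoot (S π : Set V) (γ : V) : Prop :=
  γ ∈ S ∧ ∀ δ ∈ S, δ - γ ∈ AddSubmonoid.closure π → δ = γ

end Orbits

namespace RootPairing

variable {ι X Y : Type*} [AddCommGroup X] [AddCommGroup Y]

/-- Irreducibility of a root datum: there are roots, and the set of roots is not the disjoint union
of two nonempty mutually orthogonal subsets. -/
def IsIrreducibleDatum (P : RootPairing ι ℤ X Y) : Prop :=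
  Nonempty ι ∧ ∀ s : Set ι, s.Nonempty → sᶜ.Nonempty → ∃ i ∈ s, ∃ j ∈ sᶜ, P.pairing i j ≠ 0

/-- A weight `x ∈ X^*`, regarded as a linear functional on `V`. -/
def weightFunctional (P : RootPairing ι ℤ X Y) (x : X) : Module.Dual ℝ (CoweightSpace Y) :=
  (TensorProduct.AlgebraTensorModule.rid ℤ ℝ ℝ).toLinearMap ∘ₗ (P.toLinearMap x).baseChange ℝ

@[simp] lemma weightFunctional_tmul (P : RootPairing ι ℤ X Y) (x : X) (r : ℝ) (y : Y) :
    P.weightFunctional x (r ⊗ₜ[ℤ] y) = (P.toLinearMap x y : ℝ) * r := by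
  simp [weightFunctional]

/-- The coroot of index `i`, regarded as an element of `V`. -/
def realCoroot (P : RootPairing ι ℤ X Y) (i : ι) : CoweightSpace Y :=
  coweightIncl Y (P.coroot i)

lemma weightFunctional_realCoroot (P : RootPairing ι ℤ X Y) (i : ι) :
    P.weightFunctional (P.root i) (P.realCoroot i) = 2 := by
  rw [realCoroot, coweightIncl_apply, weightFunctional_tmul, P.root_coroot_two]
  norm_num

/-- The reflection `s_α(v) = v - ⟨α, v⟩ α̌` of `V`. -/
def realReflection (P : RootPairing ι ℤ X Y) (i : ι) : CoweightSpace Y ≃ₗ[ℝ] CoweightSpace Y :=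
  Module.reflection (P.weightFunctional_realCoroot i)

/-- The finite Weyl group `W_0`, as a group of linear transformations of `V`. -/
def realWeylGroup (P : RootPairing ι ℤ X Y) :
    Subgroup (CoweightSpace Y ≃ₗ[ℝ] CoweightSpace Y) :=
  Subgroup.closure (Set.range P.realReflection)

/-- The affine reflection `s_{α,k}` of `V`; see `affineReflection_apply`. -/
def affineReflection (P : RootPairing ι ℤ X Y) (i : ι) (k : ℤ) :
    CoweightSpace Y ≃ᵃ[ℝ] CoweightSpace Y :=
  (P.realReflection i).toAffineEquiv.trans
    (AffineEquiv.constVAdd ℝ (CoweightSpace Y) ((k : ℝ) • P.realCoroot i))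

lemma affineReflection_apply (P : RootPairing ι ℤ X Y) (i : ι) (k : ℤ) (v : CoweightSpace Y) :
    P.affineReflection i k v =
      v - (P.weightFunctional (P.root i) v - k) • P.realCoroot i := by
  simp only [affineReflection, realReflection, AffineEquiv.trans_apply,
    LinearEquiv.coe_toAffineEquiv, AffineEquiv.constVAdd_apply, Module.reflection_apply,
    vadd_eq_add]
  module

/-- The affine Weyl group `W_aff`: the group of affine transformations of `V` generated by all
reflections `s_{α,k}`. -/
def affineWeylGroup (P : RootPairing ι ℤ X Y) :
    Subgroup (CoweightSpace Y ≃ᵃ[ℝ] CoweightSpace Y) :=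
  Subgroup.closure (Set.range fun a : ι × ℤ ↦ P.affineReflection a.1 a.2)

/-- The coroot lattice `Q̌`, as a subgroup of `V`. -/
def corootLattice (P : RootPairing ι ℤ X Y) : AddSubgroup (CoweightSpace Y) :=
  AddSubgroup.closure (Set.range P.realCoroot)

/-- `B` is an inner product on `V` that is invariant under `W_0`. -/
structure IsInvariantInner (P : RootPairing ι ℤ X Y)
    (B : LinearMap.BilinForm ℝ (CoweightSpace Y)) : Prop where
  symm : ∀ v w, B v w = B w v
  pos : ∀ v, v ≠ 0 → 0 < B v v
  invariant : ∀ g ∈ P.realWeylGroup, ∀ v w, B (g v) (g w) = B v w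

/-- `Θ` is an automorphism of the based root datum: a linear isometry of `V` that leaves stable
the set `X^*`, the set of roots and the set of simple roots, regarded as functionals on `V`. -/
structure IsAutomorphism (P : RootPairing ι ℤ X Y) (b : P.Base)
    (B : LinearMap.BilinForm ℝ (CoweightSpace Y))
    (Θ : CoweightSpace Y ≃ₗ[ℝ] CoweightSpace Y) : Prop where
  isometry : ∀ v w, B (Θ v) (Θ w) = B v w
  weights : ∀ f : Module.Dual ℝ (CoweightSpace Y),
    f ∘ₗ Θ.toLinearMap ∈ Set.range P.weightFunctional ↔ f ∈ Set.range P.weightFunctional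
  roots : ∀ f : Module.Dual ℝ (CoweightSpace Y),
    f ∘ₗ Θ.toLinearMap ∈ Set.range (fun i ↦ P.weightFunctional (P.root i)) ↔
      f ∈ Set.range (fun i ↦ P.weightFunctional (P.root i))
  simpleRoots : ∀ f : Module.Dual ℝ (CoweightSpace Y),
    f ∘ₗ Θ.toLinearMap ∈ (fun i ↦ P.weightFunctional (P.root i)) '' (b.support : Set ι) ↔
      f ∈ (fun i ↦ P.weightFunctional (P.root i)) '' (b.support : Set ι)

/-- The root `β` of index `i`, regarded as the element `2 β̌ / (β̌, β̌)` of `V`. (For a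
`W_0`-invariant inner product this vector represents the functional `β`.) -/
def rootVector (P : RootPairing ι ℤ X Y) (B : LinearMap.BilinForm ℝ (CoweightSpace Y)) (i : ι) :
    CoweightSpace Y :=
  (2 / B (P.realCoroot i) (P.realCoroot i)) • P.realCoroot i

/-- The subgroup `𝒵` of the coweights on which all roots vanish. -/
def centralCoweights (P : RootPairing ι ℤ X Y) : AddSubgroup Y :=
  ⨅ i, (P.toLinearMap (P.root i)).toAddMonoidHom.ker

/-- `X_*^{[Θ]}`: the coweights `x` with `x - Θ x ∈ 𝒵`. -/
def foldedCoweights (P : RootPairing ι ℤ X Y) (Θ : CoweightSpace Y ≃ₗ[ℝ] CoweightSpace Y) :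
    AddSubgroup Y :=
  (P.centralCoweights.map (coweightIncl Y)).comap
    (coweightIncl Y - Θ.toLinearMap.toAddMonoidHom.comp (coweightIncl Y))

/-- The inclusion `V^{[Θ]} = X_*^{[Θ]} ⊗ ℝ → X_* ⊗ ℝ = V`. -/
def foldedIncl (P : RootPairing ι ℤ X Y) (Θ : CoweightSpace Y ≃ₗ[ℝ] CoweightSpace Y) :
    CoweightSpace (P.foldedCoweights Θ) →ₗ[ℝ] CoweightSpace Y :=
  (P.foldedCoweights Θ).subtype.toIntLinearMap.baseChange ℝ

/-- `R^{[Θ]}`, as a subset of `V`: the averages of the `Θ`-orbits of the roots, except those which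
are smaller multiples of others. -/
def foldedRoots (P : RootPairing ι ℤ X Y) (B : LinearMap.BilinForm ℝ (CoweightSpace Y))
    (Θ : CoweightSpace Y ≃ₗ[ℝ] CoweightSpace Y) : Set (CoweightSpace Y) :=
  {v | v ∈ Set.range (fun i ↦ orbitAverage Θ (P.rootVector B i)) ∧
    ∀ c : ℝ, 1 < c → c • v ∉ Set.range (fun i ↦ orbitAverage Θ (P.rootVector B i))}

/-- `Π^{[Θ]}`, as a subset of `V`: for each `Θ`-orbit `π` of simple roots, the average of the
`Θ`-orbit of a highest root of the root system `R ∩ V_π`, where `V_π` is the span of `π`. -/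
def foldedSimpleRoots (P : RootPairing ι ℤ X Y) (b : P.Base)
    (B : LinearMap.BilinForm ℝ (CoweightSpace Y))
    (Θ : CoweightSpace Y ≃ₗ[ℝ] CoweightSpace Y) : Set (CoweightSpace Y) :=
  {v | ∃ i ∈ b.support, ∃ γ : CoweightSpace Y,
    IsHighestRoot
      (Set.range (P.rootVector B) ∩ Submodule.span ℝ (cyclicOrbit Θ (P.rootVector B i)))
      (cyclicOrbit Θ (P.rootVector B i)) γ ∧
    v = orbitAverage Θ γ}

/-- `Q̌^Θ`: the elements of the coroot lattice fixed by `Θ`. -/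
def fixedCorootLattice (P : RootPairing ι ℤ X Y)
    (Θ : CoweightSpace Y ≃ₗ[ℝ] CoweightSpace Y) : AddSubgroup (CoweightSpace Y) :=
  P.corootLattice ⊓ (LinearMap.eqLocus Θ.toLinearMap LinearMap.id).toAddSubgroup

/-- `W_0^Θ`: the elements of `W_0` fixed under conjugation by `Θ`. -/
def fixedWeylGroup (P : RootPairing ι ℤ X Y) (Θ : CoweightSpace Y ≃ₗ[ℝ] CoweightSpace Y) :
    Subgroup (CoweightSpace Y ≃ₗ[ℝ] CoweightSpace Y) :=
  fixedUnderConj Θ P.realWeylGroup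

/-- `W_aff^Θ`: the elements of `W_aff` fixed under conjugation by `Θ`. -/
def fixedAffineWeylGroup (P : RootPairing ι ℤ X Y)
    (Θ : CoweightSpace Y ≃ₗ[ℝ] CoweightSpace Y) :
    Subgroup (CoweightSpace Y ≃ᵃ[ℝ] CoweightSpace Y) :=
  fixedUnderConj Θ.toAffineEquiv P.affineWeylGroup

/-- `Q` is the system `(X^{*[Θ]}, X_*^{[Θ]}, R^{[Θ]}, Ř^{[Θ]})`: it lives on `X_*^{[Θ]}` and its
dual `X^{*[Θ]} = Hom(X_*^{[Θ]}, ℤ)` with the evaluation pairing, its roots are the elements `β` of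
`R^{[Θ]}` regarded as the functionals `(β, ·)`, and the coroot of `β` is `2 β / (β, β)`. -/
structure IsFoldedDatum (P : RootPairing ι ℤ X Y) (B : LinearMap.BilinForm ℝ (CoweightSpace Y))
    (Θ : CoweightSpace Y ≃ₗ[ℝ] CoweightSpace Y)
    (Q : RootPairing (P.foldedRoots B Θ) ℤ
      (Module.Dual ℤ (P.foldedCoweights Θ)) (P.foldedCoweights Θ)) : Prop where
  pairing_eq : ∀ f y, Q.toLinearMap f y = f y
  root_eq : ∀ (β : P.foldedRoots B Θ) (y : P.foldedCoweights Θ),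
    ((Q.root β y : ℤ) : ℝ) = B (β : CoweightSpace Y) (coweightIncl Y (y : Y))
  coroot_eq : ∀ β : P.foldedRoots B Θ,
    coweightIncl Y (Q.coroot β : Y) =
      (2 / B (β : CoweightSpace Y) (β : CoweightSpace Y)) • (β : CoweightSpace Y)

end RootPairing

end

/-! The inner product turns weights into vectors of V, so the datum becomes a based root system in a
real inner product space (`BasedRootSystem`) and Θ becomes an isometry permuting its roots and
simple roots.

A folded root is an orbit average with no larger multiple among the averages. This maximality makes
the orbit orthogonal (`orthogonal`): two of its roots with negative product would add up to a root
whose average is twice as long, and two with positive product would differ by a root of average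
zero, impossible because averaging preserves height. Hence 2β/(β,β) is the sum of the coroots of the
orbit (`folded_coroot`), and the product of the orbit's commuting reflections lies in W_0, commutes
with Θ and acts on V^{[Θ]} as the reflection in β. Integrality and stability of the folded roots
follow; reducedness is maximality again.

For a simple root, the multiple c of its average that is folded is 1 or 2 (`eq_one_or_two`), and it
is reached by a highest root of the orbit's span. Descent in height writes each positive folded
root, and at the same time its coroot, in terms of these simple ones (`folded_mem_closure`).
Irreducibility descends because distinct simple roots have nonpositive products.

An element of W_aff commutes with Θ exactly when its translation part is fixed and its linear part
commutes. The linear parts are generated by the orbit reflections, by induction on the number of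
inversions (`mem_closure_of_commute`). The translations are generated by the simple folded coroots:
a fixed lattice vector has constant coefficients along orbits, and an orbit sum of simple coroots is
a folded coroot even when c = 2 (`dualVector_foldedSimple`). Restriction to V^{[Θ]} is faithful
because an element of W_0^Θ fixing all averages of simple roots keeps every simple root at height
one. -/

noncomputable section

/-! ### Based root systems: positivity, height and the exchange condition -/

/-- A reduced crystallographic root system in a real inner product space, with a base. The vectors
`root i` represent the roots through the form, and `coord j` gives the coefficient of a root at the
simple root of index `j`. -/
structure BasedRootSystem (ι V : Type*) [AddCommGroup V] [Module ℝ V] where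
  form : LinearMap.BilinForm ℝ V
  symm : ∀ v w, form v w = form w v
  pos : ∀ v, v ≠ 0 → 0 < form v v
  root : ι → V
  root_injective : Function.Injective root
  root_ne_zero : ∀ i, root i ≠ 0
  integral : ∀ i j, ∃ n : ℤ, form (root i) ((2 / form (root j) (root j)) • root j) = n
  reflection_mem : ∀ i j, ∃ k,
    root k = root i - form (root i) ((2 / form (root j) (root j)) • root j) • root j
  sub_mem : ∀ i j, i ≠ j → 0 < form (root i) (root j) → ∃ k, root k = root i - root j
  reduced : ∀ i j (c : ℝ), root i = c • root j → c = 1 ∨ c = -1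
  simple : Finset ι
  coord : ι → Module.Dual ℝ V
  coord_self : ∀ i ∈ simple, coord i (root i) = 1
  coord_of_ne : ∀ i ∈ simple, ∀ j ∈ simple, i ≠ j → coord i (root j) = 0
  root_eq_sum : ∀ i, root i = ∑ j ∈ simple, coord j (root i) • root j
  coord_int : ∀ i, ∀ j ∈ simple, ∃ n : ℤ, coord j (root i) = n
  coord_sign : ∀ i,
    (∀ j ∈ simple, 0 ≤ coord j (root i)) ∨ (∀ j ∈ simple, coord j (root i) ≤ 0)
  coroot_mem : ∀ i, (2 / form (root i) (root i)) • root i ∈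
    AddSubgroup.closure ((fun j ↦ (2 / form (root j) (root j)) • root j) '' (simple : Set ι))

namespace BasedRootSystem

variable {ι V : Type*} [AddCommGroup V] [Module ℝ V] (D : BasedRootSystem ι V)

/-- The coroot of index `i`. -/
def coroot (i : ι) : V := (2 / D.form (D.root i) (D.root i)) • D.root i

lemma form_self_pos (i : ι) : 0 < D.form (D.root i) (D.root i) :=
  D.pos _ (D.root_ne_zero i)

lemma form_self_eq_zero {v : V} (h : D.form v v = 0) : v = 0 := by
  by_contra hv
  exact (D.pos v hv).ne' h

lemma form_root_coroot_self (i : ι) : D.form (D.root i) (D.coroot i) = 2 := by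
  have := (D.form_self_pos i).ne'
  simp only [coroot, map_smul, smul_eq_mul]
  field_simp

lemma exists_neg (i : ι) : ∃ k, D.root k = -D.root i := by
  obtain ⟨k, hk⟩ := D.reflection_mem i i
  refine ⟨k, ?_⟩
  have := D.form_root_coroot_self i
  rw [coroot] at this
  rw [hk, this]
  module

/-- The reflection in the root of index `i`. -/
def reflection (i : ι) : V ≃ₗ[ℝ] V := Module.reflection (D.form_root_coroot_self i)

lemma reflection_apply (i : ι) (v : V) :
    D.reflection i v = v - D.form (D.root i) v • D.coroot i := by
  simp [reflection, Module.reflection_apply]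

lemma reflection_apply' (i : ι) (v : V) :
    D.reflection i v = v - D.form v (D.coroot i) • D.root i := by
  rw [reflection_apply, coroot, map_smul, smul_smul, D.symm v, smul_eq_mul, mul_comm]

lemma reflection_root_self (i : ι) : D.reflection i (D.root i) = -D.root i := by
  rw [reflection_apply', form_root_coroot_self]
  module

lemma reflection_mul_self (i : ι) : D.reflection i * D.reflection i = 1 := by
  ext v
  exact Module.involutive_reflection (D.form_root_coroot_self i) v

lemma reflection_inv (i : ι) : (D.reflection i)⁻¹ = D.reflection i :=
  inv_eq_of_mul_eq_one_left (D.reflection_mul_self i)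

lemma form_reflection (i : ι) (v w : V) :
    D.form (D.reflection i v) (D.reflection i w) = D.form v w := by
  have := (D.form_self_pos i).ne'
  simp only [reflection_apply, coroot, map_sub, map_smul, LinearMap.sub_apply, LinearMap.smul_apply,
    smul_eq_mul, D.symm v (D.root i)]
  field_simp
  ring

/-- The Weyl group. -/
def weyl : Subgroup (V ≃ₗ[ℝ] V) := Subgroup.closure (Set.range D.reflection)

lemma reflection_mem_weyl (i : ι) : D.reflection i ∈ D.weyl :=
  Subgroup.subset_closure ⟨i, rfl⟩

lemma form_weyl {g : V ≃ₗ[ℝ] V} (hg : g ∈ D.weyl) (v w : V) :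
    D.form (g v) (g w) = D.form v w := by
  induction hg using Subgroup.closure_induction generalizing v w with
  | mem x hx => obtain ⟨i, rfl⟩ := hx; exact D.form_reflection i v w
  | one => rfl
  | mul x y _ _ hx hy => rw [LinearEquiv.mul_apply, LinearEquiv.mul_apply, hx, hy]
  | inv x _ hx =>
    rw [← hx]
    simp

lemma exists_reflection_root (i j : ι) : ∃ k, D.root k = D.reflection i (D.root j) := by
  obtain ⟨k, hk⟩ := D.reflection_mem j i
  exact ⟨k, by rw [hk, reflection_apply', coroot]⟩

lemma exists_weyl_root {g : V ≃ₗ[ℝ] V} (hg : g ∈ D.weyl) (i : ι) :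
    ∃ k, D.root k = g (D.root i) := by
  rw [weyl] at hg
  induction hg using Subgroup.closure_induction'' generalizing i with
  | mem x hx => obtain ⟨j, rfl⟩ := hx; exact D.exists_reflection_root j i
  | inv_mem x hx =>
    obtain ⟨j, rfl⟩ := hx
    rw [reflection_inv]
    exact D.exists_reflection_root j i
  | one => exact ⟨i, rfl⟩
  | mul x y _ _ hx hy =>
    obtain ⟨j, hj⟩ := hy i
    obtain ⟨k, hk⟩ := hx j
    exact ⟨k, by rw [hk, hj]; rfl⟩

/-- A root is positive if its coefficients at the simple roots are nonnegative. -/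
def IsPos (i : ι) : Prop := ∀ j ∈ D.simple, 0 ≤ D.coord j (D.root i)

/-- The height functional. -/
def height : Module.Dual ℝ V := ∑ j ∈ D.simple, D.coord j

lemma height_apply (v : V) : D.height v = ∑ j ∈ D.simple, D.coord j v := by
  simp [height]

lemma height_simple {i : ι} (hi : i ∈ D.simple) : D.height (D.root i) = 1 := by
  rw [height_apply, Finset.sum_eq_single_of_mem i hi, D.coord_self i hi]
  exact fun j hj hji ↦ D.coord_of_ne j hj i hi hji

lemma isPos_simple {i : ι} (hi : i ∈ D.simple) : D.IsPos i := by
  intro j hj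
  by_cases h : j = i
  · subst h; rw [D.coord_self j hj]; exact zero_le_one
  · rw [D.coord_of_ne j hj i hi h]

lemma exists_coord_ne_zero (i : ι) : ∃ j ∈ D.simple, D.coord j (D.root i) ≠ 0 := by
  by_contra! h
  apply D.root_ne_zero i
  rw [D.root_eq_sum i]
  exact Finset.sum_eq_zero fun j hj ↦ by rw [h j hj, zero_smul]

variable {D} in
lemma IsPos.height_pos {i : ι} (hi : D.IsPos i) : 0 < D.height (D.root i) := by
  obtain ⟨j, hj, h⟩ := D.exists_coord_ne_zero i
  rw [height_apply]
  exact Finset.sum_pos' hi ⟨j, hj, lt_of_le_of_ne (hi j hj) h.symm⟩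

variable {D} in
lemma IsPos.of_neg {i k : ι} (hi : ¬ D.IsPos i) (hk : D.root k = -D.root i) : D.IsPos k := by
  intro j hj
  rw [hk, map_neg]
  have := (D.coord_sign i).resolve_left hi j hj
  linarith

variable {D} in
lemma isPos_iff {i : ι} : D.IsPos i ↔ 0 < D.height (D.root i) := by
  refine ⟨IsPos.height_pos, fun h ↦ ?_⟩
  by_contra hi
  obtain ⟨k, hk⟩ := D.exists_neg i
  have := (IsPos.of_neg hi hk).height_pos
  rw [hk, map_neg] at this
  linarith

lemma height_ne_zero (i : ι) : D.height (D.root i) ≠ 0 := by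
  by_cases h : D.IsPos i
  · exact h.height_pos.ne'
  · obtain ⟨k, hk⟩ := D.exists_neg i
    have := (IsPos.of_neg h hk).height_pos
    rw [hk, map_neg] at this
    linarith

variable {D} in
lemma not_isPos_iff {i : ι} : ¬ D.IsPos i ↔ D.height (D.root i) < 0 := by
  rw [isPos_iff, not_lt]
  exact ⟨fun h ↦ lt_of_le_of_ne h (D.height_ne_zero i), le_of_lt⟩

-- All coordinates of a root have one sign, so a single positive coordinate decides.
variable {D} in
lemma isPos_of_coord_pos {i j : ι} (hj : j ∈ D.simple) (h : 0 < D.coord j (D.root i)) :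
    D.IsPos i := by
  refine (D.coord_sign i).resolve_right fun h' ↦ ?_
  have := h' j hj
  linarith

lemma exists_height_eq_int (i : ι) : ∃ n : ℤ, D.height (D.root i) = n := by
  choose! f hf using fun j hj ↦ D.coord_int i j hj
  refine ⟨∑ j ∈ D.simple, f j, ?_⟩
  rw [height_apply]
  push_cast
  exact Finset.sum_congr rfl hf

lemma one_le_height {i : ι} (hi : D.IsPos i) : 1 ≤ D.height (D.root i) := by
  obtain ⟨n, hn⟩ := D.exists_height_eq_int i
  have := hi.height_pos
  rw [hn] at this ⊢
  exact_mod_cast this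

/-- With a positive product the difference would be a root having coordinates 1 and -1. -/
lemma form_simple_nonpos {i j : ι} (hi : i ∈ D.simple) (hj : j ∈ D.simple) (hij : i ≠ j) :
    D.form (D.root i) (D.root j) ≤ 0 := by
  by_contra! h
  obtain ⟨k, hk⟩ := D.sub_mem i j hij h
  have h1 : D.coord i (D.root k) = 1 := by
    rw [hk, map_sub, D.coord_self i hi, D.coord_of_ne i hi j hj hij, sub_zero]
  have h2 : D.coord j (D.root k) = -1 := by
    rw [hk, map_sub, D.coord_self j hj, D.coord_of_ne j hj i hi hij.symm, zero_sub]
  have := isPos_of_coord_pos hi (by rw [h1]; exact zero_lt_one) j hj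
  linarith

lemma coord_coroot_of_ne {i j : ι} (hi : i ∈ D.simple) (hj : j ∈ D.simple) (hij : i ≠ j) :
    D.coord i (D.coroot j) = 0 := by
  rw [coroot, map_smul, D.coord_of_ne i hi j hj hij, smul_zero]

/-- A simple reflection maps a positive root, other than the simple root itself, to a positive
root. -/
lemma IsPos.reflection {i j k : ι} (hj : D.IsPos j) (hi : i ∈ D.simple) (hij : j ≠ i)
    (hk : D.root k = D.reflection i (D.root j)) : D.IsPos k := by
  -- By reducedness, a positive root other than α_i involves a second simple root; the reflection
  -- does not change that coordinate.
  obtain ⟨l, hl, hli, h⟩ : ∃ l ∈ D.simple, l ≠ i ∧ D.coord l (D.root j) ≠ 0 := by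
    by_contra! h
    have h1 : D.root j = D.coord i (D.root j) • D.root i := by
      conv_lhs => rw [D.root_eq_sum j]
      refine Finset.sum_eq_single_of_mem i hi fun l hl hli ↦ ?_
      rw [h l hl hli, zero_smul]
    rcases D.reduced j i _ h1 with h2 | h2
    · rw [h2, one_smul] at h1
      exact hij (D.root_injective h1)
    · have := hj i hi
      linarith
  apply isPos_of_coord_pos hl
  rw [hk, reflection_apply, map_sub, map_smul, D.coord_coroot_of_ne hl hi hli, smul_zero, sub_zero]
  exact lt_of_le_of_ne (hj l hl) h.symm

-- Otherwise expanding one argument of (β, β) in simple roots gives a nonpositive sum.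
variable {D} in
lemma IsPos.exists_simple_form_pos {i : ι} (hi : D.IsPos i) :
    ∃ j ∈ D.simple, 0 < D.form (D.root j) (D.root i) := by
  by_contra! h
  have h1 : D.form (D.root i) (D.root i) =
      ∑ j ∈ D.simple, D.coord j (D.root i) * D.form (D.root j) (D.root i) := by
    conv_lhs => enter [1]; rw [D.root_eq_sum i]
    simp
  have := Finset.sum_nonpos fun j hj ↦ mul_nonpos_of_nonneg_of_nonpos (hi j hj) (h j hj)
  have := D.form_self_pos i
  linarith

/-- Induction on the roots through simple reflections. -/
lemma root_induction {p : ι → Prop} (hs : ∀ i ∈ D.simple, p i)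
    (hr : ∀ i ∈ D.simple, ∀ j k, D.root k = D.reflection i (D.root j) → p j → p k)
    (hn : ∀ j k, D.root k = -D.root j → p j → p k) (i : ι) : p i := by
  suffices ∀ n : ℕ, ∀ i, D.IsPos i → D.height (D.root i) ≤ n → p i by
    by_cases hi : D.IsPos i
    · obtain ⟨n, hn⟩ := exists_nat_ge (D.height (D.root i))
      exact this n i hi hn
    · obtain ⟨k, hk⟩ := D.exists_neg i
      obtain ⟨n, hn'⟩ := exists_nat_ge (D.height (D.root k))
      exact hn k i (by rw [hk, neg_neg]) (this n k (IsPos.of_neg hi hk) hn')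
  intro n
  induction n with
  | zero =>
    intro i hi h
    have := hi.height_pos
    simp only [Nat.cast_zero] at h
    linarith
  | succ n ih =>
    intro i hi h
    obtain ⟨j, hj, hji⟩ := hi.exists_simple_form_pos
    by_cases hij : i = j
    · exact hs i (hij ▸ hj)
    obtain ⟨k, hk⟩ := D.exists_reflection_root j i
    have hik : D.root i = D.reflection j (D.root k) := by
      rw [hk, ← LinearEquiv.mul_apply, reflection_mul_self]; rfl
    refine hr j hj k i hik (ih k (IsPos.reflection D hi hj hij hk) ?_)
    -- The pairing is a positive integer, so the reflection lowers the height by at least one.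
    obtain ⟨m, hm⟩ := D.integral i j
    have hm' : D.form (D.root i) (D.coroot j) = m := hm
    have h0 : 0 < D.form (D.root i) (D.coroot j) := by
      rw [coroot, map_smul, D.symm (D.root i), smul_eq_mul]
      exact mul_pos (div_pos two_pos (D.form_self_pos j)) hji
    rw [hk, reflection_apply', map_sub, map_smul, D.height_simple hj, hm', smul_eq_mul, mul_one]
    rw [hm'] at h0
    have : (1 : ℝ) ≤ m := by exact_mod_cast h0
    push_cast at h
    linarith

lemma reflection_eq_conj {g : V ≃ₗ[ℝ] V} (hg : ∀ v w, D.form (g v) (g w) = D.form v w)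
    {j k : ι} (hk : D.root k = g (D.root j)) : D.reflection k = g * D.reflection j * g⁻¹ := by
  ext v
  obtain ⟨u, rfl⟩ := g.surjective v
  have : g⁻¹ (g u) = u := by rw [← LinearEquiv.mul_apply, inv_mul_cancel]; rfl
  rw [LinearEquiv.mul_apply, LinearEquiv.mul_apply, this, reflection_apply', reflection_apply',
    coroot, coroot, hk, map_sub, map_smul, map_smul, map_smul, hg, hg]

/-- The Weyl group is generated by the simple reflections. -/
lemma weyl_eq_closure_simple :
    D.weyl = Subgroup.closure (D.reflection '' (D.simple : Set ι)) := by
  apply le_antisymm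
  · rw [weyl, Subgroup.closure_le]
    rintro _ ⟨i, rfl⟩
    refine D.root_induction (p := fun i ↦ D.reflection i ∈
      Subgroup.closure (D.reflection '' (D.simple : Set ι))) ?_ ?_ ?_ i
    · exact fun i hi ↦ Subgroup.subset_closure ⟨i, hi, rfl⟩
    · intro i hi j k hk h
      rw [D.reflection_eq_conj (D.form_reflection i) hk]
      have := Subgroup.subset_closure (Set.mem_image_of_mem D.reflection (Finset.mem_coe.2 hi))
      exact mul_mem (mul_mem this h) (inv_mem this)
    · intro j k hk h
      convert h using 1
      ext v
      rw [reflection_apply, reflection_apply, coroot, coroot, hk]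
      simp
  · exact Subgroup.closure_mono (Set.image_subset_range _ _)

lemma exists_word {g : V ≃ₗ[ℝ] V} (hg : g ∈ D.weyl) :
    ∃ l : List ι, (∀ i ∈ l, i ∈ D.simple) ∧ (l.map D.reflection).prod = g := by
  rw [weyl_eq_closure_simple] at hg
  induction hg using Subgroup.closure_induction'' with
  | mem x hx =>
    obtain ⟨i, hi, rfl⟩ := hx
    exact ⟨[i], by simpa using hi, by simp⟩
  | inv_mem x hx =>
    obtain ⟨i, hi, rfl⟩ := hx
    exact ⟨[i], by simpa using hi, by simp [reflection_inv]⟩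
  | one => exact ⟨[], by simp, by simp⟩
  | mul x y _ _ hx hy =>
    obtain ⟨l, hl, rfl⟩ := hx
    obtain ⟨m, hm, rfl⟩ := hy
    refine ⟨l ++ m, fun i hi ↦ ?_, by simp⟩
    rcases List.mem_append.1 hi with h | h
    exacts [hl i h, hm i h]

lemma word_mem_weyl (l : List ι) : (l.map D.reflection).prod ∈ D.weyl :=
  Subgroup.list_prod_mem _ fun x hx ↦ by
    obtain ⟨i, _, rfl⟩ := List.mem_map.1 hx
    exact D.reflection_mem_weyl i

/-- The exchange condition. -/
lemma exchange {i : ι} (hi : i ∈ D.simple) (l : List ι) (hl : ∀ j ∈ l, j ∈ D.simple)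
    (h : D.height ((l.map D.reflection).prod (D.root i)) < 0) :
    ∃ m : List ι, (∀ j ∈ m, j ∈ D.simple) ∧ m.length + 1 = l.length ∧
      (m.map D.reflection).prod = (l.map D.reflection).prod * D.reflection i := by
  induction l with
  | nil =>
    have := D.height_simple hi
    simp only [List.map_nil, List.prod_nil, LinearEquiv.coe_one, id_eq] at h
    linarith
  | cons j t ih =>
    have hj : j ∈ D.simple := hl j (by simp)
    have ht : ∀ k ∈ t, k ∈ D.simple := fun k hk ↦ hl k (by simp [hk])
    obtain ⟨k, hk⟩ := D.exists_weyl_root (D.word_mem_weyl t) i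
    by_cases hp : D.IsPos k
    -- The tail t keeps α_i positive and s_j then makes it negative. Only α_j itself behaves so
    -- under s_j, hence t α_i = α_j, s_j = t s_i t⁻¹, and the first letter can be deleted.
    · refine ⟨t, ht, by simp, ?_⟩
      have hkj : k = j := by
        by_contra hkj
        obtain ⟨k', hk'⟩ := D.exists_reflection_root j k
        have := (IsPos.reflection D hp hj hkj hk').height_pos
        rw [hk', hk] at this
        simp only [List.map_cons, List.prod_cons, LinearEquiv.mul_apply] at h
        linarith
      subst hkj
      rw [List.map_cons, List.prod_cons,
        D.reflection_eq_conj (D.form_weyl (D.word_mem_weyl t)) hk, inv_mul_cancel_right,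
        mul_assoc, reflection_mul_self, mul_one]
    · rw [not_isPos_iff, hk] at hp
      obtain ⟨m, hm, hmt, hm'⟩ := ih ht hp
      refine ⟨j :: m, by simpa using ⟨hj, hm⟩, by simp [hmt], ?_⟩
      rw [List.map_cons, List.prod_cons, hm', List.map_cons, List.prod_cons, mul_assoc]

/-- An element of the Weyl group that preserves positivity is trivial. -/
lemma eq_one_of_forall_height_pos {g : V ≃ₗ[ℝ] V} (hg : g ∈ D.weyl)
    (h : ∀ i ∈ D.simple, 0 < D.height (g (D.root i))) : g = 1 := by
  classical
  have hex : ∃ n, ∃ l : List ι, l.length = n ∧ (∀ i ∈ l, i ∈ D.simple) ∧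
      (l.map D.reflection).prod = g := by
    obtain ⟨l, h1, h2⟩ := D.exists_word hg
    exact ⟨_, l, rfl, h1, h2⟩
  obtain ⟨l, hn, hl, rfl⟩ := Nat.find_spec hex
  -- The word has minimal length. If it ends in i, then t already makes α_i negative, and the
  -- exchange condition yields a shorter word.
  rcases List.eq_nil_or_concat l with rfl | ⟨t, i, rfl⟩
  · simp
  · exfalso
    have hi : i ∈ D.simple := hl i (by simp)
    have ht : ∀ k ∈ t, k ∈ D.simple := fun k hk ↦ hl k (by simp [hk])
    have h1 := h i hi
    simp only [List.concat_eq_append, List.map_append, List.map_cons, List.map_nil,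
      List.prod_append, List.prod_cons, List.prod_nil, mul_one, LinearEquiv.mul_apply,
      reflection_root_self, map_neg] at h1
    obtain ⟨m, hm, hmt, hm'⟩ := D.exchange hi t ht (by linarith)
    refine Nat.find_min hex (m := m.length) ?_ ⟨m, rfl, hm, ?_⟩
    · rw [← hn]; simp; omega
    · rw [hm']; simp

end BasedRootSystem

/-! ### Automorphisms, orbit averages and folded roots -/

namespace BasedRootSystem

variable {ι V : Type*} [AddCommGroup V] [Module ℝ V] {D : BasedRootSystem ι V}

/-- An automorphism of a based root system. -/
structure Automorphism (D : BasedRootSystem ι V) where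
  lin : V ≃ₗ[ℝ] V
  perm : Equiv.Perm ι
  isometry : ∀ v w, D.form (lin v) (lin w) = D.form v w
  map_root : ∀ i, lin (D.root i) = D.root (perm i)
  map_simple : ∀ i, perm i ∈ D.simple ↔ i ∈ D.simple

namespace Automorphism

open Classical in
/-- The orbit of an index. -/
def orbit [Fintype ι] (T : D.Automorphism) (i : ι) : Finset ι :=
  Finset.univ.filter (T.perm.SameCycle i)

/-- The averaging operator over the powers of an automorphism. -/
def avg (T : D.Automorphism) : V →ₗ[ℝ] V :=
  (orderOf T.perm : ℝ)⁻¹ • ∑ k ∈ Finset.range (orderOf T.perm), (T.lin ^ k).toLinearMap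

lemma avg_apply (T : D.Automorphism) (v : V) :
    T.avg v = (orderOf T.perm : ℝ)⁻¹ • ∑ k ∈ Finset.range (orderOf T.perm), (T.lin ^ k) v := by
  simp [avg]

/-- The averages of the orbits of the roots, except those which are smaller multiples of others. -/
def folded (T : D.Automorphism) : Set V :=
  {v | v ∈ Set.range (fun i ↦ orbitAverage T.lin (D.root i)) ∧
    ∀ c : ℝ, 1 < c → c • v ∉ Set.range (fun i ↦ orbitAverage T.lin (D.root i))}

/-- The positive multiples of averages of simple roots among the folded roots. -/
def foldedSimple (T : D.Automorphism) : Set V :=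
  {v | v ∈ T.folded ∧ ∃ i ∈ D.simple, ∃ c : ℝ, 0 < c ∧ v = c • T.avg (D.root i)}

lemma pow_root (T : D.Automorphism) (k : ℕ) (i : ι) :
    (T.lin ^ k) (D.root i) = D.root ((T.perm ^ k) i) := by
  induction k with
  | zero => rfl
  | succ k ih =>
    rw [pow_succ', pow_succ', LinearEquiv.mul_apply, ih, T.map_root, Equiv.Perm.mul_apply]

lemma map_coroot (T : D.Automorphism) (i : ι) : T.lin (D.coroot i) = D.coroot (T.perm i) := by
  rw [coroot, map_smul, coroot, ← T.map_root, T.isometry]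

lemma coord_perm (T : D.Automorphism) {j : ι} (hj : j ∈ D.simple) (i : ι) :
    D.coord (T.perm j) (D.root (T.perm i)) = D.coord j (D.root i) := by
  rw [← T.map_root]
  conv_lhs => rw [D.root_eq_sum i]
  rw [map_sum, map_sum, Finset.sum_eq_single_of_mem j hj]
  · rw [map_smul, map_smul, T.map_root, D.coord_self _ ((T.map_simple j).2 hj), smul_eq_mul,
      mul_one]
  · intro k hk hkj
    rw [map_smul, map_smul, T.map_root, D.coord_of_ne _ ((T.map_simple j).2 hj) _
      ((T.map_simple k).2 hk) fun h ↦ hkj (T.perm.injective h).symm, smul_zero]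

lemma pow_apply_of_fixed (T : D.Automorphism) {v : V} (hv : T.lin v = v) (k : ℕ) :
    (T.lin ^ k) v = v := by
  induction k with
  | zero => rfl
  | succ k ih => rw [pow_succ', LinearEquiv.mul_apply, ih, hv]

lemma sum_pow_root_succ (T : D.Automorphism) (i : ι) :
    ∑ k ∈ Finset.range (orderOf T.perm), (T.lin ^ (k + 1)) (D.root i) =
      ∑ k ∈ Finset.range (orderOf T.perm), (T.lin ^ k) (D.root i) := by
  have h1 := Finset.sum_range_succ (fun k ↦ (T.lin ^ k) (D.root i)) (orderOf T.perm)
  have h2 := Finset.sum_range_succ' (fun k ↦ (T.lin ^ k) (D.root i)) (orderOf T.perm)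
  rw [h1, T.pow_root, pow_orderOf_eq_one] at h2
  simpa using h2.symm

lemma height_perm (T : D.Automorphism) (i : ι) :
    D.height (D.root (T.perm i)) = D.height (D.root i) := by
  rw [height_apply, height_apply]
  refine (Finset.sum_equiv T.perm (fun j ↦ (T.map_simple j).symm) fun j hj ↦ ?_).symm
  exact (T.coord_perm hj i).symm

/-- Invariance of v is required only as the roots see it, because vectors of V^{[Θ]} are fixed by Θ
only modulo the common kernel of the roots. -/
lemma form_perm (T : D.Automorphism) {v : V}
    (hv : ∀ j, D.form (D.root j) (T.lin v) = D.form (D.root j) v) (i : ι) :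
    D.form (D.root (T.perm i)) v = D.form (D.root i) v := by
  rw [← hv, ← T.map_root, T.isometry]

lemma avg_commute (T : D.Automorphism) {g : V ≃ₗ[ℝ] V} (hg : Commute g T.lin) (v : V) :
    T.avg (g v) = g (T.avg v) := by
  rw [avg_apply, avg_apply, map_smul, map_sum]
  congr 1
  refine Finset.sum_congr rfl fun k _ ↦ ?_
  rw [← LinearEquiv.mul_apply, ← LinearEquiv.mul_apply, (hg.pow_right k).eq]

lemma avg_perm (T : D.Automorphism) (i : ι) :
    T.avg (D.root (T.perm i)) = T.avg (D.root i) := by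
  rw [avg_apply, avg_apply, ← T.sum_pow_root_succ i, ← T.map_root]
  simp only [pow_succ, LinearEquiv.mul_apply]

lemma lin_avg (T : D.Automorphism) (i : ι) : T.lin (T.avg (D.root i)) = T.avg (D.root i) := by
  rw [avg_apply, map_smul, map_sum, ← sum_pow_root_succ]
  simp only [pow_succ', LinearEquiv.mul_apply]

variable [Fintype ι]

@[simp] lemma mem_orbit (T : D.Automorphism) {i j : ι} :
    j ∈ T.orbit i ↔ T.perm.SameCycle i j := by
  simp [orbit]

lemma self_mem_orbit (T : D.Automorphism) (i : ι) : i ∈ T.orbit i := by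
  rw [mem_orbit]

lemma card_orbit_pos (T : D.Automorphism) (i : ι) : (0 : ℝ) < (T.orbit i).card := by
  exact_mod_cast Finset.card_pos.2 ⟨i, T.self_mem_orbit i⟩

lemma orbit_eq (T : D.Automorphism) {i j : ι} (h : j ∈ T.orbit i) : T.orbit j = T.orbit i := by
  ext k
  rw [mem_orbit] at h
  rw [mem_orbit, mem_orbit]
  exact ⟨h.trans, h.symm.trans⟩

lemma perm_mem_orbit (T : D.Automorphism) {i j : ι} : T.perm j ∈ T.orbit i ↔ j ∈ T.orbit i := by
  simp

lemma exists_pow_of_mem_orbit (T : D.Automorphism) {i j : ι} (h : j ∈ T.orbit i) :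
    ∃ k : ℕ, (T.perm ^ k) i = j :=
  (T.mem_orbit.1 h).exists_nat_pow_eq

lemma orbit_induction (T : D.Automorphism) {p : ι → Prop} {i j : ι} (h : j ∈ T.orbit i) (hi : p i)
    (hp : ∀ k, p k → p (T.perm k)) : p j := by
  obtain ⟨k, rfl⟩ := T.exists_pow_of_mem_orbit h
  induction k with
  | zero => exact hi
  | succ k ih =>
    rw [pow_succ', Equiv.Perm.mul_apply]
    exact hp _ (ih (by simp [Equiv.Perm.SameCycle.rfl]))

lemma eq_of_mem_orbit {α : Type*} (T : D.Automorphism) {f : ι → α} (hf : ∀ k, f (T.perm k) = f k)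
    {i j : ι} (h : j ∈ T.orbit i) : f j = f i :=
  T.orbit_induction (p := fun j ↦ f j = f i) h rfl fun k hk ↦ (hf k).trans hk

lemma sum_orbit_perm {M : Type*} [AddCommMonoid M] (T : D.Automorphism) (f : ι → M) (i : ι) :
    ∑ j ∈ T.orbit i, f (T.perm j) = ∑ j ∈ T.orbit i, f j :=
  Finset.sum_equiv T.perm (fun _ ↦ T.perm_mem_orbit.symm) fun _ _ ↦ rfl

lemma simple_of_mem_orbit (T : D.Automorphism) {i j : ι} (h : j ∈ T.orbit i) :
    j ∈ D.simple ↔ i ∈ D.simple := by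
  have := T.eq_of_mem_orbit (f := (· ∈ D.simple)) (fun k ↦ propext (T.map_simple k)) h
  exact Iff.of_eq this

lemma form_self_of_mem_orbit (T : D.Automorphism) {i j : ι} (h : j ∈ T.orbit i) :
    D.form (D.root j) (D.root j) = D.form (D.root i) (D.root i) :=
  T.eq_of_mem_orbit (f := fun j ↦ D.form (D.root j) (D.root j))
    (fun k ↦ by simp only [← T.map_root, T.isometry]) h

lemma lin_sum_root (T : D.Automorphism) (i : ι) :
    T.lin (∑ j ∈ T.orbit i, D.root j) = ∑ j ∈ T.orbit i, D.root j := by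
  rw [map_sum, ← T.sum_orbit_perm D.root]
  exact Finset.sum_congr rfl fun j _ ↦ T.map_root j

lemma order_pos (T : D.Automorphism) : (0 : ℝ) < orderOf T.perm := by
  exact_mod_cast orderOf_pos T.perm

lemma avg_of_fixed (T : D.Automorphism) {v : V} (hv : T.lin v = v) : T.avg v = v := by
  rw [avg_apply, Finset.sum_congr rfl fun k _ ↦ T.pow_apply_of_fixed hv k, Finset.sum_const,
    Finset.card_range, ← Nat.cast_smul_eq_nsmul ℝ, smul_smul, inv_mul_cancel₀ T.order_pos.ne',
    one_smul]

lemma avg_of_mem_orbit (T : D.Automorphism) {i j : ι} (h : j ∈ T.orbit i) :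
    T.avg (D.root j) = T.avg (D.root i) :=
  T.eq_of_mem_orbit (f := fun j ↦ T.avg (D.root j)) T.avg_perm h

/-- The orbit sum is fixed, hence is its own average, and all its terms have the same average. -/
lemma card_smul_avg (T : D.Automorphism) (i : ι) :
    ((T.orbit i).card : ℝ) • T.avg (D.root i) = ∑ j ∈ T.orbit i, D.root j := by
  rw [← T.avg_of_fixed (T.lin_sum_root i), map_sum,
    Finset.sum_congr rfl fun j hj ↦ T.avg_of_mem_orbit hj, Finset.sum_const,
    ← Nat.cast_smul_eq_nsmul ℝ]

lemma avg_eq (T : D.Automorphism) (i : ι) :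
    T.avg (D.root i) = ((T.orbit i).card : ℝ)⁻¹ • ∑ j ∈ T.orbit i, D.root j := by
  rw [← T.card_smul_avg, smul_smul, inv_mul_cancel₀ (T.card_orbit_pos i).ne', one_smul]

lemma sum_range_minimalPeriod {M : Type*} [AddCommMonoid M] (T : D.Automorphism) (f : ι → M)
    (i : ι) :
    ∑ k ∈ Finset.range (Function.minimalPeriod T.perm i), f ((T.perm ^ k) i) =
      ∑ j ∈ T.orbit i, f j := by
  refine Finset.sum_nbij (fun k ↦ (T.perm ^ k) i) (fun k _ ↦ by simp [Equiv.Perm.SameCycle.rfl])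
    ?_ ?_ fun _ _ ↦ rfl
  · have := Function.iterate_injOn_Iio_minimalPeriod (f := T.perm) (x := i)
    simpa [Equiv.Perm.iterate_eq_pow] using this
  · intro j hj
    obtain ⟨k, rfl⟩ := T.exists_pow_of_mem_orbit hj
    have hp : i ∈ Function.periodicPts T.perm :=
      Function.mk_mem_periodicPts (orderOf_pos T.perm) (by
        rw [Function.IsPeriodicPt, Equiv.Perm.iterate_eq_pow, pow_orderOf_eq_one]
        exact rfl)
    refine ⟨k % Function.minimalPeriod T.perm i, ?_, ?_⟩
    · simpa using Nat.mod_lt _ (Function.minimalPeriod_pos_of_mem_periodicPts hp)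
    · simp only [← Equiv.Perm.iterate_eq_pow]
      exact Function.iterate_mod_minimalPeriod_eq

/-- Root vectors are distinct, so the period of a vector equals the period of its index. The average
over an orbit, whose length varies, thereby becomes the value of one linear operator. -/
lemma orbitAverage_root (T : D.Automorphism) (i : ι) :
    orbitAverage T.lin (D.root i) = T.avg (D.root i) := by
  have hp : Function.minimalPeriod T.lin (D.root i) = Function.minimalPeriod T.perm i := by
    rw [Function.minimalPeriod_eq_minimalPeriod_iff]
    intro n
    have h : T.lin^[n] (D.root i) = D.root (T.perm^[n] i) := by
      rw [Equiv.Perm.iterate_eq_pow, ← pow_root]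
      induction n with
      | zero => rfl
      | succ n ih => rw [Function.iterate_succ_apply', ih, pow_succ', LinearEquiv.mul_apply]
    rw [Function.IsPeriodicPt, Function.IsFixedPt, h, D.root_injective.eq_iff]
    rfl
  have hc := T.sum_range_minimalPeriod (fun _ ↦ (1 : ℕ)) i
  simp only [Finset.sum_const, Finset.card_range, smul_eq_mul, mul_one] at hc
  rw [orbitAverage, hp, avg_eq, ← hc, ← T.sum_range_minimalPeriod D.root]
  simp only [T.pow_root]

lemma mem_folded_iff (T : D.Automorphism) {v : V} :
    v ∈ T.folded ↔ (∃ i, T.avg (D.root i) = v) ∧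
      ∀ c : ℝ, 1 < c → ∀ j, T.avg (D.root j) ≠ c • v := by
  simp [folded, orbitAverage_root]

lemma finite_folded (T : D.Automorphism) : T.folded.Finite :=
  (Set.finite_range _).subset fun _ h ↦ h.1

/-- Θ permutes the simple roots, so height is constant on orbits. Since heights of roots are
nonzero, no average of a root vanishes. -/
lemma height_avg (T : D.Automorphism) (i : ι) :
    D.height (T.avg (D.root i)) = D.height (D.root i) := by
  rw [avg_eq, map_smul, map_sum, Finset.sum_congr rfl fun j hj ↦
    T.eq_of_mem_orbit (f := fun j ↦ D.height (D.root j)) T.height_perm hj, Finset.sum_const,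
    ← Nat.cast_smul_eq_nsmul ℝ, smul_smul, inv_mul_cancel₀ (T.card_orbit_pos i).ne', one_smul]

lemma avg_ne_zero (T : D.Automorphism) (i : ι) : T.avg (D.root i) ≠ 0 := fun h ↦
  D.height_ne_zero i (by rw [← T.height_avg, h, map_zero])

lemma folded_ne_zero (T : D.Automorphism) {β : V} (h : β ∈ T.folded) : β ≠ 0 := by
  obtain ⟨⟨i, rfl⟩, -⟩ := T.mem_folded_iff.1 h
  exact T.avg_ne_zero i

lemma lin_folded (T : D.Automorphism) {β : V} (h : β ∈ T.folded) : T.lin β = β := by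
  obtain ⟨⟨i, rfl⟩, -⟩ := T.mem_folded_iff.1 h
  exact T.lin_avg i

lemma form_of_mem_orbit (T : D.Automorphism) {v : V}
    (hv : ∀ j, D.form (D.root j) (T.lin v) = D.form (D.root j) v) {i j : ι} (h : j ∈ T.orbit i) :
    D.form (D.root j) v = D.form (D.root i) v :=
  T.eq_of_mem_orbit (f := fun j ↦ D.form (D.root j) v) (T.form_perm hv) h

lemma form_avg (T : D.Automorphism) {v : V}
    (hv : ∀ j, D.form (D.root j) (T.lin v) = D.form (D.root j) v) (i : ι) :
    D.form (T.avg (D.root i)) v = D.form (D.root i) v := by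
  rw [avg_eq, map_smul, map_sum, LinearMap.smul_apply, LinearMap.sum_apply,
    Finset.sum_congr rfl fun j hj ↦ T.form_of_mem_orbit hv hj, Finset.sum_const,
    ← Nat.cast_smul_eq_nsmul ℝ, smul_smul, inv_mul_cancel₀ (T.card_orbit_pos i).ne', one_smul]

lemma form_avg_avg (T : D.Automorphism) (i j : ι) :
    D.form (T.avg (D.root i)) (T.avg (D.root j)) = D.form (D.root i) (T.avg (D.root j)) :=
  T.form_avg (fun _ ↦ by rw [T.lin_avg]) i

/-- Every average of an orbit of roots has a multiple which is a folded root. -/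
lemma exists_smul_avg_mem_folded (T : D.Automorphism) (i : ι) :
    ∃ c : ℝ, 1 ≤ c ∧ c • T.avg (D.root i) ∈ T.folded := by
  -- Take the longest among the finitely many averages that are multiples of the given one by a
  -- factor at least 1.
  obtain ⟨j, ⟨c, hc, hj⟩, hmax⟩ := Set.exists_max_image
    {j | ∃ c : ℝ, 1 ≤ c ∧ T.avg (D.root j) = c • T.avg (D.root i)}
    (fun j ↦ D.form (T.avg (D.root j)) (T.avg (D.root j))) (Set.toFinite _)
    ⟨i, 1, le_rfl, (one_smul _ _).symm⟩
  refine ⟨c, hc, T.mem_folded_iff.2 ⟨⟨j, hj⟩, fun d hd k hk ↦ ?_⟩⟩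
  have h := hmax k ⟨d * c, by nlinarith, by rw [hk, mul_smul]⟩
  rw [← hj] at hk
  have hp := D.pos _ (T.avg_ne_zero j)
  simp only [hk, map_smul, LinearMap.smul_apply, smul_eq_mul] at h
  nlinarith [mul_pos (sub_pos.2 hd) hp, mul_pos (mul_pos (sub_pos.2 hd) hp) (by linarith : 0 < d)]

/-- Of two averages on one ray the shorter is a smaller multiple of the longer, so maximality leaves
one folded root per ray. -/
lemma eq_of_smul_mem_folded (T : D.Automorphism) {β β' : V} (h : β ∈ T.folded)
    (h' : β' ∈ T.folded) {c : ℝ} (hc : 0 < c) (he : β' = c • β) : β' = β := by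
  obtain ⟨⟨i, hi⟩, h1⟩ := T.mem_folded_iff.1 h
  obtain ⟨⟨j, hj⟩, h2⟩ := T.mem_folded_iff.1 h'
  rcases lt_trichotomy c 1 with hc1 | rfl | hc1
  · refine absurd ?_ (h2 c⁻¹ ((one_lt_inv₀ hc).2 hc1) i)
    rw [hi, he, smul_smul, inv_mul_cancel₀ hc.ne', one_smul]
  · rw [he, one_smul]
  · exact absurd (hj.trans he) (h1 c hc1 j)

lemma neg_mem_folded (T : D.Automorphism) {β : V} (h : β ∈ T.folded) : -β ∈ T.folded := by
  obtain ⟨⟨i, rfl⟩, h1⟩ := T.mem_folded_iff.1 h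
  obtain ⟨k, hk⟩ := D.exists_neg i
  refine T.mem_folded_iff.2 ⟨⟨k, by rw [hk, map_neg]⟩, fun c hc j hj ↦ ?_⟩
  obtain ⟨l, hl⟩ := D.exists_neg j
  exact h1 c hc l (by rw [hl, map_neg, hj, smul_neg, neg_neg])

lemma map_mem_folded (T : D.Automorphism) {g : V ≃ₗ[ℝ] V} (hw : g ∈ D.weyl)
    (hg : Commute g T.lin) {β : V} (h : β ∈ T.folded) : g β ∈ T.folded := by
  obtain ⟨⟨i, rfl⟩, h1⟩ := T.mem_folded_iff.1 h
  obtain ⟨k, hk⟩ := D.exists_weyl_root hw i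
  refine T.mem_folded_iff.2 ⟨⟨k, by rw [hk, T.avg_commute hg]⟩, fun c hc j hj ↦ ?_⟩
  obtain ⟨l, hl⟩ := D.exists_weyl_root (inv_mem hw) j
  refine h1 c hc l ?_
  rw [hl, T.avg_commute hg.inv_left, hj, map_smul, ← LinearEquiv.mul_apply, inv_mul_cancel]
  rfl

/-- The roots in the orbit defining a folded root are mutually orthogonal. -/
lemma orthogonal (T : D.Automorphism) {i j k : ι} (h : T.avg (D.root i) ∈ T.folded)
    (hj : j ∈ T.orbit i) (hk : k ∈ T.orbit i) (hjk : j ≠ k) :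
    D.form (D.root j) (D.root k) = 0 := by
  have hj' := T.avg_of_mem_orbit hj
  have hk' := T.avg_of_mem_orbit hk
  rcases lt_trichotomy (D.form (D.root j) (D.root k)) 0 with h1 | h1 | h1
  · exfalso
    -- The roots of an orbit have equal nonzero height, so α_j ≠ -α_k. Thus α_j + α_k is a root, and
    -- its average is twice the given one, against maximality.
    obtain ⟨k', hk2⟩ := D.exists_neg k
    have hne : j ≠ k' := by
      rintro rfl
      have h2 := congrArg (fun v ↦ D.height (T.avg v)) hk2
      simp only [map_neg, hj', hk', height_avg] at h2
      exact D.height_ne_zero i (by linarith)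
    obtain ⟨l, hl⟩ := D.sub_mem j k' hne (by rw [hk2, map_neg]; linarith)
    refine (T.mem_folded_iff.1 h).2 2 one_lt_two l ?_
    rw [hl, hk2, map_sub, map_neg, hj', hk']
    module
  · exact h1
  · exfalso
    -- Here α_j - α_k would be a root with average zero.
    obtain ⟨l, hl⟩ := D.sub_mem j k hjk h1
    apply T.avg_ne_zero l
    rw [hl, map_sub, hj', hk', sub_self]

/-- The coroot of a folded root is the sum of an orbit of coroots. -/
lemma folded_coroot (T : D.Automorphism) {i : ι} (h : T.avg (D.root i) ∈ T.folded) :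
    (2 / D.form (T.avg (D.root i)) (T.avg (D.root i))) • T.avg (D.root i) =
      ∑ j ∈ T.orbit i, D.coroot j := by
  have hp := T.card_orbit_pos i
  have hi := D.form_self_pos i
  -- By orthogonality only the term j = i survives in the product of α_i with its orbit sum.
  have h1 : D.form (T.avg (D.root i)) (T.avg (D.root i)) =
      ((T.orbit i).card : ℝ)⁻¹ * D.form (D.root i) (D.root i) := by
    rw [form_avg_avg, avg_eq, map_smul, map_sum, Finset.sum_eq_single_of_mem i (T.self_mem_orbit i)]
    · rfl
    · exact fun j hj hji ↦ T.orthogonal h (T.self_mem_orbit i) hj hji.symm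
  have h2 : ∑ j ∈ T.orbit i, D.coroot j =
      (2 / D.form (D.root i) (D.root i)) • ∑ j ∈ T.orbit i, D.root j := by
    rw [Finset.smul_sum]
    exact Finset.sum_congr rfl fun j hj ↦ by rw [coroot, T.form_self_of_mem_orbit hj]
  rw [h2, ← card_smul_avg, h1, smul_smul]
  congr 1
  field_simp

end Automorphism

end BasedRootSystem

/-! ### Orbit reflections, simple orbits and highest roots -/

namespace BasedRootSystem

variable {ι V : Type*} [AddCommGroup V] [Module ℝ V] {D : BasedRootSystem ι V}

/-- The vector `2 v / (v, v)`. -/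
def dualVector (D : BasedRootSystem ι V) (v : V) : V := (2 / D.form v v) • v

lemma form_dualVector_self {v : V} (hv : v ≠ 0) : D.form v (D.dualVector v) = 2 := by
  rw [dualVector, map_smul, smul_eq_mul, div_mul_cancel₀ _ (D.pos v hv).ne']

lemma dualVector_neg (v : V) : D.dualVector (-v) = -D.dualVector v := by
  simp [dualVector]

lemma exists_form_sum_coroot_eq_int (i : ι) (s : Finset ι) :
    ∃ n : ℤ, D.form (D.root i) (∑ j ∈ s, D.coroot j) = n := by
  choose f hf using D.integral i
  refine ⟨∑ j ∈ s, f j, ?_⟩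
  rw [map_sum]
  push_cast
  exact Finset.sum_congr rfl fun j _ ↦ hf j

/-- By orthogonality no reflection changes the pairings used by the others, so all corrections are
made to the original vector. -/
lemma exists_mul_reflections (s : Finset ι)
    (hs : ∀ i ∈ s, ∀ j ∈ s, i ≠ j → D.form (D.root i) (D.root j) = 0) :
    ∃ g ∈ D.weyl, ∀ v, g v = v - ∑ j ∈ s, D.form (D.root j) v • D.coroot j := by
  classical
  induction s using Finset.induction_on with
  | empty => exact ⟨1, one_mem _, fun v ↦ by simp⟩
  | insert i s hi ih =>
    obtain ⟨g, hg, h⟩ := ih fun j hj k hk ↦ hs j (by simp [hj]) k (by simp [hk])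
    refine ⟨D.reflection i * g, mul_mem (D.reflection_mem_weyl i) hg, fun v ↦ ?_⟩
    have h0 : D.form (D.root i) (g v) = D.form (D.root i) v := by
      rw [h, map_sub, map_sum, sub_eq_self]
      refine Finset.sum_eq_zero fun j hj ↦ ?_
      rw [map_smul, coroot, map_smul,
        hs i (by simp) j (by simp [hj]) (by rintro rfl; exact hi hj), smul_zero, smul_zero]
    rw [LinearEquiv.mul_apply, reflection_apply, h0, h, Finset.sum_insert hi]
    abel

lemma sum_smul_root_mem_closure (s : Finset ι) (f : ι → ℝ) (hf : ∀ j ∈ s, ∃ n : ℕ, f j = n) :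
    ∑ j ∈ s, f j • D.root j ∈ AddSubmonoid.closure (D.root '' (s : Set ι)) := by
  refine sum_mem fun j hj ↦ ?_
  obtain ⟨n, hn⟩ := hf j hj
  rw [hn, Nat.cast_smul_eq_nsmul]
  exact nsmul_mem (AddSubmonoid.subset_closure (Set.mem_image_of_mem _ hj)) n

lemma IsPos.exists_coord_eq_nat {i j : ι} (hi : D.IsPos i) (hj : j ∈ D.simple) :
    ∃ n : ℕ, D.coord j (D.root i) = n := by
  obtain ⟨n, hn⟩ := D.coord_int i j hj
  have := hi j hj
  rw [hn] at this
  lift n to ℕ using by exact_mod_cast this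
  exact ⟨n, by simpa using hn⟩

/-- A root of height one is simple. -/
lemma mem_simple_of_height_eq_one {k : ι} (hk : D.IsPos k) (h : D.height (D.root k) = 1) :
    k ∈ D.simple := by
  classical
  obtain ⟨j, hj, hj0⟩ := D.exists_coord_ne_zero k
  choose! f hf using fun j hj ↦ hk.exists_coord_eq_nat (j := j) hj
  have h1 : ∑ j ∈ D.simple, f j = 1 := by
    rw [height_apply, Finset.sum_congr rfl hf] at h
    exact_mod_cast h
  have hjf : f j ≠ 0 := by
    intro h0
    rw [hf j hj, h0] at hj0
    simp at hj0
  rw [← Finset.add_sum_erase _ _ hj] at h1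
  have h2 : f j = 1 := by omega
  have h3 : ∑ l ∈ D.simple.erase j, f l = 0 := by omega
  have : D.root k = D.root j := by
    rw [D.root_eq_sum k, Finset.sum_eq_single_of_mem j hj, hf j hj, h2, Nat.cast_one, one_smul]
    intro l hl hlj
    rw [hf l hl, Finset.sum_eq_zero_iff.1 h3 l (Finset.mem_erase.2 ⟨hlj, hl⟩), Nat.cast_zero,
      zero_smul]
  rw [D.root_injective this]
  exact hj

namespace Automorphism

lemma zpow_root (T : D.Automorphism) (k : ℤ) (i : ι) :
    (T.lin ^ k) (D.root i) = D.root ((T.perm ^ k) i) := by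
  cases k with
  | ofNat k => exact T.pow_root k i
  | negSucc k =>
    rw [zpow_negSucc, zpow_negSucc]
    apply (T.lin ^ (k + 1)).injective
    rw [T.pow_root, ← LinearEquiv.mul_apply, mul_inv_cancel, ← Equiv.Perm.mul_apply,
      mul_inv_cancel]
    rfl

lemma avg_eq_sum (T : D.Automorphism) (k : ι) :
    T.avg (D.root k) = ∑ j ∈ D.simple, D.coord j (D.root k) • T.avg (D.root j) := by
  conv_lhs => rw [D.root_eq_sum k]
  rw [map_sum]
  exact Finset.sum_congr rfl fun j _ ↦ map_smul _ _ _

variable [Fintype ι]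

/-- `g` is the product of the reflections in the orbit of `i`, which are assumed to commute. -/
structure IsOrbitReflection (T : D.Automorphism) (i : ι) (g : V ≃ₗ[ℝ] V) : Prop where
  mem_weyl : g ∈ D.weyl
  commute : Commute g T.lin
  apply : ∀ v, g v = v - ∑ j ∈ T.orbit i, D.form (D.root j) v • D.coroot j

/-- The formula for the product is a sum over the orbit, which Θ merely permutes; hence the product
commutes with Θ. -/
lemma exists_isOrbitReflection (T : D.Automorphism) {i : ι} (h : T.avg (D.root i) ∈ T.folded) :
    ∃ g, T.IsOrbitReflection i g := by
  obtain ⟨g, hg, hv⟩ := D.exists_mul_reflections (T.orbit i)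
    fun j hj k hk hjk ↦ T.orthogonal h hj hk hjk
  refine ⟨g, hg, ?_, hv⟩
  ext v
  rw [LinearEquiv.mul_apply, LinearEquiv.mul_apply, hv, hv, map_sub, map_sum,
    ← T.sum_orbit_perm fun j ↦ D.form (D.root j) (T.lin v) • D.coroot j]
  congr 1
  refine Finset.sum_congr rfl fun j _ ↦ ?_
  rw [← T.map_root, T.isometry, map_smul, T.map_coroot]

/-- All roots of the orbit take the same value on v, and the coroots of the orbit add up to the
folded coroot, so the product acts as one reflection. -/
lemma IsOrbitReflection.apply_of_fixed {T : D.Automorphism} {i : ι} {g : V ≃ₗ[ℝ] V}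
    (hg : T.IsOrbitReflection i g) (h : T.avg (D.root i) ∈ T.folded) {v : V}
    (hv : ∀ j, D.form (D.root j) (T.lin v) = D.form (D.root j) v) :
    g v = v - D.form (T.avg (D.root i)) v • D.dualVector (T.avg (D.root i)) := by
  rw [hg.apply, dualVector, T.folded_coroot h, Finset.smul_sum, T.form_avg hv]
  congr 1
  exact Finset.sum_congr rfl fun j hj ↦ by rw [T.form_of_mem_orbit hv hj]

lemma exists_form_dualVector_eq_int (T : D.Automorphism) (i : ι) {β : V} (h : β ∈ T.folded) :
    ∃ n : ℤ, D.form (D.root i) (D.dualVector β) = n := by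
  obtain ⟨⟨j, rfl⟩, -⟩ := T.mem_folded_iff.1 h
  rw [dualVector, T.folded_coroot h]
  exact exists_form_sum_coroot_eq_int i _

lemma exists_form_folded_dualVector_eq_int (T : D.Automorphism) {α β : V} (hα : α ∈ T.folded)
    (h : β ∈ T.folded) : ∃ n : ℤ, D.form α (D.dualVector β) = n := by
  obtain ⟨⟨j, rfl⟩, -⟩ := T.mem_folded_iff.1 hα
  rw [T.form_avg]
  · exact T.exists_form_dualVector_eq_int j h
  · intro k
    rw [dualVector, map_smul, T.lin_folded h]

lemma height_avg_simple (T : D.Automorphism) {i : ι} (hi : i ∈ D.simple) :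
    D.height (T.avg (D.root i)) = 1 := by
  rw [T.height_avg, D.height_simple hi]

/-- The form value of a simple root on the dual of a folded multiple `c` of its average. -/
lemma form_dualVector_smul_avg (T : D.Automorphism) (i : ι) (c : ℝ) (hc : c ≠ 0) :
    D.form (D.root i) (D.dualVector (c • T.avg (D.root i))) = 2 / c := by
  have := (D.pos _ (T.avg_ne_zero i)).ne'
  rw [← T.form_avg]
  · simp only [dualVector, map_smul, LinearMap.smul_apply, smul_eq_mul]
    field_simp
  · intro j
    simp only [dualVector, map_smul, T.lin_avg]

/-- The factor c is the height of the root k, hence an integer, and 2 / c is the pairing of α_i with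
a folded coroot, hence also an integer. -/
lemma eq_one_or_two (T : D.Automorphism) {i k : ι} (hi : i ∈ D.simple) {c : ℝ} (hc : 0 < c)
    (h : c • T.avg (D.root i) ∈ T.folded) (hk : T.avg (D.root k) = c • T.avg (D.root i)) :
    c = 1 ∨ c = 2 := by
  obtain ⟨n, hn⟩ := T.exists_form_dualVector_eq_int i h
  rw [T.form_dualVector_smul_avg i c hc.ne'] at hn
  obtain ⟨m, hm⟩ := D.exists_height_eq_int k
  rw [← T.height_avg, hk, map_smul, T.height_avg_simple hi, smul_eq_mul, mul_one] at hm
  rw [div_eq_iff hc.ne', hm] at hn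
  rw [hm] at hc
  have h1 : (2 : ℤ) = n * m := by exact_mod_cast hn
  have h2 : 0 < m := by exact_mod_cast hc
  have h3 : m ≤ 2 := Int.le_of_dvd two_pos ⟨n, by rw [h1, mul_comm]⟩
  rw [hm]
  interval_cases m
  · left; norm_num
  · right; norm_num

lemma avg_eq_height_smul (T : D.Automorphism) {i k : ι}
    (h : ∀ j ∈ D.simple, j ∉ T.orbit i → D.coord j (D.root k) = 0) :
    T.avg (D.root k) = D.height (D.root k) • T.avg (D.root i) := by
  rw [avg_eq_sum, height_apply, Finset.sum_smul]
  refine Finset.sum_congr rfl fun j hj ↦ ?_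
  by_cases hji : j ∈ T.orbit i
  · rw [T.avg_of_mem_orbit hji]
  · rw [h j hj hji, zero_smul, zero_smul]

/-- The sum of the coefficients at the simple roots in an orbit. -/
def orbitCoord (T : D.Automorphism) (i : ι) : Module.Dual ℝ V := ∑ j ∈ T.orbit i, D.coord j

lemma orbitCoord_apply (T : D.Automorphism) (i : ι) (v : V) :
    T.orbitCoord i v = ∑ j ∈ T.orbit i, D.coord j v := by
  simp [orbitCoord]

lemma orbitCoord_avg (T : D.Automorphism) {i : ι} (hi : i ∈ D.simple) (k : ι) :
    T.orbitCoord i (T.avg (D.root k)) = T.orbitCoord i (D.root k) := by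
  have h (j : ι) : T.orbitCoord i (D.root (T.perm j)) = T.orbitCoord i (D.root j) := by
    rw [orbitCoord_apply, orbitCoord_apply,
      ← T.sum_orbit_perm fun l ↦ D.coord l (D.root (T.perm j))]
    exact Finset.sum_congr rfl fun l hl ↦ T.coord_perm ((T.simple_of_mem_orbit hl).2 hi) j
  rw [avg_eq, map_smul, map_sum, Finset.sum_congr rfl fun j hj ↦
    T.eq_of_mem_orbit (f := fun j ↦ T.orbitCoord i (D.root j)) h hj, Finset.sum_const,
    ← Nat.cast_smul_eq_nsmul ℝ, smul_smul, inv_mul_cancel₀ (T.card_orbit_pos k).ne', one_smul]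

lemma orbitCoord_avg_self (T : D.Automorphism) {i : ι} (hi : i ∈ D.simple) :
    T.orbitCoord i (T.avg (D.root i)) = 1 := by
  rw [T.orbitCoord_avg hi, orbitCoord_apply, Finset.sum_eq_single_of_mem i (T.self_mem_orbit i),
    D.coord_self i hi]
  exact fun j hj hji ↦ D.coord_of_ne j ((T.simple_of_mem_orbit hj).2 hi) i hi hji

lemma orbitCoord_avg_of_notMem (T : D.Automorphism) {i k : ι} (hi : i ∈ D.simple)
    (hk : k ∈ D.simple) (h : k ∉ T.orbit i) : T.orbitCoord i (T.avg (D.root k)) = 0 := by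
  rw [T.orbitCoord_avg hi, orbitCoord_apply]
  refine Finset.sum_eq_zero fun j hj ↦
    D.coord_of_ne j ((T.simple_of_mem_orbit hj).2 hi) k hk ?_
  rintro rfl
  exact h hj

/-- Averaging preserves the sum of the coordinates over a simple orbit. The coordinates of a root
have one sign, so where this sum vanishes every term does. -/
lemma coord_eq_zero_of_avg_eq (T : D.Automorphism) {i k : ι} {c : ℝ} (hi : i ∈ D.simple)
    (h : T.avg (D.root k) = c • T.avg (D.root i)) {j : ι} (hj : j ∈ D.simple)
    (hji : j ∉ T.orbit i) : D.coord j (D.root k) = 0 := by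
  have h1 : T.orbitCoord j (D.root k) = 0 := by
    rw [← T.orbitCoord_avg hj, h, map_smul, T.orbitCoord_avg_of_notMem hj hi, smul_zero]
    intro hij
    exact hji (by rw [T.orbit_eq hij]; exact T.self_mem_orbit j)
  rw [orbitCoord_apply] at h1
  have hs (l : ι) (hl : l ∈ T.orbit j) := (T.simple_of_mem_orbit hl).2 hj
  rcases D.coord_sign k with h2 | h2
  · exact (Finset.sum_eq_zero_iff_of_nonneg fun l hl ↦ h2 l (hs l hl)).1 h1 j (T.self_mem_orbit j)
  · exact (Finset.sum_eq_zero_iff_of_nonpos fun l hl ↦ h2 l (hs l hl)).1 h1 j (T.self_mem_orbit j)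

/-- Every root in the orbit of l is supported on the simple orbit of i, so only coordinates in that
orbit can change. -/
lemma IsOrbitReflection.coord_apply {T : D.Automorphism} {i l : ι} {g : V ≃ₗ[ℝ] V} {c : ℝ}
    (hg : T.IsOrbitReflection l g) (hi : i ∈ D.simple)
    (hl : T.avg (D.root l) = c • T.avg (D.root i)) {j : ι} (hj : j ∈ D.simple)
    (hji : j ∉ T.orbit i) (v : V) : D.coord j (g v) = D.coord j v := by
  rw [hg.apply, map_sub, map_sum, Finset.sum_eq_zero, sub_zero]
  intro k hk
  rw [map_smul, coroot, map_smul, T.coord_eq_zero_of_avg_eq hi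
    ((T.avg_of_mem_orbit hk).trans hl) hj hji, smul_zero, smul_zero]

lemma cyclicOrbit_root (T : D.Automorphism) (i : ι) :
    cyclicOrbit T.lin (D.root i) = D.root '' (T.orbit i : Set ι) := by
  ext v
  simp only [cyclicOrbit, Set.mem_ofPred_eq, T.zpow_root, Set.mem_image, Finset.mem_coe, mem_orbit]
  constructor
  · rintro ⟨n, rfl⟩
    exact ⟨_, ⟨n, rfl⟩, rfl⟩
  · rintro ⟨_, ⟨n, rfl⟩, rfl⟩
    exact ⟨n, rfl⟩

lemma root_eq_sum_orbit (T : D.Automorphism) {i k : ι} (hi : i ∈ D.simple)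
    (h : ∀ j ∈ D.simple, j ∉ T.orbit i → D.coord j (D.root k) = 0) :
    D.root k = ∑ j ∈ T.orbit i, D.coord j (D.root k) • D.root j := by
  conv_lhs => rw [D.root_eq_sum k]
  refine (Finset.sum_subset (fun j hj ↦ (T.simple_of_mem_orbit hj).2 hi) fun j hj hji ↦ ?_).symm
  rw [h j hj hji, zero_smul]

lemma root_mem_span_iff (T : D.Automorphism) {i : ι} (hi : i ∈ D.simple) (k : ι) :
    D.root k ∈ Submodule.span ℝ (D.root '' (T.orbit i : Set ι)) ↔
      ∀ j ∈ D.simple, j ∉ T.orbit i → D.coord j (D.root k) = 0 := by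
  constructor
  · intro h j hj hji
    have : Submodule.span ℝ (D.root '' (T.orbit i : Set ι)) ≤ LinearMap.ker (D.coord j) := by
      rw [Submodule.span_le]
      rintro _ ⟨l, hl, rfl⟩
      exact D.coord_of_ne j hj l ((T.simple_of_mem_orbit hl).2 hi) (by rintro rfl; exact hji hl)
    exact this h
  · intro h
    rw [T.root_eq_sum_orbit hi h]
    exact Submodule.sum_mem _ fun j hj ↦
      Submodule.smul_mem _ _ (Submodule.subset_span ⟨j, hj, rfl⟩)

lemma root_mem_closure_orbit (T : D.Automorphism) {i k : ι} (hi : i ∈ D.simple)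
    (h : ∀ j ∈ D.simple, j ∉ T.orbit i → D.coord j (D.root k) = 0) (hk : D.IsPos k) :
    D.root k ∈ AddSubmonoid.closure (D.root '' (T.orbit i : Set ι)) := by
  rw [T.root_eq_sum_orbit hi h]
  exact sum_smul_root_mem_closure _ _ fun j hj ↦
    hk.exists_coord_eq_nat ((T.simple_of_mem_orbit hj).2 hi)

lemma height_pos_of_mem_closure (T : D.Automorphism) {i : ι} (hi : i ∈ D.simple) {v : V}
    (h : v ∈ AddSubmonoid.closure (D.root '' (T.orbit i : Set ι))) :
    v = 0 ∨ 0 < D.height v := by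
  induction h using AddSubmonoid.closure_induction with
  | mem x hx =>
    obtain ⟨j, hj, rfl⟩ := hx
    right
    rw [D.height_simple ((T.simple_of_mem_orbit hj).2 hi)]
    exact zero_lt_one
  | zero => exact Or.inl rfl
  | add x y _ _ hx hy =>
    rcases hx with rfl | hx
    · simpa using hy
    · right
      rcases hy with rfl | hy
      · simpa using hx
      · rw [map_add]; exact add_pos hx hy

/-- The set of roots in the span of the orbit of a simple root. -/
def orbitRoots (T : D.Automorphism) (i : ι) : Set V :=
  Set.range D.root ∩ Submodule.span ℝ (cyclicOrbit T.lin (D.root i))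

lemma root_mem_orbitRoots_iff (T : D.Automorphism) {i : ι} (hi : i ∈ D.simple) (k : ι) :
    D.root k ∈ T.orbitRoots i ↔
      ∀ j ∈ D.simple, j ∉ T.orbit i → D.coord j (D.root k) = 0 := by
  rw [← T.root_mem_span_iff hi, orbitRoots, cyclicOrbit_root]
  exact ⟨fun h ↦ h.2, fun h ↦ ⟨⟨k, rfl⟩, h⟩⟩

/-- A root of greatest height in the span will do, since a nonzero sum of simple roots has positive
height. -/
lemma exists_isHighestRoot (T : D.Automorphism) {i : ι} (hi : i ∈ D.simple) :
    ∃ γ, IsHighestRoot (T.orbitRoots i) (cyclicOrbit T.lin (D.root i)) γ := by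
  obtain ⟨k, hk, hmax⟩ := Set.exists_max_image
    {k | D.root k ∈ T.orbitRoots i} (fun k ↦ D.height (D.root k)) (Set.toFinite _)
    ⟨i, (T.root_mem_orbitRoots_iff hi i).2 fun j hj hji ↦ D.coord_of_ne j hj i hi fun h ↦
      hji (h ▸ T.self_mem_orbit i)⟩
  refine ⟨D.root k, hk, ?_⟩
  rintro _ ⟨⟨l, rfl⟩, hl⟩ hlk
  rw [cyclicOrbit_root] at hlk
  rcases T.height_pos_of_mem_closure hi hlk with h | h
  · exact sub_eq_zero.1 h
  · have := hmax l ⟨⟨l, rfl⟩, hl⟩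
    rw [map_sub] at h
    linarith

lemma orbitRoots_perm (T : D.Automorphism) {i k : ι} (hi : i ∈ D.simple)
    (h : D.root k ∈ T.orbitRoots i) : D.root (T.perm k) ∈ T.orbitRoots i := by
  rw [T.root_mem_orbitRoots_iff hi] at h ⊢
  intro j hj hji
  obtain ⟨l, rfl⟩ := T.perm.surjective j
  rw [T.map_simple] at hj
  rw [T.perm_mem_orbit] at hji
  rw [T.coord_perm hj, h l hj hji]

lemma lin_mem_closure_orbit (T : D.Automorphism) {i : ι} {v : V}
    (h : v ∈ AddSubmonoid.closure (D.root '' (T.orbit i : Set ι))) :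
    T.lin v ∈ AddSubmonoid.closure (D.root '' (T.orbit i : Set ι)) := by
  induction h using AddSubmonoid.closure_induction with
  | mem x hx =>
    obtain ⟨j, hj, rfl⟩ := hx
    rw [T.map_root]
    exact AddSubmonoid.subset_closure ⟨_, T.perm_mem_orbit.2 hj, rfl⟩
  | zero => rw [map_zero]; exact zero_mem _
  | add x y _ _ hx hy => rw [map_add]; exact add_mem hx hy

/-- If γ were negative, then -γ would exceed it by -2γ, a sum of simple roots of the orbit. -/
lemma isPos_of_isHighestRoot (T : D.Automorphism) {i k : ι} (hi : i ∈ D.simple)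
    (h : IsHighestRoot (T.orbitRoots i) (cyclicOrbit T.lin (D.root i)) (D.root k)) :
    D.IsPos k := by
  by_contra hk
  obtain ⟨l, hl⟩ := D.exists_neg k
  have hl' : D.root l ∈ T.orbitRoots i := by
    have := h.1
    rw [T.root_mem_orbitRoots_iff hi] at this ⊢
    intro j hj hji
    rw [hl, map_neg, this j hj hji, neg_zero]
  have hp : D.IsPos l := IsPos.of_neg hk hl
  have hcl := root_mem_closure_orbit T hi ((T.root_mem_orbitRoots_iff hi l).1 hl') hp
  have := h.2 _ hl' (by
    rw [cyclicOrbit_root, show D.root l - D.root k = D.root l + D.root l by rw [hl]; abel]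
    exact add_mem hcl hcl)
  exact hk (D.root_injective this ▸ hp)

/-- The average of a highest root of the root system spanned by an orbit of simple roots is a
folded root. -/
lemma avg_mem_folded_of_isHighestRoot (T : D.Automorphism) {i k : ι} (hi : i ∈ D.simple)
    (h : IsHighestRoot (T.orbitRoots i) (cyclicOrbit T.lin (D.root i)) (D.root k)) :
    T.avg (D.root k) ∈ T.folded := by
  have hp := T.isPos_of_isHighestRoot hi h
  have hk0 := (T.root_mem_orbitRoots_iff hi k).1 h.1
  have hk := T.avg_eq_height_smul hk0
  obtain ⟨c, hc1, hc⟩ := T.exists_smul_avg_mem_folded i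
  have hc0 : 0 < c := by linarith
  obtain ⟨⟨l, hl⟩, hlmax⟩ := T.mem_folded_iff.1 hc
  -- The average of the highest root is its height times the average of α_i, and c is the largest
  -- such factor.
  have hle : D.height (D.root k) ≤ c := by
    by_contra! hlt
    refine hlmax (D.height (D.root k) / c) ((one_lt_div hc0).2 hlt) k ?_
    rw [smul_smul, div_mul_cancel₀ _ hc0.ne', ← hk]
  have h1 := D.one_le_height hp
  by_cases heq : D.height (D.root k) = c
  · rw [hk, heq]
    exact hc
  exfalso
  have hlt := lt_of_le_of_ne hle heq
  -- The remaining case is c = 2 with a highest root of height one, that is, a simple root of the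
  -- orbit. It is excluded by the root l, which has height two.
  have hc2 : c = 2 := (T.eq_one_or_two hi hc0 hc hl).resolve_left (by linarith)
  subst hc2
  have hk1 : D.height (D.root k) = 1 := by
    obtain ⟨m, hm⟩ := D.exists_height_eq_int k
    rw [hm] at h1 hlt ⊢
    have h1' : 1 ≤ m := by exact_mod_cast h1
    have hlt' : m < 2 := by exact_mod_cast hlt
    have : m = 1 := by omega
    rw [this, Int.cast_one]
  have hks := mem_simple_of_height_eq_one hp hk1
  have hki : k ∈ T.orbit i := by
    by_contra hki
    have := hk0 k hks hki
    rw [D.coord_self k hks] at this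
    exact one_ne_zero this
  have hlh : D.height (D.root l) = 2 := by
    rw [← T.height_avg, hl, map_smul, T.height_avg_simple hi, smul_eq_mul, mul_one]
  have hlp : D.IsPos l := isPos_iff.2 (by rw [hlh]; exact two_pos)
  have hl0 : D.root l ∈ T.orbitRoots i :=
    (T.root_mem_orbitRoots_iff hi l).2 fun j hj hji ↦ T.coord_eq_zero_of_avg_eq hi hl hj hji
  obtain ⟨j, hj, hjl⟩ := D.exists_coord_ne_zero l
  have hji : j ∈ T.orbit i := by
    by_contra hji
    exact hjl (T.coord_eq_zero_of_avg_eq hi hl hj hji)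
  -- The coordinate of l at j is a positive integer, so it stays nonnegative after subtracting 1.
  have hcl : D.root l - D.root j ∈ AddSubmonoid.closure (D.root '' (T.orbit i : Set ι)) := by
    classical
    have : D.root l - D.root j =
        ∑ m ∈ T.orbit i, (D.coord m (D.root l) - if m = j then 1 else 0) • D.root m := by
      simp only [sub_smul, Finset.sum_sub_distrib, ite_smul, one_smul, zero_smul,
        Finset.sum_ite_eq', hji, if_true]
      rw [← T.root_eq_sum_orbit hi ((T.root_mem_orbitRoots_iff hi l).1 hl0)]
    rw [this]
    refine sum_smul_root_mem_closure _ _ fun m hm ↦ ?_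
    obtain ⟨n, hn⟩ := hlp.exists_coord_eq_nat ((T.simple_of_mem_orbit hm).2 hi)
    split_ifs with hmj
    · subst hmj
      have : n ≠ 0 := by
        rintro rfl
        rw [hn] at hjl
        simp at hjl
      exact ⟨n - 1, by rw [hn, Nat.cast_sub (by omega), Nat.cast_one]⟩
    · exact ⟨n, by rw [hn, sub_zero]⟩
  -- Powers of Θ carry j to k, and carry l to a root of height two lying above k.
  have hkj : k ∈ T.orbit j := by rw [T.orbit_eq hji]; exact hki
  obtain ⟨l', hl', hcl', hh⟩ : ∃ l', D.root l' ∈ T.orbitRoots i ∧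
      D.root l' - D.root k ∈ AddSubmonoid.closure (D.root '' (T.orbit i : Set ι)) ∧
      D.height (D.root l') = 2 := by
    refine T.orbit_induction (p := fun k ↦ ∃ l', D.root l' ∈ T.orbitRoots i ∧
      D.root l' - D.root k ∈ AddSubmonoid.closure (D.root '' (T.orbit i : Set ι)) ∧
      D.height (D.root l') = 2) hkj ⟨l, hl0, hcl, hlh⟩ ?_
    rintro k ⟨l', h1, h2, h3⟩
    refine ⟨T.perm l', T.orbitRoots_perm hi h1, ?_, by rw [T.height_perm, h3]⟩
    rw [← T.map_root, ← T.map_root, ← map_sub]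
    exact T.lin_mem_closure_orbit h2
  have := h.2 _ hl' (by rw [cyclicOrbit_root]; exact hcl')
  rw [this, hk1] at hh
  norm_num at hh

/-- Both descriptions pick the folded root on the ray of the average of α_i, and a ray contains only
one. In particular the choice of highest root is immaterial. -/
lemma foldedSimple_eq (T : D.Automorphism) :
    T.foldedSimple = {v | ∃ i ∈ D.simple, ∃ γ : V,
      IsHighestRoot (T.orbitRoots i) (cyclicOrbit T.lin (D.root i)) γ ∧
      v = orbitAverage T.lin γ} := by
  have key {i : ι} (hi : i ∈ D.simple) {γ : V}
      (h : IsHighestRoot (T.orbitRoots i) (cyclicOrbit T.lin (D.root i)) γ) :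
      orbitAverage T.lin γ ∈ T.folded ∧
        ∃ c : ℝ, 0 < c ∧ orbitAverage T.lin γ = c • T.avg (D.root i) := by
    obtain ⟨k, rfl⟩ := h.1.1
    rw [orbitAverage_root]
    exact ⟨T.avg_mem_folded_of_isHighestRoot hi h, _,
      (T.isPos_of_isHighestRoot hi h).height_pos,
      T.avg_eq_height_smul ((T.root_mem_orbitRoots_iff hi k).1 h.1)⟩
  ext v
  constructor
  · rintro ⟨hv, i, hi, c, hc, rfl⟩
    obtain ⟨γ, hγ⟩ := T.exists_isHighestRoot hi
    obtain ⟨h1, d, hd, h2⟩ := key hi hγ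
    refine ⟨i, hi, γ, hγ, T.eq_of_smul_mem_folded h1 hv (div_pos hc hd) ?_⟩
    rw [h2, smul_smul, div_mul_cancel₀ _ hd.ne']
  · rintro ⟨i, hi, γ, hγ, rfl⟩
    obtain ⟨h1, d, hd, h2⟩ := key hi hγ
    exact ⟨h1, i, hi, d, hd, h2⟩

end Automorphism

end BasedRootSystem

/-! ### The folded base and the fixed coroot lattice -/

namespace BasedRootSystem

variable {ι V : Type*} [AddCommGroup V] [Module ℝ V] {D : BasedRootSystem ι V}

lemma dualVector_map {g : V ≃ₗ[ℝ] V} (hg : g ∈ D.weyl) (v : V) :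
    D.dualVector (g v) = g (D.dualVector v) := by
  rw [dualVector, dualVector, map_smul, D.form_weyl hg]

lemma form_dualVector (v w : V) : D.form v (D.dualVector w) = 2 / D.form w w * D.form v w := by
  rw [dualVector, map_smul, smul_eq_mul]

lemma form_smul_dualVector (v w : V) :
    D.form v w • D.dualVector v = D.form w (D.dualVector v) • v := by
  rw [form_dualVector, dualVector, smul_smul, D.symm w v, mul_comm]

/-- The coroot lattice. -/
def corootLattice (D : BasedRootSystem ι V) : AddSubgroup V :=
  AddSubgroup.closure (Set.range D.coroot)

lemma coroot_mem_corootLattice (i : ι) : D.coroot i ∈ D.corootLattice :=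
  AddSubgroup.subset_closure ⟨i, rfl⟩

lemma exists_eq_sum_of_mem_corootLattice {v : V} (h : v ∈ D.corootLattice) :
    ∃ n : ι → ℤ, v = ∑ j ∈ D.simple, (n j : ℝ) • D.coroot j := by
  classical
  have hle : D.corootLattice ≤ AddSubgroup.closure (D.coroot '' (D.simple : Set ι)) := by
    rw [corootLattice, AddSubgroup.closure_le]
    rintro _ ⟨i, rfl⟩
    exact D.coroot_mem i
  have h' := hle h
  induction h' using AddSubgroup.closure_induction with
  | mem x hx =>
    obtain ⟨i, hi, rfl⟩ := hx
    refine ⟨Pi.single i 1, ?_⟩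
    rw [Finset.sum_eq_single_of_mem i hi fun j _ hji ↦ by simp [hji]]
    simp
  | zero => exact ⟨0, by simp⟩
  | add x y hx hy hx' hy' =>
    have hS : AddSubgroup.closure (D.coroot '' (D.simple : Set ι)) ≤ D.corootLattice :=
      AddSubgroup.closure_mono (Set.image_subset_range _ _)
    obtain ⟨m, rfl⟩ := hx' (hS hx)
    obtain ⟨n, rfl⟩ := hy' (hS hy)
    exact ⟨m + n, by simp [add_smul, Finset.sum_add_distrib]⟩
  | neg x hx hx' =>
    have hS : AddSubgroup.closure (D.coroot '' (D.simple : Set ι)) ≤ D.corootLattice :=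
      AddSubgroup.closure_mono (Set.image_subset_range _ _)
    obtain ⟨m, rfl⟩ := hx' (hS hx)
    exact ⟨-m, by simp⟩

lemma coord_sum_smul_coroot {i : ι} (hi : i ∈ D.simple) (f : ι → ℝ) :
    D.coord i (∑ j ∈ D.simple, f j • D.coroot j) =
      f i * (2 / D.form (D.root i) (D.root i)) := by
  rw [map_sum, Finset.sum_eq_single_of_mem i hi, map_smul, coroot, map_smul, D.coord_self i hi,
    smul_eq_mul, smul_eq_mul, mul_one]
  intro j hj hji
  rw [map_smul, D.coord_coroot_of_ne hi hj hji.symm, smul_zero]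

lemma two_div_form_pos (i : ι) : 0 < 2 / D.form (D.root i) (D.root i) :=
  div_pos two_pos (D.form_self_pos i)

namespace Automorphism

lemma mem_foldedSimple_of_smul (T : D.Automorphism) {i : ι} (hi : i ∈ D.simple) {c : ℝ}
    (hc : 0 < c) (h : c • T.avg (D.root i) ∈ T.folded) : c • T.avg (D.root i) ∈ T.foldedSimple :=
  ⟨h, i, hi, c, hc, rfl⟩

variable [Fintype ι]

lemma dualVector_fixed (T : D.Automorphism) {β : V} (h : β ∈ T.folded) :
    T.lin (D.dualVector β) = D.dualVector β := by
  rw [dualVector, map_smul, T.lin_folded h]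

/-- A positive folded root is a sum of simple folded roots, and likewise for the coroots. -/
lemma folded_mem_closure (T : D.Automorphism) {k : ι} (hk : D.IsPos k)
    (h : T.avg (D.root k) ∈ T.folded) :
    T.avg (D.root k) ∈ AddSubmonoid.closure T.foldedSimple ∧
      D.dualVector (T.avg (D.root k)) ∈
        AddSubmonoid.closure (D.dualVector '' T.foldedSimple) := by
  obtain ⟨n, hn⟩ := exists_nat_ge (D.height (D.root k))
  induction n generalizing k with
  | zero =>
    have := hk.height_pos
    simp only [Nat.cast_zero] at hn
    linarith
  | succ n ih =>
    obtain ⟨i, hi, hik⟩ :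
        ∃ i ∈ D.simple, 0 < D.form (T.avg (D.root i)) (T.avg (D.root k)) := by
      by_contra! hcon
      have h1 : D.form (T.avg (D.root k)) (T.avg (D.root k)) = ∑ j ∈ D.simple,
          D.coord j (D.root k) * D.form (T.avg (D.root j)) (T.avg (D.root k)) := by
        conv_lhs => enter [1]; rw [T.avg_eq_sum]
        simp
      have := Finset.sum_nonpos fun j hj ↦
        mul_nonpos_of_nonneg_of_nonpos (hk j hj) (hcon j hj)
      have := D.pos _ (T.avg_ne_zero k)
      linarith
    obtain ⟨c, hc1, hc⟩ := T.exists_smul_avg_mem_folded i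
    have hc0 : 0 < c := by linarith
    have hs := T.mem_foldedSimple_of_smul hi hc0 hc
    obtain ⟨⟨l, hl⟩, -⟩ := T.mem_folded_iff.1 hc
    -- On the ray of the simple folded root the two coincide; off it, the orbit reflection gives a
    -- positive folded root of smaller height.
    by_cases hprop : ∃ t : ℝ, 0 < t ∧ T.avg (D.root k) = t • (c • T.avg (D.root i))
    · obtain ⟨t, ht, hkt⟩ := hprop
      rw [T.eq_of_smul_mem_folded hc h ht hkt]
      exact ⟨AddSubmonoid.subset_closure hs, AddSubmonoid.subset_closure ⟨_, hs, rfl⟩⟩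
    · obtain ⟨g, hg⟩ := T.exists_isOrbitReflection (i := l) (by rw [hl]; exact hc)
      obtain ⟨k', hk'⟩ := D.exists_weyl_root hg.mem_weyl k
      have hav : T.avg (D.root k') = g (T.avg (D.root k)) := by
        rw [hk', T.avg_commute hg.commute]
      have hfix {v : V} (hv : T.lin v = v) : g v = v -
          D.form (c • T.avg (D.root i)) v • D.dualVector (c • T.avg (D.root i)) := by
        rw [hg.apply_of_fixed (by rw [hl]; exact hc) fun j ↦ by rw [hv], hl]
      have hf' : T.avg (D.root k') ∈ T.folded := by
        rw [hav]
        exact T.map_mem_folded hg.mem_weyl hg.commute h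
      -- Off the ray, the root k has a nonzero coordinate outside the orbit of i, and the reflection
      -- preserves it.
      have hpos : D.IsPos k' := by
        obtain ⟨m, hm, hmi, hm0⟩ :
            ∃ m ∈ D.simple, m ∉ T.orbit i ∧ D.coord m (D.root k) ≠ 0 := by
          by_contra! hcon
          refine hprop ⟨D.height (D.root k) / c, div_pos hk.height_pos hc0, ?_⟩
          rw [smul_smul, div_mul_cancel₀ _ hc0.ne']
          exact T.avg_eq_height_smul hcon
        apply isPos_of_coord_pos hm
        rw [hk', hg.coord_apply hi hl hm hmi]
        exact lt_of_le_of_ne (hk m hm) hm0.symm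
      have h1 := hfix (T.lin_avg k)
      have h2 := hfix (T.dualVector_fixed h)
      -- The reflection subtracts p times the simple folded root from the root and q times its
      -- coroot from the coroot. Both are positive integers, so one induction settles roots and
      -- coroots.
      obtain ⟨p, hp⟩ := T.exists_form_folded_dualVector_eq_int h hc
      obtain ⟨q, hq⟩ := T.exists_form_folded_dualVector_eq_int hc h
      have hik' : 0 < D.form (c • T.avg (D.root i)) (T.avg (D.root k)) := by
        rw [map_smul, LinearMap.smul_apply, smul_eq_mul]
        exact mul_pos hc0 hik
      have hp0 : 0 < (p : ℝ) := by
        rw [← hp, form_dualVector, D.symm (T.avg (D.root k))]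
        exact mul_pos (div_pos two_pos (D.pos _ (T.folded_ne_zero hc))) hik'
      have hq0 : 0 < (q : ℝ) := by
        rw [← hq, form_dualVector]
        exact mul_pos (div_pos two_pos (D.pos _ (T.folded_ne_zero h))) hik'
      have hp1 : 0 < p := by exact_mod_cast hp0
      have hq1 : 0 < q := by exact_mod_cast hq0
      rw [form_smul_dualVector, hp, ← hav] at h1
      rw [← dualVector_map hg.mem_weyl, hq, ← hav] at h2
      lift p to ℕ using hp1.le
      lift q to ℕ using hq1.le
      have hlt : D.height (D.root k') ≤ n := by
        rw [← T.height_avg, h1, map_sub, map_smul, map_smul, T.height_avg, T.height_avg_simple hi]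
        have : (1 : ℝ) ≤ ((p : ℤ) : ℝ) := by exact_mod_cast hp1
        push_cast at hn
        simp only [smul_eq_mul, mul_one]
        nlinarith
      obtain ⟨e1, e2⟩ := ih hpos hf' hlt
      constructor
      · rw [← sub_add_cancel (T.avg (D.root k)) ((p : ℝ) • c • T.avg (D.root i))]
        refine add_mem ?_ ?_
        · simpa [h1] using e1
        · rw [Nat.cast_smul_eq_nsmul]
          exact nsmul_mem (AddSubmonoid.subset_closure hs) p
      · rw [← sub_add_cancel (D.dualVector (T.avg (D.root k)))
          ((q : ℝ) • D.dualVector (c • T.avg (D.root i)))]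
        refine add_mem ?_ ?_
        · simpa [h2] using e2
        · rw [Nat.cast_smul_eq_nsmul]
          exact nsmul_mem (AddSubmonoid.subset_closure (Set.mem_image_of_mem _ hs)) q

lemma folded_mem_or_neg_mem_closure (T : D.Automorphism) {β : V} (h : β ∈ T.folded) :
    (β ∈ AddSubmonoid.closure T.foldedSimple ∧
      D.dualVector β ∈ AddSubmonoid.closure (D.dualVector '' T.foldedSimple)) ∨
    (-β ∈ AddSubmonoid.closure T.foldedSimple ∧
      -D.dualVector β ∈ AddSubmonoid.closure (D.dualVector '' T.foldedSimple)) := by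
  obtain ⟨⟨k, rfl⟩, -⟩ := T.mem_folded_iff.1 h
  by_cases hk : D.IsPos k
  · exact Or.inl (T.folded_mem_closure hk h)
  · obtain ⟨l, hl⟩ := D.exists_neg k
    have hl' : T.avg (D.root l) = -T.avg (D.root k) := by rw [hl, map_neg]
    have := T.folded_mem_closure (IsPos.of_neg hk hl) (by rw [hl']; exact T.neg_mem_folded h)
    rw [hl', dualVector_neg] at this
    exact Or.inr this

/-- The coordinate sum over one simple orbit vanishes on the averages of the other simple orbits. -/
lemma linearIndependent_foldedSimple (T : D.Automorphism) :
    LinearIndependent ℝ (fun β : T.foldedSimple ↦ (β : V)) := by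
  rw [linearIndependent_iff']
  rintro s f hf ⟨β, hβ, i, hi, c, hc, rfl⟩ hs
  have h1 := congrArg (T.orbitCoord i) hf
  rw [map_sum, map_zero, Finset.sum_eq_single_of_mem _ hs] at h1
  · rw [map_smul, map_smul, T.orbitCoord_avg_self hi] at h1
    simpa [hc.ne'] using h1
  · rintro ⟨β', hβ', j, hj, d, hd, rfl⟩ - hne
    by_cases hji : j ∈ T.orbit i
    · refine absurd (Subtype.ext ?_) hne
      refine T.eq_of_smul_mem_folded hβ hβ' (div_pos hd hc) ?_
      change d • T.avg (D.root j) = (d / c) • c • T.avg (D.root i)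
      rw [T.avg_of_mem_orbit hji, smul_smul, div_mul_cancel₀ _ hc.ne']
    · rw [map_smul, map_smul, T.orbitCoord_avg_of_notMem hi hj hji, smul_zero, smul_zero]

/-- The coroot of a simple folded root is the sum of an orbit of simple coroots. -/
lemma dualVector_foldedSimple (T : D.Automorphism) {i : ι} (hi : i ∈ D.simple) {c : ℝ} (hc : 0 < c)
    (h : c • T.avg (D.root i) ∈ T.folded) :
    D.dualVector (c • T.avg (D.root i)) = ∑ j ∈ T.orbit i, D.coroot j := by
  obtain ⟨⟨k, hk⟩, -⟩ := T.mem_folded_iff.1 h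
  rcases T.eq_one_or_two hi hc h hk with rfl | rfl
  · rw [one_smul] at h ⊢
    exact T.folded_coroot h
  -- For c = 2 the average of α_i is not itself folded, so the coroot is first computed from the
  -- orbit of k. It is a positive multiple e of the required sum, and integrality will give e = 1.
  have hlat : D.dualVector ((2 : ℝ) • T.avg (D.root i)) ∈ D.corootLattice := by
    rw [← hk, dualVector, T.folded_coroot (hk ▸ h)]
    exact sum_mem fun j _ ↦ coroot_mem_corootLattice j
  have hi0 := two_div_form_pos (D := D) i
  have hcor : ∑ j ∈ T.orbit i, D.coroot j =
      (2 / D.form (D.root i) (D.root i)) • ((T.orbit i).card : ℝ) • T.avg (D.root i) := by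
    rw [card_smul_avg, Finset.smul_sum]
    exact Finset.sum_congr rfl fun j hj ↦ by rw [coroot, T.form_self_of_mem_orbit hj]
  obtain ⟨e, he, hde⟩ : ∃ e : ℝ, 0 < e ∧
      D.dualVector ((2 : ℝ) • T.avg (D.root i)) = e • ∑ j ∈ T.orbit i, D.coroot j := by
    have hcard := T.card_orbit_pos i
    refine ⟨2 / D.form ((2 : ℝ) • T.avg (D.root i)) ((2 : ℝ) • T.avg (D.root i)) * 2 /
      (2 / D.form (D.root i) (D.root i) * (T.orbit i).card), div_pos (mul_pos (div_pos two_pos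
        (D.pos _ (T.folded_ne_zero h))) two_pos) (mul_pos hi0 hcard), ?_⟩
    rw [hcor, smul_smul, smul_smul, mul_assoc, div_mul_cancel₀ _ (mul_pos hi0 hcard).ne',
      dualVector,
      smul_smul]
  obtain ⟨n, hn⟩ := exists_eq_sum_of_mem_corootLattice hlat
  -- The scalar e is the coefficient at a simple coroot of an element of the coroot lattice, hence
  -- an integer.
  have hen : e = n i := by
    have h1 := congrArg (D.coord i) hn
    rw [coord_sum_smul_coroot hi, hde, map_smul, map_sum,
      Finset.sum_eq_single_of_mem i (T.self_mem_orbit i)] at h1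
    · rw [coroot, map_smul, D.coord_self i hi, smul_eq_mul, smul_eq_mul, mul_one] at h1
      exact mul_right_cancel₀ hi0.ne' h1
    · exact fun j hj hji ↦ D.coord_coroot_of_ne hi ((T.simple_of_mem_orbit hj).2 hi) hji.symm
  -- Pairing with α_i gives e m = 2 / c = 1 with m an integer.
  obtain ⟨m, hm⟩ := exists_form_sum_coroot_eq_int (D := D) i (T.orbit i)
  have h1 := T.form_dualVector_smul_avg i 2 two_ne_zero
  rw [hde, map_smul, hm, hen, smul_eq_mul, div_self two_ne_zero] at h1
  rw [hen] at he
  have h2 : n i * m = 1 := by exact_mod_cast h1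
  have h3 : 0 < n i := by exact_mod_cast he
  have h4 : n i = 1 := Int.eq_one_of_mul_eq_one_right h3.le h2
  rw [hde, hen, h4, Int.cast_one, one_smul]

/-- The fixed part of the coroot lattice is generated by the simple folded coroots. -/
lemma mem_closure_of_mem_corootLattice (T : D.Automorphism) {v : V} (h : v ∈ D.corootLattice)
    (hv : T.lin v = v) : v ∈ AddSubgroup.closure (D.dualVector '' T.foldedSimple) := by
  classical
  obtain ⟨n, rfl⟩ := exists_eq_sum_of_mem_corootLattice h
  -- Comparing coordinates of v and Θ v shows that the coefficients are constant along orbits.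
  have hn (j : ι) (hj : j ∈ D.simple) : n (T.perm j) = n j := by
    have hsum : ∑ j ∈ D.simple, (n (T.perm.symm j) : ℝ) • D.coroot j =
        ∑ j ∈ D.simple, (n j : ℝ) • D.coroot j := by
      rw [← hv, map_sum]
      refine (Finset.sum_equiv T.perm (fun j ↦ (T.map_simple j).symm) fun j _ ↦ ?_).symm
      rw [map_smul, T.map_coroot, Equiv.symm_apply_apply]
    have h1 := congrArg (D.coord (T.perm j)) hsum
    rw [coord_sum_smul_coroot ((T.map_simple j).2 hj) fun j ↦ (n (T.perm.symm j) : ℝ),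
      coord_sum_smul_coroot ((T.map_simple j).2 hj) fun j ↦ (n j : ℝ),
      Equiv.symm_apply_apply] at h1
    have := mul_right_cancel₀ (two_div_form_pos _).ne' h1
    exact_mod_cast this.symm
  -- The sum is taken apart one orbit at a time, so the claim is proved for all stable sets of
  -- simple roots.
  suffices ∀ s ⊆ D.simple, (∀ j, T.perm j ∈ s ↔ j ∈ s) → ∑ j ∈ s, (n j : ℝ) • D.coroot j ∈
      AddSubgroup.closure (D.dualVector '' T.foldedSimple) from this _ subset_rfl T.map_simple
  intro s
  induction s using Finset.strongInduction with
  | H s ih =>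
    intro hs hperm
    rcases s.eq_empty_or_nonempty with rfl | ⟨i, hi⟩
    · rw [Finset.sum_empty]
      exact zero_mem _
    have hsub : T.orbit i ⊆ s := fun j hj ↦
      T.orbit_induction hj hi fun k hk ↦ (hperm k).2 hk
    rw [← Finset.sum_sdiff hsub]
    refine add_mem (ih _ (Finset.sdiff_ssubset hsub ⟨i, T.self_mem_orbit i⟩)
      (Finset.sdiff_subset.trans hs) fun j ↦ ?_) ?_
    · rw [Finset.mem_sdiff, Finset.mem_sdiff, hperm, T.perm_mem_orbit]
    · have hconst (j : ι) (hj : j ∈ T.orbit i) : n j = n i :=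
        (T.orbit_induction (p := fun j ↦ j ∈ D.simple ∧ n j = n i) hj ⟨hs hi, rfl⟩
          fun k hk ↦ ⟨(T.map_simple k).2 hk.1, (hn k hk.1).trans hk.2⟩).2
      obtain ⟨c, hc1, hc⟩ := T.exists_smul_avg_mem_folded i
      have hc0 : 0 < c := by linarith
      rw [Finset.sum_congr rfl fun j hj ↦ by rw [hconst j hj], ← Finset.smul_sum,
        ← T.dualVector_foldedSimple (hs hi) hc0 hc, Int.cast_smul_eq_zsmul]
      exact zsmul_mem (AddSubgroup.subset_closure
        (Set.mem_image_of_mem _ (T.mem_foldedSimple_of_smul (hs hi) hc0 hc))) _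

end Automorphism

end BasedRootSystem

/-! ### Generators of the fixed Weyl group, and irreducibility -/

namespace BasedRootSystem

variable {ι V : Type*} [AddCommGroup V] [Module ℝ V] {D : BasedRootSystem ι V}

namespace Automorphism

variable [Fintype ι]

lemma IsOrbitReflection.apply_self {T : D.Automorphism} {i : ι} {g : V ≃ₗ[ℝ] V}
    (hg : T.IsOrbitReflection i g) (h : T.avg (D.root i) ∈ T.folded) :
    g (T.avg (D.root i)) = -T.avg (D.root i) := by
  rw [hg.apply_of_fixed h fun j ↦ by rw [T.lin_avg], form_smul_dualVector,
    form_dualVector_self (T.avg_ne_zero i)]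
  module

lemma height_map_of_mem_orbit (T : D.Automorphism) {g : V ≃ₗ[ℝ] V} (hw : g ∈ D.weyl)
    (hg : Commute g T.lin) {i j : ι} (h : j ∈ T.orbit i) :
    D.height (g (D.root j)) = D.height (g (D.root i)) := by
  refine T.eq_of_mem_orbit (f := fun j ↦ D.height (g (D.root j))) (fun k ↦ ?_) h
  obtain ⟨l, hl⟩ := D.exists_weyl_root hw k
  rw [← T.map_root, ← LinearEquiv.mul_apply, hg.eq, LinearEquiv.mul_apply, ← hl, T.map_root,
    T.height_perm]

/-- The elements of the Weyl group that commute with an automorphism are generated by the products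
of the reflections in the orbits of roots that define folded roots. -/
lemma mem_closure_of_commute (T : D.Automorphism) {g : V ≃ₗ[ℝ] V} (hw : g ∈ D.weyl)
    (hg : Commute g T.lin) :
    g ∈ Subgroup.closure {w | ∃ i, T.avg (D.root i) ∈ T.folded ∧ T.IsOrbitReflection i w} := by
  classical
  -- Induction on the number of positive roots that `g` makes negative.
  generalize hn : (Finset.univ.filter fun k ↦ D.IsPos k ∧ D.height (g (D.root k)) < 0).card = n
  induction n using Nat.strongRec generalizing g with
  | ind n ih =>
  by_cases hall : ∀ i ∈ D.simple, 0 < D.height (g (D.root i))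
  · rw [D.eq_one_of_forall_height_pos hw hall]
    exact one_mem _
  push Not at hall
  obtain ⟨i, hi, hgi⟩ := hall
  replace hgi : D.height (g (D.root i)) < 0 := by
    refine lt_of_le_of_ne hgi ?_
    obtain ⟨k, hk⟩ := D.exists_weyl_root hw i
    rw [← hk]
    exact D.height_ne_zero k
  obtain ⟨c, hc1, hc⟩ := T.exists_smul_avg_mem_folded i
  have hc0 : 0 < c := by linarith
  obtain ⟨⟨l, hl⟩, -⟩ := T.mem_folded_iff.1 hc
  have hlf : T.avg (D.root l) ∈ T.folded := by rw [hl]; exact hc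
  obtain ⟨w, hwr⟩ := T.exists_isOrbitReflection hlf
  choose φ hφ using D.exists_weyl_root hwr.mem_weyl
  -- A positive root supported on the orbit of i has its average reversed by w, so w makes it
  -- negative, still supported there. As g makes each simple root of the orbit negative, g w would
  -- send it to nonnegative height.
  have hout (k : ι) (hk : D.IsPos k) (hk' : D.height ((g * w) (D.root k)) < 0) :
      ∃ m ∈ D.simple, m ∉ T.orbit i ∧ D.coord m (D.root k) ≠ 0 := by
    by_contra! hin
    have h1 : T.avg (D.root (φ k)) =
        (-(D.height (D.root k) / c)) • T.avg (D.root l) := by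
      have h2 : T.avg (D.root k) = (D.height (D.root k) / c) • T.avg (D.root l) := by
        rw [hl, smul_smul, div_mul_cancel₀ _ hc0.ne']
        exact T.avg_eq_height_smul hin
      rw [hφ, T.avg_commute hwr.commute, h2, map_smul, hwr.apply_self hlf, smul_neg, neg_smul]
    have hneg : D.height (D.root (φ k)) < 0 := by
      rw [← T.height_avg, h1, hl, map_smul, map_smul, T.height_avg_simple hi, smul_eq_mul,
        smul_eq_mul, mul_one, neg_mul, div_mul_cancel₀ _ hc0.ne', neg_lt_zero]
      exact hk.height_pos
    have hco := (D.coord_sign (φ k)).resolve_left (not_isPos_iff.2 hneg)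
    have hz : ∀ j ∈ D.simple, j ∉ T.orbit i → D.coord j (D.root (φ k)) = 0 := by
      intro j hj hji
      rw [hφ, hwr.coord_apply hi hl hj hji, hin j hj hji]
    rw [LinearEquiv.mul_apply, ← hφ, T.root_eq_sum_orbit hi hz, map_sum, map_sum] at hk'
    refine absurd hk' (not_lt.2 (Finset.sum_nonneg fun j hj ↦ ?_))
    rw [map_smul, map_smul, T.height_map_of_mem_orbit hw hg hj, smul_eq_mul]
    exact mul_nonneg_of_nonpos_of_nonpos (hco j ((T.simple_of_mem_orbit hj).2 hi)) hgi.le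
  -- The map induced by w sends the inversions of g w injectively into those of g, and misses i.
  have hlt : (Finset.univ.filter fun k ↦
      D.IsPos k ∧ D.height ((g * w) (D.root k)) < 0).card < n := by
    have hinj : Function.Injective φ := fun a b hab ↦ by
      have := hφ b
      rw [← hab, hφ a] at this
      exact D.root_injective (w.injective this)
    rw [← hn, ← Finset.card_image_of_injective _ hinj]
    apply Finset.card_lt_card
    rw [Finset.ssubset_iff_of_subset]
    · refine ⟨i, by simpa using ⟨D.isPos_simple hi, hgi⟩, ?_⟩
      rw [Finset.mem_image]
      rintro ⟨k, hk, hki⟩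
      rw [Finset.mem_filter] at hk
      obtain ⟨m, hm, hmi, hm0⟩ := hout k hk.2.1 hk.2.2
      rw [← hwr.coord_apply hi hl hm hmi, ← hφ, hki] at hm0
      refine hm0 (D.coord_of_ne m hm i hi ?_)
      rintro rfl
      exact hmi (T.self_mem_orbit m)
    · intro k' hk'
      rw [Finset.mem_image] at hk'
      obtain ⟨k, hk, rfl⟩ := hk'
      rw [Finset.mem_filter] at hk ⊢
      obtain ⟨m, hm, hmi, hm0⟩ := hout k hk.2.1 hk.2.2
      refine ⟨Finset.mem_univ _, isPos_of_coord_pos hm ?_, ?_⟩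
      · rw [hφ, hwr.coord_apply hi hl hm hmi]
        exact lt_of_le_of_ne (hk.2.1 m hm) hm0.symm
      · rw [hφ]
        exact hk.2.2
  have := ih _ hlt (mul_mem hw hwr.mem_weyl) (hg.mul_left hwr.commute) rfl
  rw [← mul_inv_cancel_right g w]
  exact mul_mem this (inv_mem (Subgroup.subset_closure ⟨l, hlf, hwr⟩))

/-- The product of α_i with the orbit sum of α_j has only nonpositive terms, so they all vanish with
the sum. -/
lemma form_simple_eq_zero (T : D.Automorphism) {i j : ι} (hi : i ∈ D.simple) (hj : j ∈ D.simple)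
    (h : D.form (T.avg (D.root i)) (T.avg (D.root j)) = 0) :
    D.form (D.root i) (D.root j) = 0 := by
  have hij : i ∉ T.orbit j := fun hij ↦ by
    rw [T.avg_of_mem_orbit hij] at h
    exact T.avg_ne_zero j (D.form_self_eq_zero h)
  rw [form_avg_avg, avg_eq, map_smul, map_sum, smul_eq_mul, mul_eq_zero, inv_eq_zero] at h
  refine (Finset.sum_eq_zero_iff_of_nonpos fun k hk ↦ ?_).1
    (h.resolve_left (T.card_orbit_pos j).ne') j (T.self_mem_orbit j)
  exact D.form_simple_nonpos hi ((T.simple_of_mem_orbit hk).2 hj) (by rintro rfl; exact hij hk)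

/-- Folding preserves irreducibility. -/
lemma irreducible_folded (T : D.Automorphism)
    (hirr : ∀ s : Set ι, s.Nonempty → sᶜ.Nonempty →
      ∃ i ∈ s, ∃ j ∈ sᶜ, D.form (D.root i) (D.root j) ≠ 0)
    (s : Set T.folded) (hs : s.Nonempty) (hs' : sᶜ.Nonempty) :
    ∃ α ∈ s, ∃ β ∈ sᶜ, D.form (α : V) β ≠ 0 := by
  by_contra! h
  choose c hc1 hc using T.exists_smul_avg_mem_folded
  have hc0 (i : ι) : c i ≠ 0 := by linarith [hc1 i]
  have hsep {i j : ι} (hi : (⟨_, hc i⟩ : T.folded) ∈ s) (hj : (⟨_, hc j⟩ : T.folded) ∈ sᶜ) :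
      D.form (T.avg (D.root i)) (T.avg (D.root j)) = 0 := by
    simpa [hc0] using h _ hi _ hj
  have hzero {β : T.folded} (hβ : ∀ i ∈ D.simple, D.form (T.avg (D.root i)) β = 0) : False := by
    obtain ⟨⟨k, hk⟩, -⟩ := T.mem_folded_iff.1 β.2
    refine T.folded_ne_zero β.2 (D.form_self_eq_zero ?_)
    conv_lhs => enter [1]; rw [← hk, T.avg_eq_sum]
    rw [map_sum, LinearMap.sum_apply]
    exact Finset.sum_eq_zero fun i hi ↦ by rw [map_smul, LinearMap.smul_apply, hβ i hi, smul_zero]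
  obtain ⟨i₁, hi₁, hs₁⟩ : ∃ i ∈ D.simple, (⟨_, hc i⟩ : T.folded) ∈ s := by
    by_contra! hcon
    obtain ⟨α, hα⟩ := hs
    refine hzero (β := α) fun i hi ↦ ?_
    have := h α hα ⟨_, hc i⟩ (hcon i hi)
    rw [D.symm]
    simpa [hc0] using this
  obtain ⟨i₂, hi₂, hs₂⟩ : ∃ i ∈ D.simple, (⟨_, hc i⟩ : T.folded) ∈ sᶜ := by
    by_contra! hcon
    obtain ⟨β, hβ⟩ := hs'
    refine hzero (β := β) fun i hi ↦ ?_
    have := h ⟨_, hc i⟩ (by simpa using hcon i hi) β hβ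
    simpa [hc0] using this
  -- The class of the folded root on its ray divides the simple roots into two parts, which are
  -- nonempty and mutually orthogonal.
  let J : Set ι := {i | i ∈ D.simple ∧ (⟨_, hc i⟩ : T.folded) ∈ s}
  let J' : Set ι := {i | i ∈ D.simple ∧ (⟨_, hc i⟩ : T.folded) ∈ sᶜ}
  let U := Submodule.span ℝ (D.root '' J)
  let U' := Submodule.span ℝ (D.root '' J')
  have hUU' : ∀ u ∈ U, ∀ v ∈ U', D.form u v = 0 := by
    intro u hu v hv
    induction hu using Submodule.span_induction with
    | mem x hx =>
      obtain ⟨i, hi, rfl⟩ := hx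
      induction hv using Submodule.span_induction with
      | mem y hy =>
        obtain ⟨j, hj, rfl⟩ := hy
        exact T.form_simple_eq_zero hi.1 hj.1 (hsep hi.2 hj.2)
      | zero => rw [map_zero]
      | add y z _ _ hy hz => rw [map_add, hy, hz, add_zero]
      | smul a y _ hy => rw [map_smul, hy, smul_zero]
    | zero => rw [map_zero, LinearMap.zero_apply]
    | add y z _ _ hy hz => rw [map_add, LinearMap.add_apply, hy, hz, add_zero]
    | smul a y _ hy => rw [map_smul, LinearMap.smul_apply, hy, smul_zero]
  -- A simple reflection from one part fixes the subspace of the other part and preserves its own.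
  have hroot (k : ι) : D.root k ∈ U ∨ D.root k ∈ U' := by
    refine D.root_induction (p := fun k ↦ D.root k ∈ U ∨ D.root k ∈ U') ?_ ?_ ?_ k
    · intro i hi
      by_cases his : (⟨_, hc i⟩ : T.folded) ∈ s
      · exact Or.inl (Submodule.subset_span ⟨i, ⟨hi, his⟩, rfl⟩)
      · exact Or.inr (Submodule.subset_span ⟨i, ⟨hi, his⟩, rfl⟩)
    · intro i hi j k hk hj
      rw [hk, reflection_apply']
      by_cases his : (⟨_, hc i⟩ : T.folded) ∈ s
      · have hiU : D.root i ∈ U := Submodule.subset_span ⟨i, ⟨hi, his⟩, rfl⟩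
        rcases hj with hj | hj
        · exact Or.inl (U.sub_mem hj (U.smul_mem _ hiU))
        · rw [coroot, map_smul, D.symm (D.root j), hUU' _ hiU _ hj, smul_zero, zero_smul, sub_zero]
          exact Or.inr hj
      · have hiU : D.root i ∈ U' := Submodule.subset_span ⟨i, ⟨hi, his⟩, rfl⟩
        rcases hj with hj | hj
        · rw [coroot, map_smul, hUU' _ hj _ hiU, smul_zero, zero_smul, sub_zero]
          exact Or.inl hj
        · exact Or.inr (U'.sub_mem hj (U'.smul_mem _ hiU))
    · intro j k hk hj
      rw [hk, neg_mem_iff, neg_mem_iff]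
      exact hj
  obtain ⟨i, hi, j, hj, hij⟩ := hirr {k | D.root k ∈ U}
    ⟨i₁, Submodule.subset_span ⟨i₁, ⟨hi₁, hs₁⟩, rfl⟩⟩
    ⟨i₂, fun hU ↦ D.root_ne_zero i₂ (D.form_self_eq_zero
      (hUU' _ hU _ (Submodule.subset_span ⟨i₂, ⟨hi₂, hs₂⟩, rfl⟩)))⟩
  exact hij (hUU' _ hi _ ((hroot j).resolve_left hj))

end Automorphism

end BasedRootSystem

/-! ### Passage from the root datum to a root system in V -/

lemma LinearIndepOn.exists_coord {ι V : Type*} [AddCommGroup V] [Module ℝ V] {v : ι → V}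
    {s : Finset ι} (hv : LinearIndepOn ℝ v (s : Set ι)) :
    ∃ ω : ι → Module.Dual ℝ V, (∀ i ∈ s, ω i (v i) = 1) ∧
      ∀ i ∈ s, ∀ j ∈ s, i ≠ j → ω i (v j) = 0 := by
  classical
  obtain ⟨L, hL⟩ := (Finsupp.linearCombination ℝ fun j : (s : Set ι) ↦
    v j).exists_leftInverse_of_injective
    (LinearMap.ker_eq_bot.2 hv)
  have h (j : ι) (hj : j ∈ s) : L (v j) = Finsupp.single (⟨j, hj⟩ : (s : Set ι)) 1 := by
    have := DFunLike.congr_fun hL (Finsupp.single (⟨j, hj⟩ : (s : Set ι)) 1)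
    simpa using this
  refine ⟨fun i ↦ if hi : i ∈ s then Finsupp.lapply (⟨i, hi⟩ : (s : Set ι)) ∘ₗ L else 0,
    fun i hi ↦ ?_, fun i hi j hj hij ↦ ?_⟩
  · simp [hi, h i hi]
  · simp [hi, h j hj, hij.symm]

lemma coord_sum_smul {ι V : Type*} [AddCommGroup V] [Module ℝ V] {v : ι → V}
    {s : Finset ι} {ω : ι → Module.Dual ℝ V} (h1 : ∀ i ∈ s, ω i (v i) = 1)
    (h2 : ∀ i ∈ s, ∀ j ∈ s, i ≠ j → ω i (v j) = 0) {i : ι} (hi : i ∈ s) (f : ι → ℝ) :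
    ω i (∑ j ∈ s, f j • v j) = f i := by
  rw [map_sum, Finset.sum_eq_single_of_mem i hi, map_smul, h1 i hi, smul_eq_mul, mul_one]
  intro j hj hji
  rw [map_smul, h2 i hi j hj hji.symm, smul_zero]

/-- A free module is flat, so tensoring preserves the injectivity of ℤ → ℝ. -/
lemma coweightIncl_injective (Y : Type*) [AddCommGroup Y] [Module.Free ℤ Y] :
    Function.Injective (coweightIncl Y) := by
  have := Module.Flat.rTensor_preserves_injective_linearMap (M := Y)
    (Algebra.linearMap ℤ ℝ) (algebraMap ℤ ℝ).injective_int
  intro x y h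
  have h2 : (Algebra.linearMap ℤ ℝ).rTensor Y ((1 : ℤ) ⊗ₜ[ℤ] x) =
      (Algebra.linearMap ℤ ℝ).rTensor Y ((1 : ℤ) ⊗ₜ[ℤ] y) := by
    simpa [coweightIncl_apply] using h
  simpa using congrArg (TensorProduct.lid ℤ Y) (this h2)

namespace RootPairing

variable {ι X Y : Type*} [AddCommGroup X] [AddCommGroup Y] {P : RootPairing ι ℤ X Y}
  {B : LinearMap.BilinForm ℝ (CoweightSpace Y)}

lemma weightFunctional_coweightIncl (x : X) (y : Y) :
    P.weightFunctional x (coweightIncl Y y) = P.toLinearMap x y := by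
  rw [coweightIncl_apply, weightFunctional_tmul, mul_one]

lemma weightFunctional_add (x x' : X) :
    P.weightFunctional (x + x') = P.weightFunctional x + P.weightFunctional x' := by
  ext y
  simp

lemma weightFunctional_injective : Function.Injective P.weightFunctional := by
  intro x x' h
  apply P.toPerfPair.injective
  ext y
  have := LinearMap.congr_fun h (coweightIncl Y y)
  rw [weightFunctional_coweightIncl, weightFunctional_coweightIncl] at this
  exact_mod_cast this

lemma realReflection_apply (i : ι) (v : CoweightSpace Y) :
    P.realReflection i v = v - P.weightFunctional (P.root i) v • P.realCoroot i := by
  simp [realReflection, Module.reflection_apply]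

lemma realCoroot_ne_zero (i : ι) : P.realCoroot i ≠ 0 := fun h ↦ by
  have := P.weightFunctional_realCoroot i
  rw [h, map_zero] at this
  norm_num at this

namespace IsInvariantInner

variable (hB : P.IsInvariantInner B)
include hB

/-- This is invariance under the reflection, applied to the coroot, which the reflection negates. -/
lemma form_realCoroot (i : ι) (v : CoweightSpace Y) :
    2 * B (P.realCoroot i) v =
      P.weightFunctional (P.root i) v * B (P.realCoroot i) (P.realCoroot i) := by
  have h := hB.invariant _ (Subgroup.subset_closure (Set.mem_range_self i))
    (P.realCoroot i) v
  rw [realReflection_apply, realReflection_apply, weightFunctional_realCoroot] at h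
  simp only [map_sub, map_smul, LinearMap.sub_apply, LinearMap.smul_apply, smul_eq_mul] at h
  linarith

lemma form_rootVector (i : ι) (v : CoweightSpace Y) :
    B (P.rootVector B i) v = P.weightFunctional (P.root i) v := by
  have h := hB.form_realCoroot i v
  have h0 := (hB.pos _ (realCoroot_ne_zero (P := P) i)).ne'
  rw [rootVector, map_smul, LinearMap.smul_apply, smul_eq_mul, div_mul_eq_mul_div, h]
  field_simp

lemma eq_of_form_eq {v w : CoweightSpace Y} (h : ∀ u, B v u = B w u) : v = w := by
  by_contra hne
  have h1 := hB.pos _ (sub_ne_zero.2 hne)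
  rw [B.map_sub, LinearMap.sub_apply, h, sub_self] at h1
  exact lt_irrefl _ h1

lemma rootVector_ne_zero (i : ι) : P.rootVector B i ≠ 0 :=
  smul_ne_zero (div_ne_zero two_ne_zero (hB.pos _ (realCoroot_ne_zero (P := P) i)).ne')
    (realCoroot_ne_zero i)

lemma smul_rootVector (i : ι) :
    (2 / B (P.rootVector B i) (P.rootVector B i)) • P.rootVector B i = P.realCoroot i := by
  have h0 := (hB.pos _ (realCoroot_ne_zero (P := P) i)).ne'
  simp only [rootVector, map_smul, LinearMap.smul_apply, smul_eq_mul, smul_smul]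
  conv_rhs => rw [← one_smul ℝ (P.realCoroot i)]
  congr 1
  field_simp

/-- The nondegenerate form identifies V with its dual. The resulting embedding of the weights into V
transports integral identities between roots to root vectors. -/
lemma exists_weightVector [Module.Finite ℤ Y] :
    ∃ τ : X →+ CoweightSpace Y, Function.Injective τ ∧
      (∀ x v, B (τ x) v = P.weightFunctional x v) ∧ ∀ i, τ (P.root i) = P.rootVector B i := by
  have hnd : LinearMap.BilinForm.Nondegenerate B := by
    refine ⟨fun v hv ↦ ?_, fun v hv ↦ ?_⟩ <;>
    · by_contra h
      exact (hB.pos v h).ne' (hv v)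
  have hτ (x : X) (v : CoweightSpace Y) :
      B ((LinearMap.BilinForm.toDual B hnd).symm (P.weightFunctional x)) v =
        P.weightFunctional x v := by
    rw [LinearMap.BilinForm.apply_toDual_symm_apply]
  refine ⟨AddMonoidHom.mk' (fun x ↦ (LinearMap.BilinForm.toDual B hnd).symm
    (P.weightFunctional x)) fun x y ↦ by rw [weightFunctional_add, map_add], ?_, hτ, fun i ↦ ?_⟩
  · exact (LinearEquiv.injective _).comp weightFunctional_injective
  · exact hB.eq_of_form_eq fun v ↦ (hτ _ v).trans (hB.form_rootVector i v).symm

lemma form_rootVector_realCoroot (i j : ι) :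
    B (P.rootVector B i) (P.realCoroot j) = P.pairing i j := by
  rw [hB.form_rootVector, realCoroot, weightFunctional_coweightIncl]
  rfl

/-- Root vectors are nonzero multiples of coroots, and independence of the simple coroots over ℤ
survives extension of scalars. -/
lemma linearIndepOn_rootVector [Module.Finite ℤ Y] (b : P.Base) :
    LinearIndepOn ℝ (P.rootVector B) (b.support : Set ι) := by
  have : Module.IsReflexive ℤ Y := .of_isPerfPair P.flip.toLinearMap
  have : Module.Free ℤ Y := inferInstance
  have h := Module.Flat.linearIndependent_one_tmul (S := ℝ) b.linearIndepOn_coroot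
  have h2 := LinearIndependent.units_smul h
    fun j ↦ Units.mk0 (2 / B (P.realCoroot j) (P.realCoroot j)) (div_ne_zero two_ne_zero
      (hB.pos _ (realCoroot_ne_zero (P := P) j)).ne')
  exact h2

lemma exists_rootVector_eq_sum [Module.Finite ℤ Y] (b : P.Base) (i : ι) :
    ∃ f : ι → ℤ, (0 < f ∨ f < 0) ∧
      P.rootVector B i = ∑ j ∈ b.support, (f j : ℝ) • P.rootVector B j := by
  obtain ⟨τ, -, -, hr⟩ := hB.exists_weightVector
  obtain ⟨f, -, hf, h⟩ := b.exists_root_eq_sum_int i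
  refine ⟨f, hf, ?_⟩
  rw [← hr, h, map_sum]
  exact Finset.sum_congr rfl fun j _ ↦ by rw [map_zsmul, hr, Int.cast_smul_eq_zsmul]

end IsInvariantInner

lemma realCoroot_mem_closure (b : P.Base) (i : ι) :
    P.realCoroot i ∈ AddSubgroup.closure (P.realCoroot '' (b.support : Set ι)) := by
  have h := b.coroot_mem_span_int i
  rw [← Submodule.mem_toAddSubgroup, Submodule.span_int_eq_addSubgroupClosure] at h
  have h2 := AddSubgroup.mem_map_of_mem (coweightIncl Y) h
  rw [AddMonoidHom.map_closure, Set.image_image] at h2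
  exact h2

/-- The based root system in `V` formed by the vectors that represent the roots. -/
def toBasedRootSystem (P : RootPairing ι ℤ X Y) [Finite ι] [Module.Finite ℤ Y]
    (hred : P.IsReduced) (b : P.Base) (hB : P.IsInvariantInner B) : BasedRootSystem ι (CoweightSpace Y) where
  form := B
  symm := hB.symm
  pos := hB.pos
  root := P.rootVector B
  root_injective := by
    obtain ⟨τ, hτ, -, hr⟩ := hB.exists_weightVector
    intro i j h
    rw [← hr, ← hr] at h
    exact P.root.injective (hτ h)
  root_ne_zero := hB.rootVector_ne_zero
  integral i j := ⟨P.pairing i j, by rw [hB.smul_rootVector, hB.form_rootVector_realCoroot]⟩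
  reflection_mem i j := by
    obtain ⟨τ, -, -, hr⟩ := hB.exists_weightVector
    refine ⟨P.reflectionPerm j i, ?_⟩
    rw [hB.smul_rootVector, hB.form_rootVector_realCoroot, ← hr, ← hr, ← hr,
      root_reflectionPerm, reflection_apply_root, map_sub, map_zsmul, Int.cast_smul_eq_zsmul]
  sub_mem i j hij h := by
    obtain ⟨τ, -, -, hr⟩ := hB.exists_weightVector
    have hp : (0 : ℝ) < P.pairing i j := by
      rw [← hB.form_rootVector_realCoroot, ← hB.smul_rootVector, map_smul, smul_eq_mul]
      exact mul_pos (div_pos two_pos (hB.pos _ (hB.rootVector_ne_zero j))) h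
    have hp' : 0 < P.pairingIn ℤ i j := by
      have : P.pairingIn ℤ i j = P.pairing i j := P.algebraMap_pairingIn ℤ i j
      rw [this]
      exact_mod_cast hp
    obtain ⟨k, hk⟩ := P.root_sub_root_mem_of_pairingIn_pos hp' hij
    exact ⟨k, by rw [← hr, ← hr, ← hr, hk, map_sub]⟩
  reduced i j c h := by
    obtain ⟨τ, hτ, -, hr⟩ := hB.exists_weightVector
    -- A real factor c makes 2c an integer, which turns the relation into a dependence over ℤ.
    have hp : (P.pairing i j : ℝ) = c * 2 := by
      rw [← hB.form_rootVector_realCoroot, h, map_smul, LinearMap.smul_apply,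
        hB.form_rootVector_realCoroot, P.pairing_same]
      norm_num
    have h1 : (2 : ℤ) • P.root i = P.pairing i j • P.root j := by
      apply hτ
      rw [map_zsmul, map_zsmul, hr, hr, ← Int.cast_smul_eq_zsmul ℝ, ← Int.cast_smul_eq_zsmul ℝ, hp,
        h, smul_smul, mul_comm]
      norm_num
    have h2 : ¬ LinearIndependent ℤ ![P.root i, P.root j] := by
      intro hli
      have := (LinearIndependent.pair_iff.1 hli 2 (-P.pairing i j) (by rw [h1]; module)).1
      norm_num at this
    have h3 := hB.rootVector_ne_zero j
    rcases hred.eq_or_eq_neg i j h2 with h4 | h4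
    · left
      rw [← hr, h4, hr, ← sub_eq_zero] at h
      have : (1 - c) • P.rootVector B j = 0 := by rw [sub_smul, one_smul, h]
      linarith [(smul_eq_zero.1 this).resolve_right h3]
    · right
      rw [← hr, h4, map_neg, hr, ← sub_eq_zero] at h
      have : (-1 - c) • P.rootVector B j = 0 := by rw [sub_smul, neg_smul, one_smul, h]
      linarith [(smul_eq_zero.1 this).resolve_right h3]
  simple := b.support
  coord := (hB.linearIndepOn_rootVector b).exists_coord.choose
  coord_self := (hB.linearIndepOn_rootVector b).exists_coord.choose_spec.1
  coord_of_ne := (hB.linearIndepOn_rootVector b).exists_coord.choose_spec.2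
  root_eq_sum i := by
    obtain ⟨h1, h2⟩ := (hB.linearIndepOn_rootVector b).exists_coord.choose_spec
    obtain ⟨f, -, h⟩ := hB.exists_rootVector_eq_sum b i
    conv_lhs => rw [h]
    exact Finset.sum_congr rfl fun j hj ↦ by rw [h, coord_sum_smul h1 h2 hj fun j ↦ (f j : ℝ)]
  coord_int i j hj := by
    obtain ⟨h1, h2⟩ := (hB.linearIndepOn_rootVector b).exists_coord.choose_spec
    obtain ⟨f, -, h⟩ := hB.exists_rootVector_eq_sum b i
    exact ⟨f j, by rw [h, coord_sum_smul h1 h2 hj fun j ↦ (f j : ℝ)]⟩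
  coord_sign i := by
    obtain ⟨h1, h2⟩ := (hB.linearIndepOn_rootVector b).exists_coord.choose_spec
    obtain ⟨f, hf, h⟩ := hB.exists_rootVector_eq_sum b i
    refine hf.imp (fun hf j hj ↦ ?_) fun hf j hj ↦ ?_
    · rw [h, coord_sum_smul h1 h2 hj fun j ↦ (f j : ℝ)]
      exact_mod_cast hf.le j
    · rw [h, coord_sum_smul h1 h2 hj fun j ↦ (f j : ℝ)]
      exact_mod_cast hf.le j
  coroot_mem i := by
    have h : (fun j ↦ (2 / B (P.rootVector B j) (P.rootVector B j)) • P.rootVector B j) =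
        P.realCoroot := funext hB.smul_rootVector
    rw [h, hB.smul_rootVector]
    exact realCoroot_mem_closure b i

namespace IsAutomorphism

variable {b : P.Base} {Θ : CoweightSpace Y ≃ₗ[ℝ] CoweightSpace Y}

/-- Roots are carried to roots by f ↦ f ∘ Θ⁻¹. Since Θ is an isometry, on representing vectors this
is Θ itself. -/
lemma exists_perm [Finite ι] (hB : P.IsInvariantInner B) (hΘ : P.IsAutomorphism b B Θ) :
    ∃ σ : Equiv.Perm ι, (∀ i, Θ (P.rootVector B i) = P.rootVector B (σ i)) ∧
      ∀ i, σ i ∈ b.support ↔ i ∈ b.support := by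
  have hex (i : ι) : ∃ j, P.weightFunctional (P.root j) =
      P.weightFunctional (P.root i) ∘ₗ Θ.symm.toLinearMap := by
    refine (hΘ.roots _).1 ⟨i, ?_⟩
    ext v
    simp
  choose σ hσ using hex
  have hσ' (i : ι) : P.weightFunctional (P.root (σ i)) ∘ₗ Θ.toLinearMap =
      P.weightFunctional (P.root i) := by
    rw [hσ]
    ext v
    simp
  have hinj : Function.Injective σ := fun i j hij ↦ by
    have := hσ' i
    rw [hij, hσ' j] at this
    exact (P.root.injective (weightFunctional_injective this)).symm
  refine ⟨Equiv.ofBijective σ (Finite.injective_iff_bijective.1 hinj), fun i ↦ ?_, fun i ↦ ?_⟩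
  · refine hB.eq_of_form_eq fun v ↦ ?_
    obtain ⟨u, rfl⟩ := Θ.surjective v
    rw [hΘ.isometry, hB.form_rootVector, hB.form_rootVector, Equiv.ofBijective_apply, ← hσ' i]
    rfl
  · have hmem (j : ι) : P.weightFunctional (P.root j) ∈
        (fun i ↦ P.weightFunctional (P.root i)) '' (b.support : Set ι) ↔ j ∈ b.support := by
      constructor
      · rintro ⟨k, hk, h⟩
        exact P.root.injective (weightFunctional_injective h) ▸ hk
      · exact fun h ↦ ⟨j, h, rfl⟩
    rw [Equiv.ofBijective_apply, ← hmem, ← hΘ.simpleRoots, hσ', hmem]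

/-- The automorphism of the based root system in `V` defined by an automorphism of a based root
datum. -/
def toAutomorphism [Finite ι] [Module.Finite ℤ Y] (hred : P.IsReduced)
    (hB : P.IsInvariantInner B) (hΘ : P.IsAutomorphism b B Θ) :
    (P.toBasedRootSystem hred b hB).Automorphism where
  lin := Θ
  perm := (hΘ.exists_perm hB).choose
  isometry := hΘ.isometry
  map_root := (hΘ.exists_perm hB).choose_spec.1
  map_simple := (hΘ.exists_perm hB).choose_spec.2

end IsAutomorphism

end RootPairing

/-! ### Construction of the folded root datum -/

namespace BasedRootSystem.Automorphism

variable {ι V : Type*} [AddCommGroup V] [Module ℝ V] {D : BasedRootSystem ι V} [Fintype ι]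

lemma exists_orbitReflection_folded (T : D.Automorphism) {β : V} (h : β ∈ T.folded) :
    ∃ i w, T.avg (D.root i) ∈ T.folded ∧ T.IsOrbitReflection i w ∧
      ∀ v, (∀ j, D.form (D.root j) (T.lin v) = D.form (D.root j) v) →
        w v = v - D.form β v • D.dualVector β := by
  obtain ⟨⟨i, rfl⟩, -⟩ := T.mem_folded_iff.1 h
  obtain ⟨w, hw⟩ := T.exists_isOrbitReflection h
  exact ⟨i, w, h, hw, fun v hv ↦ hw.apply_of_fixed h hv⟩

/-- The folded roots are stable under the reflections in folded roots, and the passage to coroots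
is compatible with these reflections. -/
lemma reflection_mem_folded (T : D.Automorphism) {α β : V} (hα : α ∈ T.folded)
    (hβ : β ∈ T.folded) :
    α - D.form α (D.dualVector β) • β ∈ T.folded ∧
      D.dualVector (α - D.form α (D.dualVector β) • β) =
        D.dualVector α - D.form β (D.dualVector α) • D.dualVector β := by
  obtain ⟨i, w, -, hw, h⟩ := T.exists_orbitReflection_folded hβ
  have h1 := h α fun j ↦ by rw [T.lin_folded hα]
  have h2 := h (D.dualVector α) fun j ↦ by rw [T.dualVector_fixed hα]
  rw [form_smul_dualVector] at h1
  rw [← h1, dualVector_map hw.mem_weyl, h2]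
  exact ⟨T.map_mem_folded hw.mem_weyl hw.commute hα, rfl⟩

end BasedRootSystem.Automorphism

namespace RootPairing

variable {ι X Y : Type*} [AddCommGroup X] [AddCommGroup Y] {P : RootPairing ι ℤ X Y}
  {B : LinearMap.BilinForm ℝ (CoweightSpace Y)} {b : P.Base}
  {Θ : CoweightSpace Y ≃ₗ[ℝ] CoweightSpace Y}

section FoldedCoweights

lemma mem_foldedCoweights_iff {y : Y} :
    y ∈ P.foldedCoweights Θ ↔ ∃ z : Y, (∀ i, P.toLinearMap (P.root i) z = 0) ∧
      coweightIncl Y z = coweightIncl Y y - Θ (coweightIncl Y y) := by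
  simp [foldedCoweights, centralCoweights, AddSubgroup.mem_iInf]

lemma mem_foldedCoweights_of_fixed {y : Y} (h : Θ (coweightIncl Y y) = coweightIncl Y y) :
    y ∈ P.foldedCoweights Θ :=
  mem_foldedCoweights_iff.2 ⟨0, by simp, by simp [h]⟩

lemma weightFunctional_of_mem_foldedCoweights {y : Y} (h : y ∈ P.foldedCoweights Θ) (i : ι) :
    P.weightFunctional (P.root i) (Θ (coweightIncl Y y)) =
      P.weightFunctional (P.root i) (coweightIncl Y y) := by
  obtain ⟨z, hz, hzy⟩ := mem_foldedCoweights_iff.1 h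
  have h1 := congrArg (P.weightFunctional (P.root i)) hzy
  rw [weightFunctional_coweightIncl, hz, map_sub, Int.cast_zero] at h1
  linarith

lemma foldedIncl_coweightIncl (y : P.foldedCoweights Θ) :
    P.foldedIncl Θ (coweightIncl _ y) = coweightIncl Y (y : Y) := by
  rw [coweightIncl_apply, coweightIncl_apply, foldedIncl, LinearMap.baseChange_tmul]
  rfl

/-- A coweight in X_*^{[Θ]} differs from its image under Θ by one on which the roots vanish, and the
equality extends linearly. It provides the invariance required by the averaging lemmas. -/
lemma weightFunctional_foldedIncl (v : CoweightSpace (P.foldedCoweights Θ)) (i : ι) :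
    P.weightFunctional (P.root i) (Θ (P.foldedIncl Θ v)) =
      P.weightFunctional (P.root i) (P.foldedIncl Θ v) := by
  suffices P.weightFunctional (P.root i) ∘ₗ Θ.toLinearMap ∘ₗ P.foldedIncl Θ =
      P.weightFunctional (P.root i) ∘ₗ P.foldedIncl Θ from LinearMap.congr_fun this v
  ext y
  have h := weightFunctional_of_mem_foldedCoweights y.2 i
  rw [← foldedIncl_coweightIncl] at h
  exact h

lemma form_foldedIncl (hB : P.IsInvariantInner B) (v : CoweightSpace (P.foldedCoweights Θ))
    (i : ι) :
    B (P.rootVector B i) (Θ (P.foldedIncl Θ v)) = B (P.rootVector B i) (P.foldedIncl Θ v) := by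
  rw [hB.form_rootVector, hB.form_rootVector, weightFunctional_foldedIncl]

instance [Module.Finite ℤ Y] : Module.Finite ℤ (P.foldedCoweights Θ) :=
  Module.Finite.of_injective (P.foldedCoweights Θ).subtype.toIntLinearMap Subtype.val_injective

instance [Module.Free ℤ Y] [Module.Finite ℤ Y] : Module.Free ℤ (P.foldedCoweights Θ) :=
  inferInstanceAs (Module.Free ℤ (AddSubgroup.toIntSubmodule (P.foldedCoweights Θ)))

lemma foldedIncl_injective : Function.Injective (P.foldedIncl Θ) :=
  Module.Flat.lTensor_preserves_injective_linearMap (M := ℝ)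
    (P.foldedCoweights Θ).subtype.toIntLinearMap Subtype.val_injective

end FoldedCoweights

lemma free_coweights (P : RootPairing ι ℤ X Y) [Module.Finite ℤ Y] : Module.Free ℤ Y := by
  have : Module.IsReflexive ℤ Y := .of_isPerfPair P.flip.toLinearMap
  infer_instance

variable [Fintype ι] [Module.Finite ℤ Y] (hred : P.IsReduced) (hB : P.IsInvariantInner B)
  (hΘ : P.IsAutomorphism b B Θ)

lemma toBasedRootSystem_coroot (i : ι) :
    (P.toBasedRootSystem hred b hB).coroot i = P.realCoroot i := hB.smul_rootVector i

lemma toBasedRootSystem_reflection (i : ι) :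
    (P.toBasedRootSystem hred b hB).reflection i = P.realReflection i := by
  ext v
  rw [BasedRootSystem.reflection_apply, realReflection_apply, toBasedRootSystem_coroot,
    ← hB.form_rootVector]
  rfl

lemma toBasedRootSystem_weyl :
    (P.toBasedRootSystem hred b hB).weyl = P.realWeylGroup := by
  rw [BasedRootSystem.weyl, realWeylGroup, funext (toBasedRootSystem_reflection hred hB)]

lemma toBasedRootSystem_corootLattice :
    (P.toBasedRootSystem hred b hB).corootLattice = P.corootLattice := by
  rw [BasedRootSystem.corootLattice, corootLattice, funext (toBasedRootSystem_coroot hred hB)]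

lemma toAutomorphism_foldedSimple :
    (hΘ.toAutomorphism hred hB).foldedSimple = P.foldedSimpleRoots b B Θ :=
  (hΘ.toAutomorphism hred hB).foldedSimple_eq

include hred hB hΘ

/-- On X_*^{[Θ]} an orbit average pairs like each root of the orbit, so it restricts to the same
functional as an integral weight. -/
lemma exists_foldedRoot (β : P.foldedRoots B Θ) :
    ∃ f : Module.Dual ℤ (P.foldedCoweights Θ), ∀ y, (f y : ℝ) = B β (coweightIncl Y (y : Y)) := by
  obtain ⟨β, hβ⟩ := β
  obtain ⟨⟨i, rfl⟩, -⟩ := (hΘ.toAutomorphism hred hB).mem_folded_iff.1 hβ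
  refine ⟨P.toLinearMap (P.root i) ∘ₗ (P.foldedCoweights Θ).subtype.toIntLinearMap, fun y ↦ ?_⟩
  have h := (hΘ.toAutomorphism hred hB).form_avg (v := coweightIncl Y (y : Y)) (fun j ↦ by
    rw [← foldedIncl_coweightIncl]
    exact form_foldedIncl hB _ j) i
  refine Eq.trans ?_ h.symm
  refine Eq.trans ?_ (hB.form_rootVector i _).symm
  rw [weightFunctional_coweightIncl]
  rfl

/-- The folded coroot is a sum over an orbit of coroots, hence a coweight fixed by Θ. -/
lemma exists_foldedCoroot (β : P.foldedRoots B Θ) :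
    ∃ y : P.foldedCoweights Θ, coweightIncl Y (y : Y) =
      (2 / B (β : CoweightSpace Y) (β : CoweightSpace Y)) • (β : CoweightSpace Y) := by
  obtain ⟨β, hβ⟩ := β
  have hfix := (hΘ.toAutomorphism hred hB).dualVector_fixed hβ
  obtain ⟨⟨i, rfl⟩, -⟩ := (hΘ.toAutomorphism hred hB).mem_folded_iff.1 hβ
  have h := (hΘ.toAutomorphism hred hB).folded_coroot hβ
  have hy : coweightIncl Y (∑ j ∈ (hΘ.toAutomorphism hred hB).orbit i, P.coroot j) =
      ∑ j ∈ (hΘ.toAutomorphism hred hB).orbit i, (P.toBasedRootSystem hred b hB).coroot j := by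
    rw [map_sum]
    exact Finset.sum_congr rfl fun j _ ↦ (toBasedRootSystem_coroot hred hB j).symm
  rw [← h] at hy
  refine ⟨⟨_, mem_foldedCoweights_of_fixed ((congrArg Θ hy).trans (hfix.trans hy.symm))⟩, hy⟩

lemma foldedRoots_finite : (P.foldedRoots B Θ).Finite :=
  (hΘ.toAutomorphism hred hB).finite_folded

lemma foldedRoots_form_pos {β : CoweightSpace Y} (hβ : β ∈ P.foldedRoots B Θ) : 0 < B β β :=
  hB.pos _ ((hΘ.toAutomorphism hred hB).folded_ne_zero hβ)

/-- A vector in the span of the folded roots that is orthogonal to `X_*^{[Θ]}` vanishes. -/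
lemma eq_zero_of_mem_span_foldedRoots {v : CoweightSpace Y}
    (hv : v ∈ Submodule.span ℝ (P.foldedRoots B Θ))
    (h : ∀ y : P.foldedCoweights Θ, B v (coweightIncl Y (y : Y)) = 0) : v = 0 := by
  by_contra hne
  refine (hB.pos v hne).ne' ?_
  -- Each folded root is a multiple of its coroot, which lies in X_*^{[Θ]}; so v is orthogonal to
  -- the whole span, and thus to itself.
  have hle : Submodule.span ℝ (P.foldedRoots B Θ) ≤ LinearMap.ker (B v) := by
    rw [Submodule.span_le]
    intro β hβ
    obtain ⟨y, hy⟩ := exists_foldedCoroot hred hB hΘ ⟨β, hβ⟩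
    have h1 := h y
    rw [hy, map_smul, smul_eq_mul] at h1
    exact (mul_eq_zero.1 h1).resolve_left
      (div_ne_zero two_ne_zero (foldedRoots_form_pos hred hB hΘ hβ).ne')
  exact hle hv

lemma reflection_mem_foldedRoots (α β : P.foldedRoots B Θ) :
    ∃ γ : P.foldedRoots B Θ,
      (γ : CoweightSpace Y) = α - B α ((2 / B (β : CoweightSpace Y) β) • (β : CoweightSpace Y)) •
        (β : CoweightSpace Y) ∧
      (2 / B (γ : CoweightSpace Y) γ) • (γ : CoweightSpace Y) =
        (2 / B (α : CoweightSpace Y) α) • (α : CoweightSpace Y) -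
          B β ((2 / B (α : CoweightSpace Y) α) • (α : CoweightSpace Y)) •
            (2 / B (β : CoweightSpace Y) β) • (β : CoweightSpace Y) := by
  obtain ⟨h, h'⟩ := (hΘ.toAutomorphism hred hB).reflection_mem_folded α.2 β.2
  exact ⟨⟨_, h⟩, rfl, h'⟩

lemma exists_foldedDatum : ∃ Q : RootPairing (P.foldedRoots B Θ) ℤ
    (Module.Dual ℤ (P.foldedCoweights Θ)) (P.foldedCoweights Θ), P.IsFoldedDatum B Θ Q := by
  have := P.free_coweights
  have hfin : Finite (P.foldedRoots B Θ) := foldedRoots_finite hred hB hΘ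
  choose r hr using exists_foldedRoot hred hB hΘ
  choose c hc using exists_foldedCoroot hred hB hΘ
  have hincl : Function.Injective fun y : P.foldedCoweights Θ ↦ coweightIncl Y (y : Y) :=
    (coweightIncl_injective Y).comp Subtype.val_injective
  have hrinj : Function.Injective r := fun α β h ↦ by
    refine Subtype.ext (sub_eq_zero.1 (eq_zero_of_mem_span_foldedRoots hred hB hΘ
      (sub_mem (Submodule.subset_span α.2) (Submodule.subset_span β.2)) fun y ↦ ?_))
    rw [B.map_sub, LinearMap.sub_apply, ← hr, ← hr, h, sub_self]
  have hcinj : Function.Injective c := fun α β h ↦ by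
    have h1 : (2 / B (α : CoweightSpace Y) (α : CoweightSpace Y)) • (α : CoweightSpace Y) =
        (2 / B (β : CoweightSpace Y) (β : CoweightSpace Y)) • (β : CoweightSpace Y) := by
      rw [← hc, ← hc, h]
    have hα := foldedRoots_form_pos hred hB hΘ α.2
    have hβ := foldedRoots_form_pos hred hB hΘ β.2
    refine Subtype.ext ((hΘ.toAutomorphism hred hB).eq_of_smul_mem_folded β.2 α.2
      (div_pos (div_pos two_pos hβ) (div_pos two_pos hα)) ?_)
    rw [div_eq_inv_mul, mul_smul, ← h1, smul_smul, inv_mul_cancel₀ (div_pos two_pos hα).ne',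
      one_smul]
  have hpair (α β : P.foldedRoots B Θ) : (r α (c β) : ℝ) =
      B α ((2 / B (β : CoweightSpace Y) (β : CoweightSpace Y)) • (β : CoweightSpace Y)) := by
    rw [hr, hc]
  refine ⟨RootPairing.mk' LinearMap.id ⟨r, hrinj⟩ ⟨c, hcinj⟩ (fun β ↦ ?_) (fun β ↦ ?_)
    fun β ↦ ?_, fun f y ↦ rfl, hr, hc⟩
  · have : (r β (c β) : ℝ) = 2 := by
      rw [hpair, map_smul, smul_eq_mul, div_mul_cancel₀ _ (foldedRoots_form_pos hred hB hΘ β.2).ne']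
    exact_mod_cast this
  · rintro _ ⟨α, rfl⟩
    obtain ⟨γ, h, -⟩ := reflection_mem_foldedRoots hred hB hΘ α β
    refine ⟨γ, ?_⟩
    ext y
    have : (r γ y : ℝ) = r α y - r α (c β) * r β y := by
      rw [hr γ, hr α y, hr β, hpair, h, B.map_sub, LinearMap.sub_apply, map_smul B,
        LinearMap.smul_apply, smul_eq_mul]
    exact_mod_cast this
  · rintro _ ⟨α, rfl⟩
    obtain ⟨γ, -, h⟩ := reflection_mem_foldedRoots hred hB hΘ α β
    refine ⟨γ, hincl ?_⟩
    have h1 : coweightIncl Y ((c α - r β (c α) • c β : P.foldedCoweights Θ) : Y) =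
        coweightIncl Y (c γ : Y) := by
      rw [AddSubgroup.coe_sub, AddSubgroup.coe_zsmul, map_sub, map_zsmul, hc, hc, hc,
        ← Int.cast_smul_eq_zsmul ℝ, hpair, h]
    exact h1.symm

end RootPairing

/-! ### Reducedness, irreducibility and base of the folded datum -/

namespace RootPairing

variable {ι X Y : Type*} [AddCommGroup X] [AddCommGroup Y] {P : RootPairing ι ℤ X Y}
  {B : LinearMap.BilinForm ℝ (CoweightSpace Y)} {b : P.Base}
  {Θ : CoweightSpace Y ≃ₗ[ℝ] CoweightSpace Y}

/-- The passage from weights to functionals on `V`, as a homomorphism. -/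
def weightFunctionalHom (P : RootPairing ι ℤ X Y) : X →+ Module.Dual ℝ (CoweightSpace Y) :=
  AddMonoidHom.mk' P.weightFunctional weightFunctional_add

/-- The functional on `V^{[Θ]}` defined by a vector of `V`. -/
def foldedFunctional (P : RootPairing ι ℤ X Y) (B : LinearMap.BilinForm ℝ (CoweightSpace Y))
    (Θ : CoweightSpace Y ≃ₗ[ℝ] CoweightSpace Y) :
    CoweightSpace Y →ₗ[ℝ] Module.Dual ℝ (CoweightSpace (P.foldedCoweights Θ)) :=
  B.compl₂ (P.foldedIncl Θ)

lemma foldedFunctional_injOn [Fintype ι] [Module.Finite ℤ Y] (hred : P.IsReduced)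
    (hB : P.IsInvariantInner B) (hΘ : P.IsAutomorphism b B Θ) :
    Set.InjOn (P.foldedFunctional B Θ) (Submodule.span ℝ (P.foldedRoots B Θ)) := by
  intro v hv w hw h
  refine sub_eq_zero.1 (eq_zero_of_mem_span_foldedRoots hred hB hΘ (sub_mem hv hw) fun y ↦ ?_)
  have h1 := LinearMap.congr_fun h (coweightIncl _ y)
  simp only [foldedFunctional, LinearMap.compl₂_apply, foldedIncl_coweightIncl] at h1
  rw [B.map_sub, LinearMap.sub_apply, h1, sub_self]

namespace IsFoldedDatum

variable {Q : RootPairing (P.foldedRoots B Θ) ℤ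
      (Module.Dual ℤ (P.foldedCoweights Θ)) (P.foldedCoweights Θ)} (hQ : P.IsFoldedDatum B Θ Q)
include hQ

lemma weightFunctional_root (β : P.foldedRoots B Θ) :
    Q.weightFunctional (Q.root β) = P.foldedFunctional B Θ β := by
  ext y
  have h1 := weightFunctional_coweightIncl (P := Q) (Q.root β) y
  rw [hQ.pairing_eq, hQ.root_eq, ← foldedIncl_coweightIncl] at h1
  exact h1

lemma foldedIncl_realCoroot (β : P.foldedRoots B Θ) :
    P.foldedIncl Θ (Q.realCoroot β) =
      (2 / B (β : CoweightSpace Y) (β : CoweightSpace Y)) • (β : CoweightSpace Y) := by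
  rw [realCoroot, foldedIncl_coweightIncl, hQ.coroot_eq]

lemma pairing_eq_form (α β : P.foldedRoots B Θ) : (Q.pairing α β : ℝ) =
    B α ((2 / B (β : CoweightSpace Y) (β : CoweightSpace Y)) • (β : CoweightSpace Y)) := by
  rw [← hQ.coroot_eq, ← hQ.root_eq, ← hQ.pairing_eq]
  rfl

lemma root_mem_closure {s : Set (P.foldedRoots B Θ)} {f : Module.Dual ℤ (P.foldedCoweights Θ)}
    {v : CoweightSpace Y} (hf : Q.weightFunctional f = P.foldedFunctional B Θ v)
    (hv : v ∈ AddSubmonoid.closure (Subtype.val '' s)) :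
    f ∈ AddSubmonoid.closure (Q.root '' s) := by
  have h := AddSubmonoid.mem_map_of_mem (P.foldedFunctional B Θ).toAddMonoidHom hv
  rw [AddMonoidHom.map_mclosure, Set.image_image] at h
  simp only [LinearMap.toAddMonoidHom_coe] at h
  rw [← AddSubmonoid.mem_map_iff_mem (f := Q.weightFunctionalHom) weightFunctional_injective,
    AddMonoidHom.map_mclosure, Set.image_image,
    show Q.weightFunctionalHom f = P.foldedFunctional B Θ v from hf]
  rwa [← Set.image_congr fun β _ ↦ hQ.weightFunctional_root β] at h

lemma coroot_mem_closure [Module.Finite ℤ Y] {s : Set (P.foldedRoots B Θ)} {y : P.foldedCoweights Θ}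
    (hy : coweightIncl Y (y : Y) ∈ AddSubmonoid.closure
      ((fun v ↦ (2 / B v v) • v) '' (Subtype.val '' s))) :
    y ∈ AddSubmonoid.closure (Q.coroot '' s) := by
  have := P.free_coweights
  rw [← AddSubmonoid.mem_map_iff_mem (f := (coweightIncl Y).comp (P.foldedCoweights Θ).subtype)
    ((coweightIncl_injective Y).comp Subtype.val_injective), AddMonoidHom.map_mclosure,
    Set.image_image]
  rw [Set.image_image] at hy
  rwa [← Set.image_congr fun β _ ↦ hQ.coroot_eq β] at hy

variable [Fintype ι] [Module.Finite ℤ Y] (hred : P.IsReduced) (hB : P.IsInvariantInner B)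
  (hΘ : P.IsAutomorphism b B Θ)
include hred hB hΘ

/-- Restricting functionals to V^{[Θ]} loses nothing on the span of the folded roots, so real
independence in V passes to the functionals and then to ℤ. -/
lemma linearIndependent_root {κ : Type*} {f : κ → P.foldedRoots B Θ}
    (hf : LinearIndependent ℝ fun k ↦ (f k : CoweightSpace Y)) :
    LinearIndependent ℤ fun k ↦ Q.root (f k) := by
  have h1 := hf.map_injOn (P.foldedFunctional B Θ) ((foldedFunctional_injOn hred hB hΘ).mono
    (Submodule.span_mono (Set.range_subset_iff.2 fun k ↦ (f k).2)))
  refine LinearIndependent.of_comp Q.weightFunctionalHom.toIntLinearMap ?_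
  rw [show Q.weightFunctionalHom.toIntLinearMap ∘ (fun k ↦ Q.root (f k)) =
    P.foldedFunctional B Θ ∘ fun k ↦ (f k : CoweightSpace Y) from
    funext fun k ↦ hQ.weightFunctional_root (f k)]
  exact h1.restrict_scalars' ℤ

lemma linearIndependent_coroot {κ : Type*} {f : κ → P.foldedRoots B Θ}
    (hf : LinearIndependent ℝ fun k ↦ (f k : CoweightSpace Y)) :
    LinearIndependent ℤ fun k ↦ Q.coroot (f k) := by
  have h1 := LinearIndependent.units_smul hf fun k ↦ Units.mk0 (2 / B (f k) (f k))
    (div_ne_zero two_ne_zero (foldedRoots_form_pos hred hB hΘ (f k).2).ne')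
  refine LinearIndependent.of_comp ((coweightIncl Y).comp
    (P.foldedCoweights Θ).subtype).toIntLinearMap ?_
  rw [show ((coweightIncl Y).comp (P.foldedCoweights Θ).subtype).toIntLinearMap ∘
    (fun k ↦ Q.coroot (f k)) = fun k ↦ (2 / B (f k) (f k)) • (f k : CoweightSpace Y) from
    funext fun k ↦ hQ.coroot_eq (f k)]
  exact h1.restrict_scalars' ℤ

/-- Dependent folded roots are proportional, and a ray contains only one of them: a positive factor
gives equal roots, a negative one opposite roots. -/
lemma isReduced : Q.IsReduced := by
  refine ⟨fun α β h ↦ ?_⟩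
  have h1 : ¬ LinearIndependent ℝ ![(α : CoweightSpace Y), (β : CoweightSpace Y)] := fun h1 ↦ by
    refine h ?_
    have h2 := hQ.linearIndependent_root hred hB hΘ (f := ![α, β])
      (by convert h1 using 1; ext k; fin_cases k <;> rfl)
    rwa [show (fun k ↦ Q.root (![α, β] k)) = ![Q.root α, Q.root β] from
      funext fun k ↦ by fin_cases k <;> rfl] at h2
  have hα := (hΘ.toAutomorphism hred hB).folded_ne_zero α.2
  rw [LinearIndependent.pair_iff' hα] at h1
  push Not at h1
  obtain ⟨c, hc⟩ := h1
  rcases lt_trichotomy c 0 with h0 | rfl | h0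
  · have h2 := (hΘ.toAutomorphism hred hB).eq_of_smul_mem_folded α.2
      ((hΘ.toAutomorphism hred hB).neg_mem_folded β.2) (neg_pos.2 h0) (by rw [← hc, neg_smul])
    right
    ext y
    have : (Q.root α y : ℝ) = -Q.root β y := by
      rw [hQ.root_eq, hQ.root_eq, ← h2, B.map_neg, LinearMap.neg_apply]
    exact_mod_cast this
  · exact absurd (by rw [← hc, zero_smul]) ((hΘ.toAutomorphism hred hB).folded_ne_zero β.2)
  · exact Or.inl (congrArg _ (Subtype.ext
      ((hΘ.toAutomorphism hred hB).eq_of_smul_mem_folded α.2 β.2 h0 hc.symm).symm))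

lemma isIrreducibleDatum (hirr : P.IsIrreducibleDatum) : Q.IsIrreducibleDatum := by
  obtain ⟨⟨i⟩, hirr⟩ := hirr
  obtain ⟨c, -, hc⟩ := (hΘ.toAutomorphism hred hB).exists_smul_avg_mem_folded i
  refine ⟨⟨⟨_, hc⟩⟩, fun s hs hs' ↦ ?_⟩
  obtain ⟨α, hα, β, hβ, h⟩ := (hΘ.toAutomorphism hred hB).irreducible_folded
    (fun t ht ht' ↦ by
      obtain ⟨j, hj, k, hk, h⟩ := hirr t ht ht'
      refine ⟨j, hj, k, hk, fun h0 ↦ h ?_⟩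
      have h1 := hB.form_rootVector_realCoroot j k
      rw [← hB.smul_rootVector, map_smul, show B (P.rootVector B j) (P.rootVector B k) = 0 from h0,
        smul_zero] at h1
      exact_mod_cast h1.symm) s hs hs'
  refine ⟨α, hα, β, hβ, fun h0 ↦ h ?_⟩
  have h1 := hQ.pairing_eq_form α β
  rw [h0, Int.cast_zero, map_smul, smul_eq_mul] at h1
  exact (mul_eq_zero.1 h1.symm).resolve_left
    (div_ne_zero two_ne_zero (foldedRoots_form_pos hred hB hΘ β.2).ne')

lemma exists_base : ∃ c : Q.Base,
    Subtype.val '' (c.support : Set (P.foldedRoots B Θ)) = P.foldedSimpleRoots b B Θ := by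
  have hfin : Finite (P.foldedRoots B Θ) := foldedRoots_finite hred hB hΘ
  set s : Set (P.foldedRoots B Θ) := Subtype.val ⁻¹' P.foldedSimpleRoots b B Θ
  have hs : Subtype.val '' s = P.foldedSimpleRoots b B Θ := by
    rw [Subtype.image_preimage_val, Set.inter_eq_right, ← toAutomorphism_foldedSimple hred hB hΘ]
    exact fun v hv ↦ hv.1
  have hli : LinearIndependent ℝ fun k : s ↦ ((k : P.foldedRoots B Θ) : CoweightSpace Y) := by
    have h := (hΘ.toAutomorphism hred hB).linearIndependent_foldedSimple
    rw [toAutomorphism_foldedSimple] at h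
    exact h.comp (fun k : s ↦ (⟨_, k.2⟩ : P.foldedSimpleRoots b B Θ)) fun k l hkl ↦
      Subtype.ext (Subtype.ext (by simpa [Subtype.ext_iff] using hkl))
  have hmem (β : P.foldedRoots B Θ) :=
    (hΘ.toAutomorphism hred hB).folded_mem_or_neg_mem_closure β.2
  simp only [toAutomorphism_foldedSimple, ← hs] at hmem
  have hs' : ((Set.toFinite s).toFinset : Set (P.foldedRoots B Θ)) = s := Set.Finite.coe_toFinset _
  refine ⟨{ support := (Set.toFinite s).toFinset
            linearIndepOn_root := ?_
            linearIndepOn_coroot := ?_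
            root_mem_or_neg_mem := fun β ↦ ?_
            coroot_mem_or_neg_mem := fun β ↦ ?_ }, ?_⟩
  · rw [hs']
    exact hQ.linearIndependent_root hred hB hΘ hli
  · rw [hs']
    exact hQ.linearIndependent_coroot hred hB hΘ hli
  · rw [hs']
    refine (hmem β).imp (fun h ↦ hQ.root_mem_closure (hQ.weightFunctional_root β) h.1)
      fun h ↦ hQ.root_mem_closure ?_ h.1
    rw [map_neg, ← hQ.weightFunctional_root]
    exact map_neg Q.weightFunctionalHom _
  · rw [hs']
    refine (hmem β).imp (fun h ↦ hQ.coroot_mem_closure ?_)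
      fun h ↦ hQ.coroot_mem_closure ?_
    · rw [hQ.coroot_eq]
      exact h.2
    · rw [AddSubgroup.coe_neg, map_neg, hQ.coroot_eq]
      exact h.2
  · rw [hs', hs]

end IsFoldedDatum

end RootPairing

/-! ### Affine Weyl groups and restriction to V^{[Θ]} -/

section AffineEquiv

lemma linearToAffine_apply {V : Type*} [AddCommGroup V] [Module ℝ V] (g : V ≃ₗ[ℝ] V) (v : V) :
    linearToAffine V g v = g v := rfl

lemma mem_translationGroup_iff {V : Type*} [AddCommGroup V] [Module ℝ V] {L : AddSubgroup V}
    {w : V ≃ᵃ[ℝ] V} : w ∈ translationGroup L ↔ ∃ l ∈ L, ∀ v, w v = v + l := by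
  constructor
  · rintro ⟨l, hl, rfl⟩
    exact ⟨_, hl, fun v ↦ add_comm _ _⟩
  · rintro ⟨l, hl, h⟩
    refine ⟨Multiplicative.ofAdd l, hl, ?_⟩
    ext v
    exact (add_comm l v).trans (h v).symm

/-- Groups of affine transformations that correspond to each other under an injection, such that
only the identity of the first one restricts to the identity, are isomorphic. -/
lemma exists_mulEquiv_of_restrict {V V' : Type*} [AddCommGroup V] [Module ℝ V]
    [AddCommGroup V'] [Module ℝ V'] {f : V' → V} (hf : Function.Injective f)
    {G : Subgroup (V ≃ᵃ[ℝ] V)} {G' : Subgroup (V' ≃ᵃ[ℝ] V')}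
    (h : ∀ w ∈ G, ∃ u ∈ G', ∀ v, f (u v) = w (f v))
    (h' : ∀ u ∈ G', ∃ w ∈ G, ∀ v, f (u v) = w (f v))
    (h1 : ∀ w ∈ G, (∀ v, w (f v) = f v) → w = 1) :
    ∃ e : G ≃* G', ∀ (w : G) v, f ((e w : V' ≃ᵃ[ℝ] V') v) = (w : V ≃ᵃ[ℝ] V) (f v) := by
  choose e he hew using h
  let e' : G →* G' := MonoidHom.mk' (fun w ↦ ⟨e w w.2, he w w.2⟩) fun w x ↦ by
    refine Subtype.ext (AffineEquiv.ext fun v ↦ hf ?_)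
    refine (hew _ _ _).trans ?_
    exact (((hew w w.2 _).trans (congrArg w.1 (hew x x.2 v)))).symm
  have hinj : Function.Injective e' := (injective_iff_map_eq_one e').2 fun w hw ↦ by
    refine Subtype.ext (h1 w w.2 fun v ↦ ?_)
    rw [← hew w w.2 v]
    exact congrArg f (congrArg (fun u : G' ↦ (u : V' ≃ᵃ[ℝ] V') v) hw)
  have hsurj : Function.Surjective e' := fun u ↦ by
    obtain ⟨w, hw, hv⟩ := h' u u.2
    exact ⟨⟨w, hw⟩, Subtype.ext (AffineEquiv.ext fun v ↦ hf ((hew w hw v).trans (hv v).symm))⟩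
  exact ⟨MulEquiv.ofBijective e' ⟨hinj, hsurj⟩, fun w v ↦ hew w w.2 v⟩

end AffineEquiv

namespace RootPairing

variable {ι X Y : Type*} [AddCommGroup X] [AddCommGroup Y] {P : RootPairing ι ℤ X Y}
  {B : LinearMap.BilinForm ℝ (CoweightSpace Y)} {b : P.Base}
  {Θ : CoweightSpace Y ≃ₗ[ℝ] CoweightSpace Y}

lemma realCoroot_mem_corootLattice (i : ι) : P.realCoroot i ∈ P.corootLattice :=
  AddSubgroup.subset_closure (Set.mem_range_self i)

lemma realReflection_mem_realWeylGroup (i : ι) : P.realReflection i ∈ P.realWeylGroup :=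
  Subgroup.subset_closure (Set.mem_range_self i)

lemma map_mem_corootLattice {g : CoweightSpace Y ≃ₗ[ℝ] CoweightSpace Y}
    (hg : g ∈ P.realWeylGroup) {l : CoweightSpace Y} (hl : l ∈ P.corootLattice) :
    g l ∈ P.corootLattice := by
  -- As an equivalence the claim passes to inverses in the induction.
  suffices ∀ l, g l ∈ P.corootLattice ↔ l ∈ P.corootLattice from (this l).2 hl
  clear hl l
  induction hg using Subgroup.closure_induction with
  | mem g hg =>
    obtain ⟨i, rfl⟩ := hg
    have h (l : CoweightSpace Y) (hl : l ∈ P.corootLattice) :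
        P.realReflection i l ∈ P.corootLattice := by
      induction hl using AddSubgroup.closure_induction with
      | mem l hl =>
        obtain ⟨j, rfl⟩ := hl
        rw [realReflection_apply, realCoroot, weightFunctional_coweightIncl,
          Int.cast_smul_eq_zsmul]
        exact sub_mem (realCoroot_mem_corootLattice j)
          (zsmul_mem (realCoroot_mem_corootLattice i) _)
      | zero => rw [map_zero]; exact zero_mem _
      | add x y _ _ hx hy => rw [map_add]; exact add_mem hx hy
      | neg x _ hx => rw [map_neg]; exact neg_mem hx
    refine fun l ↦ ⟨fun hl ↦ ?_, h l⟩
    have h2 := h _ hl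
    rwa [realReflection, Module.involutive_reflection] at h2
  | one => exact fun l ↦ Iff.rfl
  | mul g g' _ _ hg hg' => exact fun l ↦ (hg _).trans (hg' l)
  | inv g _ hg =>
    intro l
    rw [← hg]
    exact iff_of_eq (congrArg (· ∈ _) (g.apply_symm_apply l))

/-- The affine Weyl group consists of the compositions of the elements of `W_0` and the
translations by the elements of the coroot lattice. -/
lemma mem_affineWeylGroup_iff {w : CoweightSpace Y ≃ᵃ[ℝ] CoweightSpace Y} :
    w ∈ P.affineWeylGroup ↔
      ∃ l ∈ P.corootLattice, ∃ g ∈ P.realWeylGroup, ∀ v, w v = g v + l := by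
  constructor
  · intro hw
    induction hw using Subgroup.closure_induction with
    | mem w hw =>
      obtain ⟨⟨i, k⟩, rfl⟩ := hw
      refine ⟨k • P.realCoroot i, zsmul_mem (realCoroot_mem_corootLattice i) k, _,
        realReflection_mem_realWeylGroup i, fun v ↦ ?_⟩
      rw [affineReflection_apply, realReflection_apply, ← Int.cast_smul_eq_zsmul ℝ]
      module
    | one => exact ⟨0, zero_mem _, 1, one_mem _, fun v ↦ (add_zero _).symm⟩
    | mul w w' _ _ hw hw' =>
      obtain ⟨l, hl, g, hg, h⟩ := hw
      obtain ⟨l', hl', g', hg', h'⟩ := hw'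
      refine ⟨g l' + l, add_mem (map_mem_corootLattice hg hl') hl, g * g', mul_mem hg hg',
        fun v ↦ ?_⟩
      rw [AffineEquiv.mul_def, AffineEquiv.trans_apply, h', h, map_add, add_assoc]
      rfl
    | inv w _ hw =>
      obtain ⟨l, hl, g, hg, h⟩ := hw
      refine ⟨-g⁻¹ l, neg_mem (map_mem_corootLattice (inv_mem hg) hl), g⁻¹, inv_mem hg,
        fun v ↦ ?_⟩
      have h1 : g (g⁻¹ v + -g⁻¹ l) = v - l := by
        rw [map_add, map_neg, sub_eq_add_neg]
        exact congrArg₂ (fun x y ↦ x + -y) (g.apply_symm_apply v) (g.apply_symm_apply l)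
      apply w.injective
      rw [h (_ + _), h1, sub_add_cancel]
      exact w.apply_symm_apply v
  · rintro ⟨l, hl, g, hg, h⟩
    have h0 (i : ι) (k : ℤ) : P.affineReflection i k ∈ P.affineWeylGroup :=
      Subgroup.subset_closure ⟨(i, k), rfl⟩
    have hlin : linearToAffine _ g ∈ P.affineWeylGroup := by
      suffices P.realWeylGroup ≤ P.affineWeylGroup.comap (linearToAffine _) from this hg
      rw [realWeylGroup, Subgroup.closure_le]
      rintro _ ⟨i, rfl⟩
      change linearToAffine _ (P.realReflection i) ∈ P.affineWeylGroup
      convert h0 i 0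
      ext v
      rw [affineReflection_apply, linearToAffine_apply, realReflection_apply, Int.cast_zero,
        sub_zero]
    have htrans : AffineEquiv.constVAdd ℝ (CoweightSpace Y) l ∈ P.affineWeylGroup := by
      suffices P.corootLattice ≤ (P.affineWeylGroup.comap
        (AffineEquiv.constVAddHom ℝ (CoweightSpace Y))).toAddSubgroup' from this hl
      rw [corootLattice, AddSubgroup.closure_le]
      rintro _ ⟨i, rfl⟩
      change AffineEquiv.constVAdd ℝ (CoweightSpace Y) (P.realCoroot i) ∈ P.affineWeylGroup
      -- The translation by the coroot of α is s_{α,1} s_{α,0}.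
      convert mul_mem (h0 i 1) (h0 i 0)
      ext v
      rw [AffineEquiv.mul_def, AffineEquiv.trans_apply, affineReflection_apply,
        affineReflection_apply, map_sub, map_smul, weightFunctional_realCoroot]
      simp only [AffineEquiv.constVAdd_apply, vadd_eq_add, smul_eq_mul]
      push_cast
      module
    convert mul_mem htrans hlin
    ext v
    exact (h v).trans (add_comm _ _)

lemma mem_fixedWeylGroup_iff {g : CoweightSpace Y ≃ₗ[ℝ] CoweightSpace Y} :
    g ∈ P.fixedWeylGroup Θ ↔ g ∈ P.realWeylGroup ∧ Commute g Θ := by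
  rw [fixedWeylGroup, fixedUnderConj, Subgroup.mem_inf, Subgroup.mem_centralizer_singleton_iff]
  rfl

lemma mem_fixedCorootLattice_iff {l : CoweightSpace Y} :
    l ∈ P.fixedCorootLattice Θ ↔ l ∈ P.corootLattice ∧ Θ l = l := Iff.rfl

lemma map_mem_fixedCorootLattice {g : CoweightSpace Y ≃ₗ[ℝ] CoweightSpace Y}
    (hg : g ∈ P.fixedWeylGroup Θ) {l : CoweightSpace Y} (hl : l ∈ P.fixedCorootLattice Θ) :
    g l ∈ P.fixedCorootLattice Θ := by
  rw [mem_fixedWeylGroup_iff] at hg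
  rw [mem_fixedCorootLattice_iff] at hl ⊢
  refine ⟨map_mem_corootLattice hg.1 hl.1, ?_⟩
  have h := LinearEquiv.congr_fun hg.2.eq l
  rw [LinearEquiv.mul_apply, LinearEquiv.mul_apply, hl.2] at h
  exact h.symm

/-- Commutation with Θ evaluated at the origin shows that the translation part is fixed; cancelling
it leaves commutation of the linear part. -/
lemma mem_fixedAffineWeylGroup_iff {w : CoweightSpace Y ≃ᵃ[ℝ] CoweightSpace Y} :
    w ∈ P.fixedAffineWeylGroup Θ ↔
      ∃ l ∈ P.fixedCorootLattice Θ, ∃ g ∈ P.fixedWeylGroup Θ, ∀ v, w v = g v + l := by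
  rw [fixedAffineWeylGroup, fixedUnderConj, Subgroup.mem_inf,
    Subgroup.mem_centralizer_singleton_iff, mem_affineWeylGroup_iff]
  constructor
  · rintro ⟨⟨l, hl, g, hg, h⟩, hc⟩
    have hc' (v) : w (Θ v) = Θ (w v) := DFunLike.congr_fun hc v
    have hl' : Θ l = l := by
      have := hc' 0
      rw [map_zero, h, map_zero, zero_add] at this
      exact this.symm
    refine ⟨l, ⟨hl, hl'⟩, g, mem_fixedWeylGroup_iff.2 ⟨hg, LinearEquiv.ext fun v ↦ ?_⟩, h⟩
    have := hc' v
    rw [h, h, map_add, hl'] at this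
    exact add_right_cancel this
  · rintro ⟨l, ⟨hl, hl'⟩, g, hg, h⟩
    rw [mem_fixedWeylGroup_iff] at hg
    refine ⟨⟨l, hl, g, hg.1, h⟩, AffineEquiv.ext fun v ↦ ?_⟩
    change w (Θ v) = Θ (w v)
    have h1 : g (Θ v) = Θ (g v) := LinearEquiv.congr_fun hg.2.eq v
    rw [h, h, map_add, h1]
    exact congrArg _ hl'.symm

lemma isInternalSemidirect_fixedAffineWeylGroup (P : RootPairing ι ℤ X Y)
    (Θ : CoweightSpace Y ≃ₗ[ℝ] CoweightSpace Y) :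
    IsInternalSemidirect (translationGroup (P.fixedCorootLattice Θ))
      ((P.fixedWeylGroup Θ).map (linearToAffine (CoweightSpace Y)))
      (P.fixedAffineWeylGroup Θ) := by
  refine ⟨fun w hw ↦ ?_, ?_, ⟨?_⟩, Subgroup.isComplement'_of_disjoint_and_mul_eq_univ ?_ ?_⟩
  · obtain ⟨l, hl, h⟩ := mem_translationGroup_iff.1 hw
    exact mem_fixedAffineWeylGroup_iff.2 ⟨l, hl, 1, one_mem _, h⟩
  · rintro _ ⟨g, hg, rfl⟩
    exact mem_fixedAffineWeylGroup_iff.2 ⟨0, zero_mem _, g, hg, fun v ↦ (add_zero _).symm⟩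
  · rintro ⟨n, hn'⟩ hn ⟨w, hw⟩
    rw [Subgroup.mem_subgroupOf] at hn ⊢
    obtain ⟨l, hl, h⟩ := mem_translationGroup_iff.1 hn
    obtain ⟨l', hl', g, hg, hw'⟩ := mem_fixedAffineWeylGroup_iff.1 hw
    refine mem_translationGroup_iff.2 ⟨g l, map_mem_fixedCorootLattice hg hl, fun v ↦ ?_⟩
    obtain ⟨v, rfl⟩ := w.surjective v
    change w (n (w.symm (w v))) = w v + g l
    have hn2 : n v = v + l := h v
    rw [AffineEquiv.symm_apply_apply, hn2, hw', hw', map_add]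
    abel
  · rw [Subgroup.disjoint_def]
    rintro ⟨w, hw⟩ h ⟨g, hg, hgw⟩
    obtain ⟨l, hl, h⟩ := mem_translationGroup_iff.1 h
    have h' (v) : g v = v + l := (DFunLike.congr_fun hgw v).trans (h v)
    have h0 := h' 0
    rw [map_zero, zero_add] at h0
    refine Subtype.ext (AffineEquiv.ext fun v ↦ (h v).trans ?_)
    rw [← h0, add_zero]
    rfl
  · refine Set.eq_univ_of_forall fun ⟨w, hw⟩ ↦ ?_
    obtain ⟨l, hl, g, hg, h⟩ := mem_fixedAffineWeylGroup_iff.1 hw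
    refine Set.mem_mul.2 ⟨⟨AffineEquiv.constVAdd ℝ _ l, mem_fixedAffineWeylGroup_iff.2
      ⟨l, hl, 1, one_mem _, fun v ↦ add_comm _ _⟩⟩, ?_, ⟨linearToAffine _ g,
      mem_fixedAffineWeylGroup_iff.2 ⟨0, zero_mem _, g, hg, fun v ↦ (add_zero _).symm⟩⟩, ?_, ?_⟩
    · exact mem_translationGroup_iff.2 ⟨l, hl, fun v ↦ add_comm _ _⟩
    · exact ⟨g, hg, rfl⟩
    · exact Subtype.ext (AffineEquiv.ext fun v ↦ (add_comm _ _).trans (h v).symm)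

namespace IsFoldedDatum

variable {Q : RootPairing (P.foldedRoots B Θ) ℤ
      (Module.Dual ℤ (P.foldedCoweights Θ)) (P.foldedCoweights Θ)} (hQ : P.IsFoldedDatum B Θ Q)
  [Fintype ι] [Module.Finite ℤ Y] (hred : P.IsReduced) (hB : P.IsInvariantInner B)
  (hΘ : P.IsAutomorphism b B Θ)
include hQ hred hB hΘ

lemma foldedIncl_realReflection (β : P.foldedRoots B Θ) {i : ι}
    {w : CoweightSpace Y ≃ₗ[ℝ] CoweightSpace Y}
    (hβ : (hΘ.toAutomorphism hred hB).avg ((P.toBasedRootSystem hred b hB).root i) = β)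
    (hw : (hΘ.toAutomorphism hred hB).IsOrbitReflection i w) (v) :
    P.foldedIncl Θ (Q.realReflection β v) = w (P.foldedIncl Θ v) := by
  have h := hw.apply_of_fixed (by rw [hβ]; exact β.2) (form_foldedIncl hB v)
  rw [hβ] at h
  rw [h, realReflection_apply, map_sub, map_smul, hQ.weightFunctional_root,
    hQ.foldedIncl_realCoroot]
  rfl

/-- The orbit reflections generate W_0^Θ, and each restricts to the reflection in a folded root. -/
lemma exists_mem_realWeylGroup {g : CoweightSpace Y ≃ₗ[ℝ] CoweightSpace Y}
    (hg : g ∈ P.fixedWeylGroup Θ) :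
    ∃ h ∈ Q.realWeylGroup, ∀ v, P.foldedIncl Θ (h v) = g (P.foldedIncl Θ v) := by
  rw [mem_fixedWeylGroup_iff, ← toBasedRootSystem_weyl hred (b := b) hB] at hg
  have h := (hΘ.toAutomorphism hred hB).mem_closure_of_commute hg.1 hg.2
  clear hg
  induction h using Subgroup.closure_induction with
  | mem g hg =>
    obtain ⟨i, hi, hg⟩ := hg
    exact ⟨Q.realReflection ⟨_, hi⟩, realReflection_mem_realWeylGroup _,
      hQ.foldedIncl_realReflection hred hB hΘ ⟨_, hi⟩ rfl hg⟩
  | one => exact ⟨1, one_mem _, fun v ↦ rfl⟩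
  | mul g g' _ _ hg hg' =>
    obtain ⟨h, hh, hg⟩ := hg
    obtain ⟨h', hh', hg'⟩ := hg'
    exact ⟨h * h', mul_mem hh hh', fun v ↦ (hg _).trans (congrArg g (hg' v))⟩
  | inv g _ hg =>
    obtain ⟨h, hh, hg⟩ := hg
    refine ⟨h⁻¹, inv_mem hh, fun v ↦ g.injective ?_⟩
    rw [← hg]
    exact (congrArg _ (h.apply_symm_apply v)).trans (g.apply_symm_apply _).symm

lemma exists_mem_fixedWeylGroup {h} (hh : h ∈ Q.realWeylGroup) :
    ∃ g ∈ P.fixedWeylGroup Θ, ∀ v, P.foldedIncl Θ (h v) = g (P.foldedIncl Θ v) := by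
  induction hh using Subgroup.closure_induction with
  | mem h hh =>
    obtain ⟨β, rfl⟩ := hh
    obtain ⟨⟨i, hi⟩, -⟩ := (hΘ.toAutomorphism hred hB).mem_folded_iff.1 β.2
    obtain ⟨w, hw⟩ := (hΘ.toAutomorphism hred hB).exists_isOrbitReflection
      (i := i) (by rw [hi]; exact β.2)
    refine ⟨w, mem_fixedWeylGroup_iff.2 ⟨?_, hw.commute⟩,
      hQ.foldedIncl_realReflection hred hB hΘ β hi hw⟩
    rw [← toBasedRootSystem_weyl hred (b := b) hB]
    exact hw.mem_weyl
  | one => exact ⟨1, one_mem _, fun v ↦ rfl⟩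
  | mul h h' _ _ hh hh' =>
    obtain ⟨g, hg, hh⟩ := hh
    obtain ⟨g', hg', hh'⟩ := hh'
    exact ⟨g * g', mul_mem hg hg', fun v ↦ (hh _).trans (congrArg g (hh' v))⟩
  | inv h _ hh =>
    obtain ⟨g, hg, hh⟩ := hh
    refine ⟨g⁻¹, inv_mem hg, fun v ↦ g.injective ?_⟩
    rw [← hh]
    exact (congrArg _ (h.apply_symm_apply v)).trans (g.apply_symm_apply _).symm

/-- The simple folded coroots already generate the fixed lattice. -/
lemma exists_mem_corootLattice {l : CoweightSpace Y} (hl : l ∈ P.fixedCorootLattice Θ) :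
    ∃ m ∈ Q.corootLattice, P.foldedIncl Θ m = l := by
  rw [mem_fixedCorootLattice_iff, ← toBasedRootSystem_corootLattice hred (b := b) hB] at hl
  have h := (hΘ.toAutomorphism hred hB).mem_closure_of_mem_corootLattice hl.1 hl.2
  suffices AddSubgroup.closure _ ≤ Q.corootLattice.map (P.foldedIncl Θ).toAddMonoidHom from this h
  rw [AddSubgroup.closure_le]
  rintro _ ⟨β, hβ, rfl⟩
  exact ⟨Q.realCoroot ⟨β, hβ.1⟩, realCoroot_mem_corootLattice _,
    hQ.foldedIncl_realCoroot ⟨β, hβ.1⟩⟩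

lemma foldedIncl_mem_fixedCorootLattice {m} (hm : m ∈ Q.corootLattice) :
    P.foldedIncl Θ m ∈ P.fixedCorootLattice Θ := by
  suffices Q.corootLattice ≤ (P.fixedCorootLattice Θ).comap (P.foldedIncl Θ).toAddMonoidHom from
    this hm
  rw [corootLattice, AddSubgroup.closure_le]
  rintro _ ⟨β, rfl⟩
  change P.foldedIncl Θ (Q.realCoroot β) ∈ P.fixedCorootLattice Θ
  rw [hQ.foldedIncl_realCoroot, mem_fixedCorootLattice_iff]
  refine ⟨?_, (hΘ.toAutomorphism hred hB).dualVector_fixed β.2⟩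
  obtain ⟨⟨i, hi⟩, -⟩ := (hΘ.toAutomorphism hred hB).mem_folded_iff.1 β.2
  have h := (hΘ.toAutomorphism hred hB).folded_coroot (i := i) (by rw [hi]; exact β.2)
  rw [hi] at h
  refine h.symm ▸ sum_mem fun j _ ↦ toBasedRootSystem_coroot hred (b := b) hB j ▸
    realCoroot_mem_corootLattice j

/-- The origin shows that w is linear. The average of a simple root is proportional to a folded
coroot, so g fixes it; as averaging commutes with g and preserves height, g keeps every simple root
at height one and is trivial. -/
lemma eq_one_of_fixes_range {w : CoweightSpace Y ≃ᵃ[ℝ] CoweightSpace Y}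
    (hw : w ∈ P.fixedAffineWeylGroup Θ)
    (h : ∀ v, w (P.foldedIncl Θ v) = P.foldedIncl Θ v) : w = 1 := by
  obtain ⟨l, -, g, hg, hwg⟩ := mem_fixedAffineWeylGroup_iff.1 hw
  have hl : l = 0 := by
    have := h 0
    rwa [map_zero, hwg, map_zero, zero_add] at this
  have hgv (v) : g (P.foldedIncl Θ v) = P.foldedIncl Θ v := by
    have := h v
    rwa [hwg, hl, add_zero] at this
  rw [mem_fixedWeylGroup_iff, ← toBasedRootSystem_weyl hred (b := b) hB] at hg
  have hg1 : g = 1 := by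
    refine (P.toBasedRootSystem hred b hB).eq_one_of_forall_height_pos hg.1 fun i hi ↦ ?_
    set T := hΘ.toAutomorphism hred hB
    obtain ⟨c, hc, hci⟩ := T.exists_smul_avg_mem_folded i
    have h1 := hgv (Q.realCoroot ⟨_, hci⟩)
    rw [hQ.foldedIncl_realCoroot, map_smul] at h1
    have h2 := smul_right_injective _ (div_pos two_pos (foldedRoots_form_pos hred hB hΘ hci)).ne' h1
    have h3 : g (T.avg ((P.toBasedRootSystem hred b hB).root i)) = _ :=
      smul_right_injective _ (one_pos.trans_le hc).ne' ((map_smul g _ _).symm.trans h2)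
    rw [← T.avg_commute hg.2] at h3
    have h4 := T.height_avg_simple hi
    obtain ⟨k, hk⟩ := (P.toBasedRootSystem hred b hB).exists_weyl_root hg.1 i
    rw [← h3, ← hk, T.height_avg, hk] at h4
    rw [h4]
    exact one_pos
  refine AffineEquiv.ext fun v ↦ ?_
  rw [hwg, hl, hg1, add_zero]
  rfl

lemma exists_mulEquiv_affineWeylGroup : ∃ e : P.fixedAffineWeylGroup Θ ≃* Q.affineWeylGroup,
    ∀ (w : P.fixedAffineWeylGroup Θ) (v : CoweightSpace (P.foldedCoweights Θ)),
      P.foldedIncl Θ ((e w : CoweightSpace (P.foldedCoweights Θ) ≃ᵃ[ℝ] _) v) =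
        (w : CoweightSpace Y ≃ᵃ[ℝ] CoweightSpace Y) (P.foldedIncl Θ v) := by
  have := P.free_coweights
  refine exists_mulEquiv_of_restrict foldedIncl_injective (fun w hw ↦ ?_) (fun u hu ↦ ?_)
    fun w hw ↦ hQ.eq_one_of_fixes_range hred hB hΘ hw
  · obtain ⟨l, hl, g, hg, h⟩ := mem_fixedAffineWeylGroup_iff.1 hw
    obtain ⟨m, hm, rfl⟩ := hQ.exists_mem_corootLattice hred hB hΘ hl
    obtain ⟨k, hk, hkg⟩ := hQ.exists_mem_realWeylGroup hred hB hΘ hg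
    refine ⟨k.toAffineEquiv.trans (AffineEquiv.constVAdd ℝ _ m),
      mem_affineWeylGroup_iff.2 ⟨m, hm, k, hk, fun v ↦ add_comm _ _⟩, fun v ↦ ?_⟩
    rw [h, ← hkg, ← map_add]
    exact congrArg _ (add_comm _ _)
  · obtain ⟨m, hm, k, hk, h⟩ := mem_affineWeylGroup_iff.1 hu
    obtain ⟨g, hg, hkg⟩ := hQ.exists_mem_fixedWeylGroup hred hB hΘ hk
    refine ⟨g.toAffineEquiv.trans (AffineEquiv.constVAdd ℝ _ (P.foldedIncl Θ m)),
      mem_fixedAffineWeylGroup_iff.2 ⟨_, hQ.foldedIncl_mem_fixedCorootLattice hred hB hΘ hm, g, hg,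
        fun v ↦ add_comm _ _⟩, fun v ↦ ?_⟩
    rw [h, map_add, hkg]
    exact add_comm _ _

end IsFoldedDatum

end RootPairing

end

theorem proposition9p1 {ι X Y : Type*} [Finite ι] [AddCommGroup X] [AddCommGroup Y]
    [Module.Finite ℤ X] [Module.Finite ℤ Y]
    (P : RootPairing ι ℤ X Y) (hred : P.IsReduced) (hirr : P.IsIrreducibleDatum) (b : P.Base)
    (B : LinearMap.BilinForm ℝ (CoweightSpace Y)) (hB : P.IsInvariantInner B)
    (Θ : CoweightSpace Y ≃ₗ[ℝ] CoweightSpace Y) (hΘ : P.IsAutomorphism b B Θ) :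
    (P.foldedRoots B Θ).Finite ∧
    Module.Finite ℤ (P.foldedCoweights Θ) ∧
    Module.Finite ℤ (Module.Dual ℤ (P.foldedCoweights Θ)) ∧
    ∃ Q : RootPairing (P.foldedRoots B Θ) ℤ
        (Module.Dual ℤ (P.foldedCoweights Θ)) (P.foldedCoweights Θ),
      P.IsFoldedDatum B Θ Q ∧
      Q.IsReduced ∧
      Q.IsIrreducibleDatum ∧
      (∃ c : Q.Base,
        Subtype.val '' (c.support : Set (P.foldedRoots B Θ)) = P.foldedSimpleRoots b B Θ) ∧
      IsInternalSemidirect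
        (translationGroup (P.fixedCorootLattice Θ))
        ((P.fixedWeylGroup Θ).map (linearToAffine (CoweightSpace Y)))
        (P.fixedAffineWeylGroup Θ) ∧
      Function.Injective (P.foldedIncl Θ) ∧
      ∃ e : P.fixedAffineWeylGroup Θ ≃* Q.affineWeylGroup,
        ∀ (w : P.fixedAffineWeylGroup Θ) (v : CoweightSpace (P.foldedCoweights Θ)),
          P.foldedIncl Θ ((e w : CoweightSpace (P.foldedCoweights Θ) ≃ᵃ[ℝ] _) v) =
            (w : CoweightSpace Y ≃ᵃ[ℝ] CoweightSpace Y) (P.foldedIncl Θ v) := by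
  have := Fintype.ofFinite ι
  have := P.free_coweights
  obtain ⟨Q, hQ⟩ := RootPairing.exists_foldedDatum hred hB hΘ
  exact ⟨RootPairing.foldedRoots_finite hred hB hΘ, inferInstance, inferInstance, Q, hQ,
    hQ.isReduced hred hB hΘ, hQ.isIrreducibleDatum hred hB hΘ hirr, hQ.exists_base hred hB hΘ,
    RootPairing.isInternalSemidirect_fixedAffineWeylGroup P Θ, RootPairing.foldedIncl_injective,
    hQ.exists_mulEquiv_affineWeylGroup hred hB hΘ⟩
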